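/- **Setting.** An aggregator coordinates $N$ electric vehicles (EVs) in slots $t=0,1,2,\dots$. The system state $A_t$ is a Markov chain on a finite set with an irreducible aperiodic transition matrix. It determines the regulation signal $G_t\in\mathbb R$ and the unit costs $e_{s,t},e_{d,t}\in[e_{\min},e_{\max}]$ ($e_{\max}\ge 0$). Put $\mathbf 1_{d,t}=1$ if $G_t>0$ and $0$ otherwise, $\mathbf 1_{u,t}=1$ if $G_t<0$ and $0$ otherwise. The indicator $\mathbf 1_{i,t}$ that EV $i$ is in the system in slot $t$ is a function of $t$ and $A_t$ (random dynamics: of $A_t$ only; predictable dynamics: of $t$ only), and $\mathbf 1_{i,0}=1$. A slot $t$ is a returning slot of EV $i$ if $\mathbf 1_{i,t}=1$ and either $t=0$ or $\mathbf 1_{i,t-1}=0$; it is a leaving slot if $t\ge1$, $\mathbf 1_{i,t}=0$ and $\mathbf 1_{i,t-1}=1$. Let $t_{ir,k}$, $t_{il,k}$ be the $k$-th returning and leaving slots ($k\ge 1$). EV $i$ has a preferred energy range $[s_{i,\min},s_{i,\max}]$ with $0\le s_{i,\min}<s_{i,\max}\le s_{i,\mathrm{cap}}$ ($s_{i,\mathrm{cap}}$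 the battery capacity), a bound $x_{i,\max}>0$ on its regulation amount per slot, a weight $\omega_i>0$, and a cost function $C_i$ that is convex, continuous and non-decreasing on $[0,x_{i,\max}]$ with $C_i(0)=0$, $0\le C_i\le c_{i,\max}$, and a bound $c_{i,\mathrm{up}}\in[0,c_{i,\max}]$. The utility $U$ is concave, continuous and non-decreasing on $[0,\max_i x_{i,\max}]$ with $U(0)=0$ and $U(x)\le \mu x$ there, for some $\mu>0$. An allocation policy chooses, possibly at random, the regulation down and up amounts $x_{id,t},x_{iu,t}$ from the past and the present; given all of this, $A_{t+1}$ is distributed according to row $A_t$ of the transition matrix. Put $b_{i,t}=\mathbf 1_{d,t}x_{id,t}-\mathbf 1_{u,t}x_{iu,t}$ and $x_{i,t}=\mathbf 1_{d,t}x_{id,t}+\mathbf 1_{u,t}x_{iu,t}$. The energy states satisfy $s_{i,t+1}=s_{i,t}+b_{i,t}$ if $\mathbf 1_{i,t}=1$, and $s_{i,t}\in[s_{i,\min},s_{i,\max}]$ at the returning slots $t$. With $\Delta_{i,k}=s_{i,t_{ir,k+1}}-s_{i,t_{il,k}}$ ($\Delta_{i,k}=0$ if there is no $(k+1)$-th return),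 assume for all $i,k$ that (A1) $|\Delta_{i,k}|\le\Delta_{i,\max}$ and (A2) $\mathbb E[\Delta_{i,k}]=0$. **Problem P1.** A policy is feasible if for all $i,t$ $$0\le x_{id,t}\le \mathbf 1_{i,t}\min\{x_{i,\max},s_{i,\max}-s_{i,t}\},\qquad 0\le x_{iu,t}\le \mathbf 1_{i,t}\min\{x_{i,\max},s_{i,t}-s_{i,\min}\},$$ $$\sum_i x_{id,t}\le \mathbf 1_{d,t}G_t,\qquad \sum_i x_{iu,t}\le \mathbf 1_{u,t}|G_t|,$$ $$\limsup_{T\to\infty}\frac1T\sum_{t<T}\mathbb E[\mathbf 1_{d,t}C_i(x_{id,t})+\mathbf 1_{u,t}C_i(x_{iu,t})]\le c_{i,\mathrm{up}}.$$ Its welfare up to $T$ is $W_T=\sum_i\omega_iU\big(\frac1T\sum_{t<T}\mathbb E[x_{i,t}]\big)-\frac1T\sum_{t<T}\mathbb E[e_t]$, where $e_t=\mathbf 1_{d,t}e_{s,t}(G_t-\sum_i x_{id,t})+\mathbf 1_{u,t}e_{d,t}(|G_t|-\sum_i x_{iu,t})$. P1 is to maximize the long-term welfare $\lim_{T\to\infty}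 W_T$ over the feasible policies. **WMRA.** Let $V_{\max}=\min_i\frac{s_{i,\max}-s_{i,\min}-4x_{i,\max}}{2(\omega_i\mu+e_{\max})}$, $V\in(0,V_{\max}]$ and $c_i=s_{i,\min}+2x_{i,\max}+V(\omega_i\mu+e_{\max})$. Virtual queues start from $J_{i,0}=H_{i,0}=0$ and evolve by $J_{i,t+1}=\max\{J_{i,t}+\mathbf 1_{d,t}C_i(x_{id,t})+\mathbf 1_{u,t}C_i(x_{iu,t})-c_{i,\mathrm{up}},0\}$ and $H_{i,t+1}=H_{i,t}+z_{i,t}-x_{i,t}$, while $K_{i,t}=s_{i,t}-c_i$ if $t$ is a returning slot of EV $i$ and $K_{i,t}=K_{i,t-1}+b_{i,t-1}$ otherwise. In each slot, WMRA takes for $z_{i,t}$ any minimizer of $H_{i,t}z-\omega_iVU(z)$ over $z\in[0,x_{i,\max}]$. If $G_t>0$, it takes for $(x_{id,t})_i$ any minimizer of $$Ve_{s,t}\Big(G_t-\sum_i y_i\Big)-\sum_iH_{i,t}y_i+\sum_iJ_{i,t}C_i(y_i)+\sum_iK_{i,t}y_i$$ subject to $0\le y_i\le\mathbf 1_{i,t}x_{i,\max}$,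 $\sum_iy_i\le |G_t|$; if $G_t<0$, it takes for $(x_{iu,t})_i$ any minimizer, under the same constraints, of $$Ve_{d,t}\Big(|G_t|-\sum_i y_i\Big)-\sum_iH_{i,t}y_i+\sum_iJ_{i,t}C_i(y_i)-\sum_iK_{i,t}y_i .$$ All other amounts are $0$. With $\Theta_t=(J_{i,t},H_{i,t},K_{i,t})_i$, assume under WMRA (A3): given $\Theta_t$ for $t=t_{ir,k+1}-1$, the conditional mean of $\Delta_{i,k}$ is $0$, i.e. $\mathbb E[\Delta_{i,k}\mathbf 1\{t_{ir,k+1}=t+1\}\mid\Theta_t]=0$ for all $i,k,t$. **Theorem 2.** Under A1–A3: 1. The WMRA allocations are feasible for P1. 2. Suppose that the EVs have random dynamics or regular predictable dynamics, that is, for some $p\ge1$ the function giving $\mathbf 1_{i,t}$ from $(t,A_t)$ is $p$-periodic in $t$ for each $i$. Then there is a constant $C$, independent of $V$, of the battery capacities and energy ranges and of the initial conditions, such that for every $V\in(0,V_{\max}]$ and every policy that is feasible for P1, with welfare $W_T$, the welfare $\tilde W_T$ of WMRA satisfies $$\liminf_{T\to\infty}\tilde W_T\ \ge\ \limsup_{T\to\infty}W_T-\frac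 CV .$$ In particular the welfare of WMRA is within $O(1/V)$ of the optimum of P1. -/

import Mathlib

open MeasureTheory Filter

noncomputable section

namespace V2G

/-- The time-homogeneous data of an aggregator with `N` electric vehicles (EVs), except for the
battery ranges. `S` is the finite set of values of the system state `A_t`.

`part t a i` says that EV `i` is in the system in slot `t` when `A_t = a`. EVs with random dynamics
(where the participation vector is a component of `A_t`) are the case where `part` does not depend
on `t`; EVs with predictable dynamics are the case where `part` does not depend on `a`. -/
structure Model (N : ℕ) (S : Type*) [Fintype S] [DecidableEq S] where
  /-- transition matrix of the system state -/
  P : Matrix S S ℝ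
  P_stochastic : P ∈ Matrix.rowStochastic ℝ S
  /-- regulation signal -/
  G : S → ℝ
  /-- unit cost of clearing an energy surplus -/
  es : S → ℝ
  /-- unit cost of clearing an energy deficit -/
  ed : S → ℝ
  eMin : ℝ
  eMax : ℝ
  eMax_nonneg : 0 ≤ eMax
  es_mem : ∀ a, es a ∈ Set.Icc eMin eMax
  ed_mem : ∀ a, ed a ∈ Set.Icc eMin eMax
  part : ℕ → S → Fin N → Prop
  /-- bound on the regulation amount of an EV in one slot -/
  xMax : Fin N → ℝ
  xMax_pos : ∀ i, 0 < xMax i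
  /-- degradation cost functions, their upper bounds, and the bounds on the average cost -/
  C : Fin N → ℝ → ℝ
  cMax : Fin N → ℝ
  cUp : Fin N → ℝ
  C_zero : ∀ i, C i 0 = 0
  C_mem : ∀ i, ∀ x ∈ Set.Icc 0 (xMax i), C i x ∈ Set.Icc 0 (cMax i)
  C_convex : ∀ i, ConvexOn ℝ (Set.Icc 0 (xMax i)) (C i)
  C_cont : ∀ i, ContinuousOn (C i) (Set.Icc 0 (xMax i))
  C_mono : ∀ i, MonotoneOn (C i) (Set.Icc 0 (xMax i))
  cUp_mem : ∀ i, cUp i ∈ Set.Icc 0 (cMax i)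
  /-- weights of the EVs -/
  ω : Fin N → ℝ
  ω_pos : ∀ i, 0 < ω i
  /-- utility function -/
  U : ℝ → ℝ
  U_zero : U 0 = 0
  U_concave : ConcaveOn ℝ (Set.Icc 0 (⨆ i, xMax i)) U
  U_cont : ContinuousOn U (Set.Icc 0 (⨆ i, xMax i))
  U_mono : MonotoneOn U (Set.Icc 0 (⨆ i, xMax i))
  μ : ℝ
  μ_pos : 0 < μ
  U_le : ∀ x ∈ Set.Icc 0 (⨆ i, xMax i), U x ≤ U 0 + μ * x
  /-- bound on the energy change of an EV during an absence -/
  ΔMax : Fin N → ℝ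
  ΔMax_nonneg : ∀ i, 0 ≤ ΔMax i

/-- Every state has period one: `1` is the only common divisor of the possible return times. -/
def Aperiodic {S : Type*} [Fintype S] [DecidableEq S] (P : Matrix S S ℝ) : Prop :=
  ∀ a, ∀ d : ℕ, (∀ n, 0 < n → 0 < (P ^ n) a a → d ∣ n) → d = 1

variable {N : ℕ} {S : Type*} [Fintype S] [DecidableEq S]

/-- Battery capacities and preferred energy ranges. -/
structure Battery (N : ℕ) where
  sMin : Fin N → ℝ
  sMax : Fin N → ℝ
  sCap : Fin N → ℝ
  sMin_nonneg : ∀ i, 0 ≤ sMin i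
  sMin_lt : ∀ i, sMin i < sMax i
  sMax_le : ∀ i, sMax i ≤ sCap i

/-- The largest admissible value of the parameter `V`. -/
def vMax (M : Model N S) (B : Battery N) : ℝ :=
  ⨅ i, (B.sMax i - B.sMin i - 4 * M.xMax i) / (2 * (M.ω i * M.μ + M.eMax))

/-- The shift `c_i` between the energy state and the virtual queue `K_i`. -/
def shift (M : Model N S) (B : Battery N) (V : ℝ) (i : Fin N) : ℝ :=
  B.sMin i + 2 * M.xMax i + V * (M.ω i * M.μ + M.eMax)

/-- Indicator of regulation down. -/
def Model.down (M : Model N S) (a : S) : ℝ := if 0 < M.G a then 1 else 0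

/-- Indicator of regulation up. -/
def Model.up (M : Model N S) (a : S) : ℝ := if M.G a < 0 then 1 else 0

/-- The system operated under some allocation policy, as stochastic processes on a probability
space: system state `A`, energy states `s`, regulation down and up amounts `xd`, `xu`.
The policy may be randomized and history dependent: `ℱ t` holds all that has been decided
or observed when the energy of slot `t` is delivered. -/
structure Operation (M : Model N S) (B : Battery N) {Ω : Type*} [mΩ : MeasurableSpace Ω]
    (ℙ : Measure Ω) where
  ℱ : Filtration ℕ mΩ
  A : ℕ → Ω → S
  s : Fin N → ℕ → Ω → ℝ
  xd : Fin N → ℕ → Ω → ℝ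
  xu : Fin N → ℕ → Ω → ℝ
  A_adapted : ∀ t a, MeasurableSet[ℱ t] {ω | A t ω = a}
  s_adapted : ∀ i t, Measurable[ℱ t] (s i t)
  xd_adapted : ∀ i t, Measurable[ℱ t] (xd i t)
  xu_adapted : ∀ i t, Measurable[ℱ t] (xu i t)
  /-- `A` is a Markov chain with transition matrix `P` -/
  markov : ∀ t b,
    ℙ[Set.indicator {ω | A (t + 1) ω = b} (fun _ => (1 : ℝ)) | ℱ t] =ᵐ[ℙ] fun ω => M.P (A t ω) b
  /-- all EVs are in the system initially -/
  initial : ∀ i ω, M.part 0 (A 0 ω) i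
  /-- energy dynamics of an EV that is in the system -/
  energy : ∀ i t ω, M.part t (A t ω) i →
    s i (t + 1) ω = s i t ω + (M.down (A t ω) * xd i t ω - M.up (A t ω) * xu i t ω)
  /-- returning energy states (the initial one included) lie in the preferred range -/
  returning : ∀ i t ω, M.part t (A t ω) i → (∀ r, t = r + 1 → ¬ M.part r (A r ω) i) →
    s i t ω ∈ Set.Icc (B.sMin i) (B.sMax i)

namespace Operation

variable {M : Model N S} {B : Battery N} {Ω : Type*} [mΩ : MeasurableSpace Ω] {ℙ : Measure Ω}
  (X : Operation M B ℙ)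

/-- EV `i` is in the system in slot `t`. -/
def Present (i : Fin N) (t : ℕ) (ω : Ω) : Prop := M.part t (X.A t ω) i

open Classical in
/-- Indicator of the presence of EV `i` in slot `t`. -/
def ind (i : Fin N) (t : ℕ) (ω : Ω) : ℝ := if X.Present i t ω then 1 else 0

/-- `t` is a returning slot of EV `i` (slot `0` counts as one). -/
def IsReturn (i : Fin N) (ω : Ω) (t : ℕ) : Prop :=
  X.Present i t ω ∧ ∀ r, t = r + 1 → ¬ X.Present i r ω

/-- `t` is a leaving slot of EV `i`: its first slot out of the system. -/
def IsLeave (i : Fin N) (ω : Ω) (t : ℕ) : Prop :=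
  ¬ X.Present i t ω ∧ ∃ r, t = r + 1 ∧ X.Present i r ω

/-- The returning slots in increasing order, numbered from `0`, so that `returnTime i 0 = 0`.
The value is `0` at a positive `k` if there are at most `k` returning slots. -/
def returnTime (i : Fin N) (k : ℕ) (ω : Ω) : ℕ := Nat.nth (X.IsReturn i ω) k

/-- The leaving slots in increasing order, numbered from `0`. -/
def leaveTime (i : Fin N) (k : ℕ) (ω : Ω) : ℕ := Nat.nth (X.IsLeave i ω) k

/-- The energy change of EV `i` during its `k`-th absence (numbered from `0`),
set to `0` if the EV does not return from a `k`-th absence. -/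
def gap (i : Fin N) (k : ℕ) (ω : Ω) : ℝ :=
  if 0 < X.returnTime i (k + 1) ω then
    X.s i (X.returnTime i (k + 1) ω) ω - X.s i (X.leaveTime i k ω) ω
  else 0

/-- A1: energy changes during absences are bounded. -/
def A1 : Prop := ∀ i k ω, |X.gap i k ω| ≤ M.ΔMax i

/-- A2: energy changes during absences have mean zero. -/
def A2 : Prop := ∀ i k, ∫ ω, X.gap i k ω ∂ℙ = 0

/-- Effective charging or discharging amount. -/
def b (i : Fin N) (t : ℕ) (ω : Ω) : ℝ :=
  M.down (X.A t ω) * X.xd i t ω - M.up (X.A t ω) * X.xu i t ω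

/-- Regulation amount allocated to EV `i`. -/
def x (i : Fin N) (t : ℕ) (ω : Ω) : ℝ :=
  M.down (X.A t ω) * X.xd i t ω + M.up (X.A t ω) * X.xu i t ω

/-- Degradation cost of EV `i` in slot `t`. -/
def deg (i : Fin N) (t : ℕ) (ω : Ω) : ℝ :=
  M.down (X.A t ω) * M.C i (X.xd i t ω) + M.up (X.A t ω) * M.C i (X.xu i t ω)

/-- Cost of the external energy sources in slot `t`. -/
def e (t : ℕ) (ω : Ω) : ℝ :=
  M.down (X.A t ω) * M.es (X.A t ω) * (M.G (X.A t ω) - ∑ i, X.xd i t ω)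
    + M.up (X.A t ω) * M.ed (X.A t ω) * (|M.G (X.A t ω)| - ∑ i, X.xu i t ω)

/-- Average over the slots `0, …, T - 1` of the expectations of a process. -/
def avg (ℙ : Measure Ω) (f : ℕ → Ω → ℝ) (T : ℕ) : ℝ :=
  (1 / (T : ℝ)) * ∑ t ∈ Finset.range T, ∫ ω, f t ω ∂ℙ

/-- Social welfare over the horizon `T`. The objective of P1 is its limit as `T → ∞`. -/
def welfare (T : ℕ) : ℝ := ∑ i, M.ω i * M.U (avg ℙ (X.x i) T) - avg ℙ X.e T

/-- Feasibility for the problem P1. The long-term constraint is on the upper limit of the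
averages, which is their limit whenever that exists. -/
structure Feasible : Prop where
  down_bound : ∀ i t ω, 0 ≤ X.xd i t ω ∧
    X.xd i t ω ≤ X.ind i t ω * min (M.xMax i) (B.sMax i - X.s i t ω)
  up_bound : ∀ i t ω, 0 ≤ X.xu i t ω ∧
    X.xu i t ω ≤ X.ind i t ω * min (M.xMax i) (X.s i t ω - B.sMin i)
  down_sum : ∀ t ω, ∑ i, X.xd i t ω ≤ M.down (X.A t ω) * M.G (X.A t ω)
  up_sum : ∀ t ω, ∑ i, X.xu i t ω ≤ M.up (X.A t ω) * |M.G (X.A t ω)|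
  degradation : ∀ i, limsup (avg ℙ (X.deg i)) atTop ≤ M.cUp i

/-- The virtual queue `J`. -/
def J (i : Fin N) : ℕ → Ω → ℝ
  | 0, _ => 0
  | t + 1, ω => max (J i t ω + X.deg i t ω - M.cUp i) 0

/-- The virtual queue `H`, for auxiliary variables `z`. -/
def H (z : Fin N → ℕ → Ω → ℝ) (i : Fin N) : ℕ → Ω → ℝ
  | 0, _ => 0
  | t + 1, ω => H z i t ω + z i t ω - X.x i t ω

open Classical in
/-- The virtual queue `K`, re-initialized at the returning slots. -/
def K (V : ℝ) (i : Fin N) : ℕ → Ω → ℝ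
  | 0, ω => X.s i 0 ω - shift M B V i
  | t + 1, ω => if X.IsReturn i ω (t + 1) then X.s i (t + 1) ω - shift M B V i
      else K V i t ω + X.b i t ω

/-- The vector of all virtual queues in slot `t`. -/
def Θ (V : ℝ) (z : Fin N → ℕ → Ω → ℝ) (t : ℕ) (ω : Ω) : Fin N → ℝ × ℝ × ℝ :=
  fun i => (X.J i t ω, X.H z i t ω, X.K V i t ω)

/-- A3: given the queue backlogs of the slot before a return, the energy change
during the absence that ends has conditional mean zero. -/
def A3 (V : ℝ) (z : Fin N → ℕ → Ω → ℝ) : Prop :=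
  ∀ i k t,
    ℙ[Set.indicator {ω | X.returnTime i (k + 1) ω = t + 1} (X.gap i k) |
      MeasurableSpace.comap (X.Θ V z t) inferInstance] =ᵐ[ℙ] 0

/-- Allocations allowed in (b1) and in (b2). -/
def allowed (t : ℕ) (ω : Ω) : Set (Fin N → ℝ) :=
  {y | (∀ i, 0 ≤ y i ∧ y i ≤ X.ind i t ω * M.xMax i) ∧ ∑ i, y i ≤ |M.G (X.A t ω)|}

/-- Objective of (b1). -/
def objDown (V : ℝ) (z : Fin N → ℕ → Ω → ℝ) (t : ℕ) (ω : Ω) (y : Fin N → ℝ) : ℝ :=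
  V * M.es (X.A t ω) * (M.G (X.A t ω) - ∑ i, y i) - ∑ i, X.H z i t ω * y i
    + ∑ i, X.J i t ω * M.C i (y i) + ∑ i, X.K V i t ω * y i

/-- Objective of (b2). -/
def objUp (V : ℝ) (z : Fin N → ℕ → Ω → ℝ) (t : ℕ) (ω : Ω) (y : Fin N → ℝ) : ℝ :=
  V * M.ed (X.A t ω) * (|M.G (X.A t ω)| - ∑ i, y i) - ∑ i, X.H z i t ω * y i
    + ∑ i, X.J i t ω * M.C i (y i) - ∑ i, X.K V i t ω * y i

/-- The system is operated by the WMRA algorithm with parameter `V`, with auxiliary decisions `z`.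
Any optimal solutions of the subproblems may be chosen. -/
structure IsWMRA (V : ℝ) (z : Fin N → ℕ → Ω → ℝ) : Prop where
  z_adapted : ∀ i t, Measurable[X.ℱ t] (z i t)
  z_mem : ∀ i t ω, z i t ω ∈ Set.Icc 0 (M.xMax i)
  z_min : ∀ i t ω, IsMinOn (fun y => X.H z i t ω * y - M.ω i * V * M.U y)
    (Set.Icc 0 (M.xMax i)) (z i t ω)
  xd_mem : ∀ t ω, 0 < M.G (X.A t ω) → (fun i => X.xd i t ω) ∈ X.allowed t ω
  xd_min : ∀ t ω, 0 < M.G (X.A t ω) →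
    IsMinOn (X.objDown V z t ω) (X.allowed t ω) (fun i => X.xd i t ω)
  xd_zero : ∀ i t ω, ¬ 0 < M.G (X.A t ω) → X.xd i t ω = 0
  xu_mem : ∀ t ω, M.G (X.A t ω) < 0 → (fun i => X.xu i t ω) ∈ X.allowed t ω
  xu_min : ∀ t ω, M.G (X.A t ω) < 0 →
    IsMinOn (X.objUp V z t ω) (X.allowed t ω) (fun i => X.xu i t ω)
  xu_zero : ∀ i t ω, ¬ M.G (X.A t ω) < 0 → X.xu i t ω = 0

end Operation

end V2G

end

/-! Feasibility rests on thresholds. Since cancelling the amount of a single EV stays within the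
constraints, a positive amount under WMRA forces sign·K ≤ V·price + H, with sign +1 for charging and
-1 for discharging. The queue H never exceeds ωVμ + xMax, because U(x) ≤ μx makes z = 0 the only
minimizer once H > ωVμ. While an EV is present, K is its energy state minus `shift`; so it charges
only if s ≤ sMin + 3xMax + 2V(ωμ + eMax), and discharges only if s ≥ sMin + xMax. The bound V ≤
`vMax` leaves room for one more xMax on either side, and the energy limits hold without being
imposed. The same optimality bounds J·C(x), so J² grows at most linearly, J = O(√T), and the average
degradation cost meets its bound.

The welfare bound is a drift-plus-penalty comparison. The quadratic potentials of J, H and K bound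
the averages of queue times drift from below (`IsWMRA.le_avg_J`, `IsWMRA.le_avg_H`,
`IsWMRA.le_avg_K`; A3 removes the jumps of K on average). In each slot WMRA minimizes penalty plus
drift, so it does at least as well there as any stationary policy (`IsWMRA.drift_le`). Dividing by V
gives the 1/V.

Two difficulties remain. The state is Markov rather than independent over time, so the queues
correlate with it. The Poisson equation of the chain, combined with a clock modulo p, writes a
centred function of the phase as a martingale-type difference; summation by parts then bounds its
correlation with a queue by the increments of the queue, not by its size
(`Operation.abs_sum_integral_mul_phase_le`). Hence the constant does not depend on V or on the
batteries.

The other difficulty is to replace an arbitrary feasible policy by a stationary one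
(`Operation.Feasible.exists_isStationary`). This is done by compactness of the averages over each
phase. Its energy balance needs the mean delivered energy to tend to 0. A2 gives mean zero only for
an absence of fixed index, whereas the number of absences before T is random. That number is within
O(√T) of a deterministic trend in mean, which is enough because the gaps are bounded
(`Operation.Feasible.tendsto_avg_b`). -/

noncomputable section

namespace V2G

/-! ### Poisson equation for a finite chain with a periodic clock -/

section

section Poisson

variable {Q : Type*} [Fintype Q] [DecidableEq Q] {T : Matrix Q Q ℝ}

/-- A function that is harmonic for an irreducible stochastic matrix is constant. -/
theorem harmonic_const (hT : T ∈ Matrix.rowStochastic ℝ Q)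
    (hirr : T.IsIrreducible) {f : Q → ℝ} (hf : T.mulVec f = f) (q q' : Q) : f q = f q' := by
  have hpow : ∀ n : ℕ, (T ^ n).mulVec f = f := by
    intro n
    induction n with
    | zero => simp
    | succ n ih => rw [pow_succ, ← Matrix.mulVec_mulVec, hf, ih]
  -- Maximum principle: f m is an average of f under row m of every power of T, and some power gives
  -- q positive weight.
  obtain ⟨m, -, hm⟩ := Finset.exists_max_image Finset.univ f ⟨q, Finset.mem_univ q⟩
  have key : ∀ q, f q = f m := by
    intro q
    obtain ⟨k, -, hk⟩ := (Matrix.isIrreducible_iff_exists_pow_pos hirr.nonneg).1 hirr m q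
    have hTk := Submonoid.pow_mem _ hT k
    have h1 : ∑ j, (T ^ k) m j * (f m - f j) = 0 := by
      have := congrFun (hpow k) m
      simp only [Matrix.mulVec, dotProduct] at this
      simp only [mul_sub, Finset.sum_sub_distrib, ← Finset.sum_mul, this,
        Matrix.sum_row_of_mem_rowStochastic hTk, one_mul, sub_self]
    have h2 := (Finset.sum_eq_zero_iff_of_nonneg (fun j _ => mul_nonneg
      (Matrix.nonneg_of_mem_rowStochastic hTk) (sub_nonneg.2 (hm j (Finset.mem_univ j))))).1 h1 q
      (Finset.mem_univ q)
    rcases mul_eq_zero.1 h2 with h | h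
    · exact absurd h hk.ne'
    · linarith
  rw [key q, key q']

/-- The value of `h - T h` at a minimum point of `h` is nonpositive. -/
theorem exists_sub_mulVec_nonpos [Nonempty Q] (hT : T ∈ Matrix.rowStochastic ℝ Q) (h : Q → ℝ) :
    ∃ m, h m - T.mulVec h m ≤ 0 := by
  obtain ⟨m, -, hm⟩ := Finset.exists_min_image Finset.univ h Finset.univ_nonempty
  refine ⟨m, ?_⟩
  have : h m = ∑ j, T m j * h m := by
    rw [← Finset.sum_mul, Matrix.sum_row_of_mem_rowStochastic hT, one_mul]
  have h2 : ∑ j, T m j * h m ≤ T.mulVec h m :=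
    Finset.sum_le_sum fun j _ => mul_le_mul_of_nonneg_left (hm j (Finset.mem_univ j))
      (Matrix.nonneg_of_mem_rowStochastic hT)
  linarith

/-- Solvability of the Poisson equation of an irreducible finite Markov chain, with bounds. -/
theorem exists_poisson_of_irreducible [Nonempty Q] (hT : T ∈ Matrix.rowStochastic ℝ Q)
    (hirr : T.IsIrreducible) :
    ∃ (w : Q → ℝ) (κ : ℝ), 0 ≤ κ ∧ (∀ q, 0 ≤ w q) ∧ ∑ q, w q = 1 ∧
      ∀ (f : Q → ℝ) (R : ℝ), (∀ q, |f q| ≤ R) → ∃ h : Q → ℝ, (∀ q, |h q| ≤ κ * R) ∧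
        ∀ q, f q - ∑ q, w q * f q = h q - T.mulVec h q := by
  -- The kernel of I - T consists of constants. No nonzero constant lies in its range, since h - T h
  -- is nonpositive at a minimum of h. By rank-nullity the range and the constants span everything,
  -- so the equation is solvable up to a constant for each unit vector, hence by linearity for every
  -- f.
  let D : (Q → ℝ) →ₗ[ℝ] (Q → ℝ) := LinearMap.id - T.mulVecLin
  have hD : ∀ h q, D h q = h q - T.mulVec h q := fun h q => by simp [D]
  let one : Q → ℝ := fun _ => 1
  have hone : one ≠ 0 := fun h => by
    simpa [one] using congrFun h (Classical.arbitrary Q)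
  have hker : LinearMap.ker D ≤ Submodule.span ℝ {one} := by
    intro f hf
    have hf' : T.mulVec f = f := by
      ext q
      have := congrFun (LinearMap.mem_ker.1 hf) q
      rw [hD] at this
      simp only [Pi.zero_apply] at this
      linarith
    refine Submodule.mem_span_singleton.2 ⟨f (Classical.arbitrary Q), ?_⟩
    ext q
    simp [one, harmonic_const hT hirr hf' q (Classical.arbitrary Q)]
  have hnot : ∀ c : ℝ, c • one ∈ LinearMap.range D → c = 0 := by
    have aux : ∀ c : ℝ, c • one ∈ LinearMap.range D → c ≤ 0 := by
      rintro c ⟨h, hh⟩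
      obtain ⟨m, hm⟩ := exists_sub_mulVec_nonpos hT h
      have := congrFun hh m
      rw [hD] at this
      simp [one] at this
      linarith
    intro c hc
    refine le_antisymm (aux c hc) ?_
    have : (-c) • one ∈ LinearMap.range D := by
      rw [neg_smul]; exact Submodule.neg_mem _ hc
    linarith [aux _ this]
  have hdis : Disjoint (LinearMap.range D) (Submodule.span ℝ {one}) := by
    rw [Submodule.disjoint_def]
    intro x hx hx'
    obtain ⟨c, rfl⟩ := Submodule.mem_span_singleton.1 hx'
    rw [hnot c hx, zero_smul]
  have htop : LinearMap.range D ⊔ Submodule.span ℝ {one} = ⊤ := by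
    have h1 := LinearMap.finrank_range_add_finrank_ker D
    have h2 := Submodule.finrank_mono hker
    apply Submodule.eq_top_of_finrank_eq
    have h3 := Submodule.finrank_sup_add_finrank_inf_eq (LinearMap.range D)
      (Submodule.span ℝ {one})
    rw [hdis.eq_bot, finrank_bot] at h3
    have h4 := Submodule.finrank_le (LinearMap.range D ⊔ Submodule.span ℝ {one})
    omega
  have hsol : ∀ q : Q, ∃ (c : ℝ) (h : Q → ℝ), D h + c • one = Pi.single q 1 := by
    intro q
    have : (Pi.single q 1 : Q → ℝ) ∈ LinearMap.range D ⊔ Submodule.span ℝ {one} := by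
      rw [htop]; trivial
    obtain ⟨y, ⟨h, rfl⟩, z, hz, hyz⟩ := Submodule.mem_sup.1 this
    obtain ⟨c, rfl⟩ := Submodule.mem_span_singleton.1 hz
    exact ⟨c, h, hyz⟩
  choose w h hw using hsol
  have hgen : ∀ f : Q → ℝ, D (∑ q, f q • h q) + (∑ q, w q * f q) • one = f := by
    intro f
    have : ∑ q, f q • (Pi.single q 1 : Q → ℝ) = f := by
      ext q; simp [Finset.sum_apply, Pi.single_apply]
    conv_rhs => rw [← this]
    simp only [← hw, map_sum, map_smul, smul_add, Finset.sum_add_distrib, smul_smul,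
      Finset.sum_smul, mul_comm (w _)]
  -- κ is the total mass of the solutions for unit vectors, which dominates every value of a
  -- combination of them with coefficients at most R.
  refine ⟨w, ∑ q, ∑ q', |h q q'|, by positivity, ?_, ?_, ?_⟩
  · intro q
    obtain ⟨m, hm⟩ := exists_sub_mulVec_nonpos hT (h q)
    have := congrFun (hw q) m
    simp only [Pi.add_apply, Pi.smul_apply, hD, smul_eq_mul, one, mul_one] at this
    have h2 : (0 : ℝ) ≤ (Pi.single q 1 : Q → ℝ) m := by
      rw [Pi.single_apply]; split_ifs <;> norm_num
    linarith
  · have h1 := hgen one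
    have h2 : (1 - ∑ q, w q) • one ∈ LinearMap.range D := by
      refine ⟨∑ q, one q • h q, ?_⟩
      rw [sub_smul, one_smul, eq_sub_iff_add_eq]
      simpa [one] using h1
    linarith [hnot _ h2]
  · intro f R hR
    refine ⟨∑ q, f q • h q, ?_, ?_⟩
    · intro q'
      rw [Finset.sum_apply, Finset.sum_mul]
      refine (Finset.abs_sum_le_sum_abs _ _).trans (Finset.sum_le_sum fun q _ => ?_)
      rw [Pi.smul_apply, smul_eq_mul, abs_mul, mul_comm]
      have : |h q q'| ≤ ∑ q', |h q q'| :=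
        Finset.single_le_sum (f := fun q' => |h q q'|) (fun _ _ => abs_nonneg _)
          (Finset.mem_univ q')
      exact mul_le_mul this (hR q) (abs_nonneg _) ((abs_nonneg _).trans this)
    · intro q
      have := congrFun (hgen f) q
      simp only [Pi.add_apply, hD, Pi.smul_apply, smul_eq_mul, one, mul_one] at this
      linarith

/-- The transition matrix of a Markov chain together with a clock modulo `p`. -/
def clockMatrix (p : ℕ) (P : Matrix Q Q ℝ) : Matrix (ZMod p × Q) (ZMod p × Q) ℝ :=
  fun x y => if y.1 = x.1 + 1 then P x.2 y.2 else 0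

variable {p : ℕ} [NeZero p] {P : Matrix Q Q ℝ}

omit [DecidableEq Q] in
theorem clockMatrix_mulVec (h : ZMod p × Q → ℝ) (x : ZMod p × Q) :
    (clockMatrix p P).mulVec h x = ∑ b, P x.2 b * h (x.1 + 1, b) := by
  simp only [Matrix.mulVec, dotProduct, Fintype.sum_prod_type, clockMatrix, ite_mul, zero_mul]
  rw [Finset.sum_comm]
  simp

theorem clockMatrix_mem (hP : P ∈ Matrix.rowStochastic ℝ Q) :
    clockMatrix p P ∈ Matrix.rowStochastic ℝ (ZMod p × Q) := by
  rw [Matrix.mem_rowStochastic]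
  constructor
  · intro x y
    unfold clockMatrix
    split_ifs
    · exact Matrix.nonneg_of_mem_rowStochastic hP
    · exact le_rfl
  · ext x
    rw [clockMatrix_mulVec]
    simp [Matrix.sum_row_of_mem_rowStochastic hP]

theorem clockMatrix_pow (n : ℕ) (x y : ZMod p × Q) :
    (clockMatrix p P ^ n) x y = if y.1 = x.1 + n then (P ^ n) x.2 y.2 else 0 := by
  induction n generalizing x with
  | zero =>
    simp only [pow_zero, Matrix.one_apply, Nat.cast_zero, add_zero, Prod.ext_iff]
    split_ifs <;> simp_all
  | succ n ih =>
    rw [pow_succ', Matrix.mul_apply']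
    change (clockMatrix p P).mulVec (fun z => (clockMatrix p P ^ n) z y) x = _
    rw [clockMatrix_mulVec, pow_succ', Matrix.mul_apply]
    simp only [ih, Nat.cast_add, Nat.cast_one]
    have : x.1 + 1 + (n : ZMod p) = x.1 + (n + 1) := by ring
    rw [this]
    split_ifs <;> simp

/-- The residues of loop lengths at a form a submonoid of a finite group, hence a subgroup. The
generator of its preimage in ℤ divides all loop lengths, so aperiodicity makes it ±1 and every
residue occurs. -/
theorem exists_loop (hP : P ∈ Matrix.rowStochastic ℝ Q) (haper : Aperiodic P) (a : Q)
    (r : ZMod p) : ∃ n : ℕ, (n : ZMod p) = r ∧ 0 < (P ^ n) a a := by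
  have hmul : ∀ m n : ℕ, 0 < (P ^ m) a a → 0 < (P ^ n) a a → 0 < (P ^ (m + n)) a a := by
    intro m n hm hn
    rw [pow_add, Matrix.mul_apply]
    refine lt_of_lt_of_le (mul_pos hm hn) (Finset.single_le_sum
      (f := fun j => (P ^ m) a j * (P ^ n) j a) (fun j _ => ?_) (Finset.mem_univ a))
    exact mul_nonneg (Matrix.nonneg_of_mem_rowStochastic (Submonoid.pow_mem _ hP m))
      (Matrix.nonneg_of_mem_rowStochastic (Submonoid.pow_mem _ hP n))
  let L : AddSubmonoid (ZMod p) :=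
    { carrier := {r | ∃ n : ℕ, (n : ZMod p) = r ∧ 0 < (P ^ n) a a}
      zero_mem' := ⟨0, by simp⟩
      add_mem' := by
        rintro _ _ ⟨m, rfl, hm⟩ ⟨n, rfl, hn⟩
        exact ⟨m + n, by simp, hmul m n hm hn⟩ }
  have hneg : ∀ x ∈ L, -x ∈ L := by
    intro x hx
    have : -x = (p - 1 : ℕ) • x := by
      have hp : 0 < p := NeZero.pos p
      rw [nsmul_eq_mul, Nat.cast_sub hp]
      simp
    rw [this]
    exact L.nsmul_mem hx _
  let G : AddSubgroup (ZMod p) := { L with neg_mem' := fun {x} hx => hneg x hx }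
  obtain ⟨d, hd⟩ := Int.subgroup_cyclic (G.comap (Int.castAddHom (ZMod p)))
  have hd1 : d.natAbs = 1 := by
    refine haper a d.natAbs fun n _ hn => ?_
    have : (n : ℤ) ∈ G.comap (Int.castAddHom (ZMod p)) := by
      rw [AddSubgroup.mem_comap]
      exact ⟨n, by simp, hn⟩
    rw [hd, AddSubgroup.mem_closure_singleton] at this
    obtain ⟨k, hk⟩ := this
    exact Int.natCast_dvd_natCast.1 (by rw [Int.natAbs_dvd, ← hk]; simp)
  have h1 : (r.val : ℤ) ∈ G.comap (Int.castAddHom (ZMod p)) := by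
    rw [hd, AddSubgroup.mem_closure_singleton]
    rcases Int.natAbs_eq d with h | h <;> rw [hd1] at h
    · exact ⟨r.val, by simp [h]⟩
    · exact ⟨-r.val, by simp [h]⟩
  rw [AddSubgroup.mem_comap] at h1
  have h2 : (Int.castAddHom (ZMod p)) (r.val : ℤ) = r := by simp
  rw [h2] at h1
  exact h1

/-- A path from a to b may arrive at the wrong clock time; a preliminary loop at a of suitable
length modulo p corrects it. -/
theorem clockMatrix_irreducible (hP : P ∈ Matrix.rowStochastic ℝ Q) (hirr : P.IsIrreducible)
    (haper : Aperiodic P) : (clockMatrix p P).IsIrreducible := by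
  rw [Matrix.isIrreducible_iff_exists_pow_pos
    fun _ _ => Matrix.nonneg_of_mem_rowStochastic (clockMatrix_mem hP)]
  rintro ⟨r, a⟩ ⟨r', b⟩
  obtain ⟨k, hk, hk'⟩ := (Matrix.isIrreducible_iff_exists_pow_pos hirr.nonneg).1 hirr a b
  obtain ⟨n, hn, hn'⟩ := exists_loop hP haper a (r' - r - (k : ZMod p))
  refine ⟨n + k, by omega, ?_⟩
  rw [clockMatrix_pow, if_pos (by simp [hn])]
  rw [pow_add, Matrix.mul_apply]
  refine lt_of_lt_of_le (mul_pos hn' hk') (Finset.single_le_sum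
    (f := fun j => (P ^ n) a j * (P ^ k) j b) (fun j _ => ?_) (Finset.mem_univ a))
  exact mul_nonneg (Matrix.nonneg_of_mem_rowStochastic (Submonoid.pow_mem _ hP n))
    (Matrix.nonneg_of_mem_rowStochastic (Submonoid.pow_mem _ hP k))

/-- `w` and `κ` solve the Poisson equations of the chain with transition matrix `P` and a clock
modulo `p`: every function bounded by `R` is its `w`-mean plus the drift of a function bounded
by `κ * R`. -/
structure IsPoisson (p : ℕ) [NeZero p] (P : Matrix Q Q ℝ) (w : ZMod p × Q → ℝ) (κ : ℝ) :
    Prop where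
  nonneg : 0 ≤ κ
  weight_nonneg : ∀ q, 0 ≤ w q
  weight_sum : ∑ q, w q = 1
  solve : ∀ (f : ZMod p × Q → ℝ) (R : ℝ), (∀ q, |f q| ≤ R) →
    ∃ h : ZMod p × Q → ℝ, (∀ q, |h q| ≤ κ * R) ∧
      ∀ r a, f (r, a) - ∑ q, w q * f q = h (r, a) - ∑ b, P a b * h (r + 1, b)

theorem exists_isPoisson [Nonempty Q] (hP : P ∈ Matrix.rowStochastic ℝ Q)
    (hirr : P.IsIrreducible) (haper : Aperiodic P) : ∃ w κ, IsPoisson p P w κ := by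
  obtain ⟨w, κ, h0, h1, h2, h3⟩ := exists_poisson_of_irreducible (clockMatrix_mem (p := p) hP)
    (clockMatrix_irreducible hP hirr haper)
  refine ⟨w, κ, h0, h1, h2, fun f R hR => ?_⟩
  obtain ⟨h, hh, hh'⟩ := h3 f R hR
  exact ⟨h, hh, fun r a => by rw [hh', clockMatrix_mulVec]⟩

end Poisson

end

/-! ### Markov property and correlation of slow processes with the phase -/

section

section Generic

variable {Ω : Type*} [mΩ : MeasurableSpace Ω] {ℙ : Measure Ω} [IsProbabilityMeasure ℙ]

theorem integrable_of_abs_le {f : Ω → ℝ} {c : ℝ} (hf : Measurable f) (hb : ∀ ω, |f ω| ≤ c) :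
    Integrable f ℙ :=
  Integrable.of_bound hf.aestronglyMeasurable c (ae_of_all _ fun ω => by
    rw [Real.norm_eq_abs]; exact hb ω)

theorem abs_integral_le_of_abs_le {f : Ω → ℝ} {c : ℝ} (hb : ∀ ω, |f ω| ≤ c) :
    |∫ ω, f ω ∂ℙ| ≤ c := by
  have := norm_integral_le_of_norm_le_const (μ := ℙ) (f := f) (C := c) (ae_of_all _ fun ω => by
    rw [Real.norm_eq_abs]; exact hb ω)
  simpa using this

omit mΩ in
theorem measurable_comp_finite {S : Type*} [Fintype S] {m : MeasurableSpace Ω} {A : Ω → S}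
    (hA : ∀ a, MeasurableSet[m] {ω | A ω = a}) {g : S → Ω → ℝ} (hg : ∀ a, Measurable[m] (g a)) :
    Measurable[m] fun ω => g (A ω) ω := by
  classical
  have : (fun ω => g (A ω) ω) = fun ω => ∑ a, Set.indicator {ω | A ω = a} (g a) ω := by
    ext ω
    simp [Set.indicator_apply]
  rw [this]
  exact Finset.measurable_sum _ fun a _ => (hg a).indicator (hA a)

-- `C i` and `U` are continuous only on an interval; extending them by their endpoint values makes
-- them continuous on ℝ without changing the composition.
omit mΩ in
theorem measurable_comp_of_continuousOn {m : MeasurableSpace Ω} {f : ℝ → ℝ} {a b : ℝ} {g : Ω → ℝ}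
    (hab : a ≤ b) (hf : ContinuousOn f (Set.Icc a b)) (hg : Measurable[m] g)
    (hmem : ∀ ω, g ω ∈ Set.Icc a b) : Measurable[m] fun ω => f (g ω) := by
  have : (fun ω => f (g ω)) = fun ω => Set.IccExtend hab ((Set.Icc a b).domRestrict f) (g ω) := by
    ext ω
    rw [Set.IccExtend_of_mem _ _ (hmem ω), Set.domRestrict_apply]
  rw [this]
  exact (continuousOn_iff_continuous_domRestrict.1 hf).Icc_extend'.measurable.comp hg

end Generic

namespace Operation

variable {N : ℕ} {S : Type*} [Fintype S] [DecidableEq S]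
  {M : Model N S} {B : Battery N} {Ω : Type*} [mΩ : MeasurableSpace Ω] {ℙ : Measure Ω}
  (X : Operation M B ℙ)

theorem measurable_A {t u : ℕ} (htu : t ≤ u) (φ : S → ℝ) :
    Measurable[X.ℱ u] fun ω => φ (X.A t ω) :=
  measurable_comp_finite (fun a => X.ℱ.mono htu _ (X.A_adapted t a)) fun _ => measurable_const

/-- The state together with the slot number modulo `p`. -/
def phase (p : ℕ) (t : ℕ) (ω : Ω) : ZMod p × S := ((t : ZMod p), X.A t ω)

theorem measurable_phase {p t u : ℕ} (htu : t ≤ u) (f : ZMod p × S → ℝ) :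
    Measurable[X.ℱ u] fun ω => f (X.phase p t ω) :=
  X.measurable_A htu fun a => f ((t : ZMod p), a)

variable [IsProbabilityMeasure ℙ]

theorem integral_mul_next {t : ℕ} {Y : Ω → ℝ} {c : ℝ} (hY : Measurable[X.ℱ t] Y)
    (hc : ∀ ω, |Y ω| ≤ c) (b : S) :
    ∫ ω, Y ω * Set.indicator {ω | X.A (t + 1) ω = b} (fun _ => (1 : ℝ)) ω ∂ℙ =
      ∫ ω, Y ω * M.P (X.A t ω) b ∂ℙ := by
  have hm : Measurable (Set.indicator {ω | X.A (t + 1) ω = b} (fun _ => (1 : ℝ))) :=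
    measurable_const.indicator (X.ℱ.le _ _ (X.A_adapted (t + 1) b))
  have hI : ∀ ω, |Set.indicator {ω | X.A (t + 1) ω = b} (fun _ => (1 : ℝ)) ω| ≤ 1 := fun ω => by
    rw [Set.indicator_apply]; split_ifs <;> simp
  have hYm : Measurable Y := hY.mono (X.ℱ.le t) le_rfl
  have h0 : ∀ ω : Ω, 0 ≤ c := fun ω => (abs_nonneg _).trans (hc ω)
  have h1 : Integrable (Y * Set.indicator {ω | X.A (t + 1) ω = b} (fun _ => (1 : ℝ))) ℙ :=
    integrable_of_abs_le (c := c) (hYm.mul hm) fun ω => by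
      rw [Pi.mul_apply, abs_mul]
      exact (mul_le_mul (hc ω) (hI ω) (abs_nonneg _) (h0 ω)).trans (by rw [mul_one])
  have h2 := condExp_mul_of_stronglyMeasurable_left (μ := ℙ) hY.stronglyMeasurable h1
    (integrable_of_abs_le hm hI)
  have h3 := integral_condExp (X.ℱ.le t) (μ := ℙ)
    (f := Y * Set.indicator {ω | X.A (t + 1) ω = b} (fun _ => (1 : ℝ)))
  refine Eq.trans h3.symm (integral_congr_ae ?_)
  filter_upwards [h2, X.markov t b] with ω hω hω'
  rw [hω, Pi.mul_apply, hω']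

/-- The Markov property for functions of two successive states. -/
theorem integral_mul_pair {t : ℕ} {Y : Ω → ℝ} {c : ℝ} (hY : Measurable[X.ℱ t] Y)
    (hc : ∀ ω, |Y ω| ≤ c) (g : S → S → ℝ) :
    ∫ ω, Y ω * g (X.A t ω) (X.A (t + 1) ω) ∂ℙ =
      ∫ ω, Y ω * ∑ b, M.P (X.A t ω) b * g (X.A t ω) b ∂ℙ := by
  obtain ⟨R, hR⟩ : ∃ R, ∀ a b, |g a b| ≤ R := by
    refine ⟨∑ a, ∑ b, |g a b|, fun a b => ?_⟩
    exact (Finset.single_le_sum (f := fun b => |g a b|) (fun _ _ => abs_nonneg _)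
      (Finset.mem_univ b)).trans (Finset.single_le_sum (f := fun a => ∑ b, |g a b|)
      (fun _ _ => Finset.sum_nonneg fun _ _ => abs_nonneg _) (Finset.mem_univ a))
  have hYg : ∀ b, Measurable[X.ℱ t] fun ω => Y ω * g (X.A t ω) b := fun b =>
    hY.mul (X.measurable_A le_rfl fun a => g a b)
  have hYgc : ∀ b ω, |Y ω * g (X.A t ω) b| ≤ c * R := fun b ω => by
    rw [abs_mul]
    exact mul_le_mul (hc ω) (hR _ _) (abs_nonneg _) ((abs_nonneg _).trans (hc ω))
  have hP : ∀ a b, |M.P a b| ≤ 1 := fun a b => by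
    rw [abs_of_nonneg (Matrix.nonneg_of_mem_rowStochastic M.P_stochastic)]
    exact Matrix.le_one_of_mem_rowStochastic M.P_stochastic
  have e1 : (fun ω => Y ω * g (X.A t ω) (X.A (t + 1) ω)) = fun ω => ∑ b,
      Y ω * g (X.A t ω) b * Set.indicator {ω | X.A (t + 1) ω = b} (fun _ => (1 : ℝ)) ω := by
    ext ω
    simp [Set.indicator_apply]
  have e2 : (fun ω => Y ω * ∑ b, M.P (X.A t ω) b * g (X.A t ω) b) = fun ω => ∑ b,
      Y ω * g (X.A t ω) b * M.P (X.A t ω) b := by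
    ext ω
    rw [Finset.mul_sum]
    exact Finset.sum_congr rfl fun b _ => by ring
  rw [e1, e2, integral_finsetSum, integral_finsetSum]
  · exact Finset.sum_congr rfl fun b _ => X.integral_mul_next (hYg b) (hYgc b) b
  · intro b _
    refine integrable_of_abs_le (c := c * R) (((hYg b).mul
      (X.measurable_A le_rfl fun a => M.P a b)).mono (X.ℱ.le t) le_rfl) fun ω => ?_
    rw [abs_mul]
    exact (mul_le_mul (hYgc b ω) (hP _ _) (abs_nonneg _)
      ((abs_nonneg _).trans (hYgc b ω))).trans (by rw [mul_one])
  · intro b _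
    refine integrable_of_abs_le (c := c * R) (((hYg b).mono (X.ℱ.le t) le_rfl).mul
      (measurable_const.indicator (X.ℱ.le _ _ (X.A_adapted (t + 1) b)))) fun ω => ?_
    rw [abs_mul]
    have h1 : |Set.indicator {ω | X.A (t + 1) ω = b} (fun _ => (1 : ℝ)) ω| ≤ 1 := by
      rw [Set.indicator_apply]; split_ifs <;> simp
    exact (mul_le_mul (hYgc b ω) h1 (abs_nonneg _)
      ((abs_nonneg _).trans (hYgc b ω))).trans (by rw [mul_one])

/-- A slowly varying adapted process does not correlate, on average, with the centred phase. -/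
theorem abs_sum_integral_mul_phase_le {p : ℕ} [NeZero p] {w : ZMod p × S → ℝ} {κ : ℝ}
    (hw : IsPoisson p M.P w κ) {f : ZMod p × S → ℝ} {R : ℝ} (hf : ∀ q, |f q| ≤ R)
    {Y : ℕ → Ω → ℝ} {c : ℕ → ℝ} {β : ℝ} (hY : ∀ t, Measurable[X.ℱ t] (Y t))
    (hc : ∀ t ω, |Y t ω| ≤ c t) (hβ : ∀ t ω, |Y (t + 1) ω - Y t ω| ≤ β) (T : ℕ) :
    |∑ t ∈ Finset.range T, ∫ ω, Y t ω * (f (X.phase p t ω) - ∑ q, w q * f q) ∂ℙ| ≤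
      κ * R * (c 0 + c T + T * β) := by
  obtain ⟨h, hh, hpo⟩ := hw.solve f R hf
  obtain ⟨ω₀⟩ := nonempty_of_isProbabilityMeasure ℙ
  have hc0 : ∀ t, 0 ≤ c t := fun t => (abs_nonneg _).trans (hc t ω₀)
  have hκ : 0 ≤ κ * R := (abs_nonneg _).trans (hh (X.phase p 0 ω₀))
  have hYm : ∀ t, Measurable (Y t) := fun t => (hY t).mono (X.ℱ.le t) le_rfl
  have hhm : ∀ t, Measurable fun ω => h (X.phase p t ω) := fun t =>
    (X.measurable_phase le_rfl h).mono (X.ℱ.le t) le_rfl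
  have hI : ∀ t u, Integrable (fun ω => Y t ω * h (X.phase p u ω)) ℙ := fun t u =>
    integrable_of_abs_le (c := c t * (κ * R)) ((hYm t).mul (hhm u)) fun ω => by
      rw [abs_mul]; exact mul_le_mul (hc t ω) (hh _) (abs_nonneg _) (hc0 t)
  have hB : ∀ t u, |∫ ω, Y t ω * h (X.phase p u ω) ∂ℙ| ≤ c t * (κ * R) := fun t u =>
    abs_integral_le_of_abs_le fun ω => by
      rw [abs_mul]; exact mul_le_mul (hc t ω) (hh _) (abs_nonneg _) (hc0 t)
  -- By the Poisson equation and the Markov property, the centred f at time t may be replaced by h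
  -- now minus h next under the integral against Y t. Moving the difference onto Y leaves a
  -- telescoping part and an increment of Y times h.
  have hstep : ∀ t, ∫ ω, Y t ω * (f (X.phase p t ω) - ∑ q, w q * f q) ∂ℙ =
      ∫ ω, Y t ω * h (X.phase p t ω) ∂ℙ - ∫ ω, Y (t + 1) ω * h (X.phase p (t + 1) ω) ∂ℙ +
        ∫ ω, (Y (t + 1) ω - Y t ω) * h (X.phase p (t + 1) ω) ∂ℙ := by
    intro t
    have h1 := X.integral_mul_pair (hY t) (hc t) fun _ b => h (((t + 1 : ℕ) : ZMod p), b)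
    have h2 : (fun ω => Y t ω * (f (X.phase p t ω) - ∑ q, w q * f q)) = fun ω =>
        Y t ω * h (X.phase p t ω) -
          Y t ω * ∑ b, M.P (X.A t ω) b * h (((t + 1 : ℕ) : ZMod p), b) := by
      ext ω
      rw [phase, hpo, Nat.cast_add, Nat.cast_one, mul_sub]
    have hI2 : Integrable (fun ω => Y t ω *
        ∑ b, M.P (X.A t ω) b * h (((t + 1 : ℕ) : ZMod p), b)) ℙ := by
      have : (fun ω => Y t ω * ∑ b, M.P (X.A t ω) b * h (((t + 1 : ℕ) : ZMod p), b)) = fun ω =>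
          Y t ω * h (X.phase p t ω) - Y t ω * (f (X.phase p t ω) - ∑ q, w q * f q) := by
        ext ω
        rw [phase, hpo, Nat.cast_add, Nat.cast_one]; ring
      rw [this]
      refine (hI t t).sub (integrable_of_abs_le (c := c t * (R + |∑ q, w q * f q|))
        ((hYm t).mul (((X.measurable_phase le_rfl f).mono (X.ℱ.le t) le_rfl).sub_const _))
        fun ω => ?_)
      rw [abs_mul]
      exact mul_le_mul (hc t ω) ((abs_sub _ _).trans (by gcongr; exact hf _)) (abs_nonneg _)
        (hc0 t)
    rw [h2, integral_sub (hI t t) hI2, ← h1]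
    simp only [sub_mul]
    rw [integral_sub (hI _ _) (hI _ _)]
    simp only [phase]
    ring
  -- The boundary term at T is kept inside the absolute value so that the induction telescopes; it
  -- is removed at the end at the cost of `c T`.
  have hsum : ∀ T : ℕ, |∑ t ∈ Finset.range T, ∫ ω, Y t ω * (f (X.phase p t ω) - ∑ q, w q * f q) ∂ℙ
      + ∫ ω, Y T ω * h (X.phase p T ω) ∂ℙ| ≤ κ * R * (c 0 + T * β) := by
    intro T
    induction T with
    | zero =>
      simp only [Finset.range_zero, Finset.sum_empty, zero_add, Nat.cast_zero, zero_mul, add_zero]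
      rw [mul_comm]
      exact hB 0 0
    | succ T ih =>
      rw [Finset.sum_range_succ, hstep T]
      have h1 : |∫ ω, (Y (T + 1) ω - Y T ω) * h (X.phase p (T + 1) ω) ∂ℙ| ≤ β * (κ * R) :=
        abs_integral_le_of_abs_le fun ω => by
          rw [abs_mul]
          exact mul_le_mul (hβ T ω) (hh _) (abs_nonneg _) ((abs_nonneg _).trans (hβ T ω))
      rw [abs_le] at ih h1 ⊢
      push_cast
      constructor <;> nlinarith [ih.1, ih.2, h1.1, h1.2]
  have h1 := hsum T
  have h2 := hB T T
  rw [abs_le] at h1 h2 ⊢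
  constructor <;> nlinarith [h1.1, h1.2, h2.1, h2.2]

end Operation

end

/-! ### Returns, absences and the recursion for the queue K -/

section

section Generic

variable {Ω : Type*} [mΩ : MeasurableSpace Ω]

/-- Positivity of n excludes the default value 0 that `Nat.nth` takes when there are too few
members. -/
theorem nth_eq_pos_iff {p : ℕ → Prop} [DecidablePred p] {k n : ℕ} (hn : 0 < n) :
    Nat.nth p k = n ↔ p n ∧ Nat.count p n = k := by
  constructor
  · rintro rfl
    exact ⟨Nat.nth_mem_of_ne_zero hn.ne',
      Nat.count_nth fun hf => Nat.lt_card_toFinset_of_nth_ne_zero hn.ne' hf⟩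
  · rintro ⟨h, rfl⟩
    exact Nat.nth_count h

omit mΩ in
theorem measurable_count {m : MeasurableSpace Ω} {p : Ω → ℕ → Prop} [∀ ω, DecidablePred (p ω)]
    {n : ℕ} (hp : ∀ t < n, MeasurableSet[m] {ω | p ω t}) :
    Measurable[m] fun ω => Nat.count (p ω) n := by
  induction n with
  | zero => simp
  | succ n ih =>
    simp only [Nat.count_succ]
    exact (ih fun t ht => hp t (by omega)).add
      (Measurable.ite (hp n (by omega)) measurable_const measurable_const)

theorem measurable_nth {p : Ω → ℕ → Prop} (hp : ∀ t, MeasurableSet {ω | p ω t}) (k : ℕ) :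
    Measurable fun ω => Nat.nth (p ω) k := by
  classical
  have hpos : ∀ n, 0 < n → MeasurableSet {ω | Nat.nth (p ω) k = n} := by
    intro n hn
    simp only [nth_eq_pos_iff hn]
    exact (hp n).inter (measurable_count (fun t _ => hp t) (measurableSet_singleton k))
  refine measurable_to_countable' fun n => ?_
  rcases Nat.eq_zero_or_pos n with rfl | hn
  -- The value 0 may be genuine or the default, so this event is obtained as the complement of all
  -- the others.
  · have : (fun ω => Nat.nth (p ω) k) ⁻¹' {0} = (⋃ n : ℕ, {ω | Nat.nth (p ω) k = n + 1})ᶜ := by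
      ext ω
      simp only [Set.mem_preimage, Set.mem_singleton_iff, Set.mem_compl_iff, Set.mem_iUnion,
        Set.mem_ofPred_eq, not_exists]
      constructor
      · intro h n; omega
      · intro h
        by_contra h0
        exact h (Nat.nth (p ω) k - 1) (by omega)
    rw [this]
    exact (MeasurableSet.iUnion fun n => hpos (n + 1) n.succ_pos).compl
  · exact hpos n hn

theorem measurable_comp_nat {f : ℕ → Ω → ℝ} (hf : ∀ n, Measurable (f n)) {τ : Ω → ℕ}
    (hτ : Measurable τ) : Measurable fun ω => f (τ ω) ω := by
  have : Measurable fun q : ℕ × Ω => f q.1 q.2 := measurable_from_prod_countable_right fun n => hf n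
  exact this.comp (hτ.prodMk measurable_id)

end Generic

namespace Operation

variable {N : ℕ} {S : Type*} [Fintype S] [DecidableEq S]
  {M : Model N S} {B : Battery N} {Ω : Type*} [mΩ : MeasurableSpace Ω] {ℙ : Measure Ω}
  (X : Operation M B ℙ)

open Classical in
/-- Number of returning slots before slot `t`. -/
def returnCount (i : Fin N) (t : ℕ) (ω : Ω) : ℕ := Nat.count (X.IsReturn i ω) t

open Classical in
/-- Number of leaving slots before slot `t`. -/
def leaveCount (i : Fin N) (t : ℕ) (ω : Ω) : ℕ := Nat.count (X.IsLeave i ω) t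

theorem isReturn_zero (i : Fin N) (ω : Ω) : X.IsReturn i ω 0 :=
  ⟨X.initial i ω, fun r hr => by omega⟩

theorem isReturn_succ {i : Fin N} {ω : Ω} {t : ℕ} :
    X.IsReturn i ω (t + 1) ↔ X.Present i (t + 1) ω ∧ ¬ X.Present i t ω :=
  ⟨fun h => ⟨h.1, h.2 t rfl⟩, fun h => ⟨h.1, fun r hr => by
    obtain rfl : t = r := by omega
    exact h.2⟩⟩

theorem isLeave_succ {i : Fin N} {ω : Ω} {t : ℕ} :
    X.IsLeave i ω (t + 1) ↔ ¬ X.Present i (t + 1) ω ∧ X.Present i t ω :=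
  ⟨fun ⟨h, r, hr, h'⟩ => ⟨h, by
    obtain rfl : t = r := by omega
    exact h'⟩, fun h => ⟨h.1, t, rfl, h.2⟩⟩

-- Returns and leaves alternate, beginning with the return in slot 0, so their counts differ by one
-- exactly while the EV is present.
open Classical in
theorem leaveCount_add (i : Fin N) (t : ℕ) (ω : Ω) :
    X.leaveCount i (t + 1) ω + (if X.Present i t ω then 1 else 0) = X.returnCount i (t + 1) ω := by
  induction t with
  | zero =>
    have h0 : X.Present i 0 ω := X.initial i ω
    have h1 : ¬ X.IsLeave i ω 0 := fun h => h.1 h0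
    simp [leaveCount, returnCount, Nat.count_succ, X.isReturn_zero, h0, h1]
  | succ t ih =>
    simp only [leaveCount, returnCount] at ih ⊢
    rw [Nat.count_succ, Nat.count_succ (n := t + 1), ← ih]
    simp only [isReturn_succ, isLeave_succ]
    by_cases h1 : X.Present i t ω <;> by_cases h2 : X.Present i (t + 1) ω <;> simp [h1, h2]

theorem one_le_returnCount (i : Fin N) (t : ℕ) (ω : Ω) : 1 ≤ X.returnCount i (t + 1) ω := by
  classical
  induction t with
  | zero => simp [returnCount, Nat.count_succ, X.isReturn_zero]
  | succ t ih =>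
    refine ih.trans ?_
    simp only [returnCount]
    exact Nat.count_monotone _ (by omega)

theorem K_of_present (V : ℝ) {i : Fin N} {t : ℕ} {ω : Ω} (h : X.Present i t ω) :
    X.K V i t ω = X.s i t ω - shift M B V i := by
  induction t with
  | zero => rfl
  | succ t ih =>
    rw [K]
    split_ifs with hr
    · rfl
    · have ht : X.Present i t ω := by
        by_contra ht
        exact hr (X.isReturn_succ.2 ⟨h, ht⟩)
      have h2 : X.s i (t + 1) ω = X.s i t ω + X.b i t ω := X.energy i t ω ht
      rw [ih ht, h2]
      ring

/-- Nothing is delivered during an absence, so K stays frozen at its value in the last leaving slot.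
During an absence as many leaves as returns have occurred, hence the index. -/
theorem K_of_absent (V : ℝ) {i : Fin N} {t : ℕ} {ω : Ω}
    (hb : ∀ t, ¬ X.Present i t ω → X.b i t ω = 0) (h : ¬ X.Present i t ω) :
    X.K V i t ω =
      X.s i (X.leaveTime i (X.returnCount i (t + 1) ω - 1) ω) ω - shift M B V i := by
  classical
  induction t with
  | zero => exact absurd (X.initial i ω) h
  | succ t ih =>
    have hc := X.leaveCount_add i (t + 1) ω
    rw [if_neg h, add_zero] at hc
    have hr : ¬ X.IsReturn i ω (t + 1) := fun hr => h hr.1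
    rw [K, if_neg hr, ← hc]
    by_cases ht : X.Present i t ω
    · have hl : X.IsLeave i ω (t + 1) := X.isLeave_succ.2 ⟨h, ht⟩
      have h1 : X.leaveCount i (t + 1 + 1) ω - 1 = Nat.count (X.IsLeave i ω) (t + 1) := by
        rw [leaveCount, Nat.count_succ, if_pos hl]; rfl
      rw [h1, leaveTime, Nat.nth_count hl, X.K_of_present V ht]
      have h2 : X.s i (t + 1) ω = X.s i t ω + X.b i t ω := X.energy i t ω ht
      rw [h2]; ring
    · have hl : ¬ X.IsLeave i ω (t + 1) := fun hl => ht (X.isLeave_succ.1 hl).2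
      have h1 : X.leaveCount i (t + 1 + 1) ω = X.returnCount i (t + 1) ω := by
        have := X.leaveCount_add i t ω
        rw [if_neg ht, add_zero] at this
        rw [← this, leaveCount, Nat.count_succ, if_neg hl]; rfl
      rw [h1, ih ht, hb t ht, add_zero]

open Classical in
/-- The energy change during an absence that ends in slot `t + 1`, if one does. -/
def jump (i : Fin N) (t : ℕ) (ω : Ω) : ℝ :=
  if X.IsReturn i ω (t + 1) then X.gap i (X.returnCount i (t + 1) ω - 1) ω else 0

theorem returnTime_eq_succ_iff {i : Fin N} {k t : ℕ} {ω : Ω} :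
    X.returnTime i (k + 1) ω = t + 1 ↔
      X.IsReturn i ω (t + 1) ∧ X.returnCount i (t + 1) ω = k + 1 := by
  classical
  rw [returnTime, nth_eq_pos_iff t.succ_pos]
  rfl

/-- Re-initialization at a return shifts the frozen value by exactly the energy change during the
absence. This makes K additive, as a quadratic drift argument requires. -/
theorem K_succ (V : ℝ) {i : Fin N} {ω : Ω} (hb : ∀ t, ¬ X.Present i t ω → X.b i t ω = 0) (t : ℕ) :
    X.K V i (t + 1) ω = X.K V i t ω + X.b i t ω + X.jump i t ω := by
  rw [K, jump]
  by_cases hr : X.IsReturn i ω (t + 1)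
  · rw [if_pos hr, if_pos hr]
    have ht := (X.isReturn_succ.1 hr).2
    have h1 := X.one_le_returnCount i t ω
    have h2 : X.returnTime i (X.returnCount i (t + 1) ω - 1 + 1) ω = t + 1 :=
      X.returnTime_eq_succ_iff.2 ⟨hr, by omega⟩
    rw [X.K_of_absent V hb ht, hb t ht, gap, h2, if_pos t.succ_pos]
    ring
  · rw [if_neg hr, if_neg hr, add_zero]

/-- A3 concerns one absence index at a time, while the index of the absence ending at t + 1 is
random; at most t + 1 indices are possible. -/
theorem jump_eq_sum (i : Fin N) (t : ℕ) (ω : Ω) :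
    X.jump i t ω = ∑ k ∈ Finset.range (t + 1),
      Set.indicator {ω | X.returnTime i (k + 1) ω = t + 1} (X.gap i k) ω := by
  classical
  have h1 := X.one_le_returnCount i t ω
  have h2 : X.returnCount i (t + 1) ω ≤ t + 1 := Nat.count_le _
  simp only [Set.indicator_apply, Set.mem_ofPred_eq, returnTime_eq_succ_iff]
  rw [jump]
  by_cases hr : X.IsReturn i ω (t + 1)
  · rw [if_pos hr, Finset.sum_eq_single (X.returnCount i (t + 1) ω - 1)]
    · rw [if_pos ⟨hr, by omega⟩]
    · intro k _ hk
      rw [if_neg]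
      rintro ⟨-, h⟩
      omega
    · intro h
      exact absurd (Finset.mem_range.2 (by omega)) h
  · rw [if_neg hr]
    exact (Finset.sum_eq_zero fun k _ => if_neg fun h => hr h.1).symm

/-- The subtraction of 1 accounts for slot 0, a return that ends no absence. -/
theorem sum_jump (i : Fin N) (T : ℕ) (ω : Ω) :
    ∑ t ∈ Finset.range T, X.jump i t ω =
      ∑ k ∈ Finset.range (X.returnCount i (T + 1) ω - 1), X.gap i k ω := by
  classical
  induction T with
  | zero => simp [returnCount, Nat.count_succ, X.isReturn_zero]
  | succ T ih =>
    have h1 := X.one_le_returnCount i T ω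
    rw [Finset.sum_range_succ, ih, jump]
    have h2 : X.returnCount i (T + 1 + 1) ω = X.returnCount i (T + 1) ω +
        if X.IsReturn i ω (T + 1) then 1 else 0 := Nat.count_succ _ _
    rw [h2]
    split_ifs with hr
    · rw [Nat.sub_add_comm h1, Finset.sum_range_succ]
    · simp

theorem abs_jump_le (h : X.A1) (i : Fin N) (t : ℕ) (ω : Ω) : |X.jump i t ω| ≤ M.ΔMax i := by
  rw [jump]
  split_ifs
  · exact h i _ ω
  · simpa using M.ΔMax_nonneg i

theorem measurableSet_present (i : Fin N) {t u : ℕ} (htu : t ≤ u) :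
    MeasurableSet[X.ℱ u] {ω | X.Present i t ω} := by
  have : {ω | X.Present i t ω} = ⋃ a ∈ {a | M.part t a i}, {ω | X.A t ω = a} := by
    ext ω; simp [Present]
  rw [this]
  exact MeasurableSet.biUnion (Set.to_countable _) fun a _ => X.ℱ.mono htu _ (X.A_adapted t a)

theorem measurableSet_isReturn (i : Fin N) {t u : ℕ} (htu : t ≤ u) :
    MeasurableSet[X.ℱ u] {ω | X.IsReturn i ω t} := by
  cases t with
  | zero =>
    have : {ω | X.IsReturn i ω 0} = Set.univ := by ext ω; simp [X.isReturn_zero]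
    rw [this]; exact @MeasurableSet.univ _ (X.ℱ u)
  | succ t =>
    simp only [isReturn_succ]
    exact (X.measurableSet_present i htu).inter (X.measurableSet_present i (by omega)).compl

theorem measurableSet_isLeave (i : Fin N) {t u : ℕ} (htu : t ≤ u) :
    MeasurableSet[X.ℱ u] {ω | X.IsLeave i ω t} := by
  cases t with
  | zero =>
    have : {ω | X.IsLeave i ω 0} = ∅ := by
      ext ω
      simpa using fun h : X.IsLeave i ω 0 => h.1 (X.initial i ω)
    rw [this]; exact @MeasurableSet.empty _ (X.ℱ u)
  | succ t =>
    simp only [isLeave_succ]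
    exact (X.measurableSet_present i htu).compl.inter (X.measurableSet_present i (by omega))

theorem measurable_returnTime (i : Fin N) (k : ℕ) : Measurable (X.returnTime i k) :=
  measurable_nth (fun t => X.ℱ.le t _ (X.measurableSet_isReturn i le_rfl)) k

theorem measurable_leaveTime (i : Fin N) (k : ℕ) : Measurable (X.leaveTime i k) :=
  measurable_nth (fun t => X.ℱ.le t _ (X.measurableSet_isLeave i le_rfl)) k

theorem measurable_returnCount (i : Fin N) {t u : ℕ} (htu : t ≤ u + 1) :
    Measurable[X.ℱ u] (X.returnCount i t) := by
  classical
  exact measurable_count fun _ hr => X.measurableSet_isReturn i (by omega)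

theorem measurable_s (i : Fin N) (t : ℕ) : Measurable (X.s i t) :=
  (X.s_adapted i t).mono (X.ℱ.le t) le_rfl

theorem measurable_gap (i : Fin N) (k : ℕ) : Measurable (X.gap i k) :=
  Measurable.ite (measurableSet_lt measurable_const (X.measurable_returnTime i (k + 1)))
    ((measurable_comp_nat (X.measurable_s i) (X.measurable_returnTime i (k + 1))).sub
      (measurable_comp_nat (X.measurable_s i) (X.measurable_leaveTime i k))) measurable_const

theorem measurable_b (i : Fin N) (t : ℕ) : Measurable[X.ℱ t] (X.b i t) :=
  ((X.measurable_A le_rfl M.down).mul (X.xd_adapted i t)).sub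
    ((X.measurable_A le_rfl M.up).mul (X.xu_adapted i t))

theorem measurable_x (i : Fin N) (t : ℕ) : Measurable[X.ℱ t] (X.x i t) :=
  ((X.measurable_A le_rfl M.down).mul (X.xd_adapted i t)).add
    ((X.measurable_A le_rfl M.up).mul (X.xu_adapted i t))

theorem measurable_K (V : ℝ) (i : Fin N) (t : ℕ) : Measurable[X.ℱ t] (X.K V i t) := by
  classical
  induction t with
  | zero => exact (X.s_adapted i 0).sub_const _
  | succ t ih =>
    have : X.K V i (t + 1) = fun ω => if X.IsReturn i ω (t + 1)
        then X.s i (t + 1) ω - shift M B V i else X.K V i t ω + X.b i t ω := by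
      ext ω; rw [K]
    rw [this]
    exact Measurable.ite (X.measurableSet_isReturn i le_rfl)
      ((X.s_adapted i (t + 1)).sub_const _)
      ((ih.add (X.measurable_b i t)).mono (X.ℱ.mono t.le_succ) le_rfl)

theorem measurable_jump (i : Fin N) (t : ℕ) : Measurable (X.jump i t) := by
  have : X.jump i t = fun ω => ∑ k ∈ Finset.range (t + 1),
      Set.indicator {ω | X.returnTime i (k + 1) ω = t + 1} (X.gap i k) ω :=
    funext fun ω => X.jump_eq_sum i t ω
  rw [this]
  exact Finset.measurable_sum _ fun k _ => (X.measurable_gap i k).indicator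
    (measurableSet_eq_fun (X.measurable_returnTime i (k + 1)) measurable_const)

end Operation

end

/-! ### Threshold structure of WMRA and bounds on the virtual queues -/

section

variable {N : ℕ} {S : Type*} [Fintype S] [DecidableEq S]

/-- `1` for regulation down, `-1` for regulation up. -/
def Model.sign (M : Model N S) (a : S) : ℝ := M.down a - M.up a

/-- Unit cost of the external energy sources. -/
def Model.price (M : Model N S) (a : S) : ℝ := M.down a * M.es a + M.up a * M.ed a

/-- Exactly one of regulation down, regulation up and no regulation takes place. -/
theorem Model.regulation_cases (M : Model N S) (a : S) :
    (0 < M.G a ∧ M.down a = 1 ∧ M.up a = 0) ∨ (M.G a < 0 ∧ M.down a = 0 ∧ M.up a = 1) ∨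
      (M.G a = 0 ∧ M.down a = 0 ∧ M.up a = 0) := by
  unfold Model.down Model.up
  rcases lt_trichotomy (M.G a) 0 with h | h | h
  · simp [h, h.not_gt]
  · simp [h]
  · simp [h, h.not_gt]

theorem Model.abs_sign_le (M : Model N S) (a : S) : |M.sign a| ≤ 1 := by
  unfold Model.sign
  rcases M.regulation_cases a with ⟨-, h1, h2⟩ | ⟨-, h1, h2⟩ | ⟨-, h1, h2⟩ <;> simp [h1, h2]

theorem Model.price_le (M : Model N S) (a : S) : M.price a ≤ M.eMax := by
  unfold Model.price
  have h3 := (M.es_mem a).2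
  have h4 := (M.ed_mem a).2
  have h5 := M.eMax_nonneg
  rcases M.regulation_cases a with ⟨-, h1, h2⟩ | ⟨-, h1, h2⟩ | ⟨-, h1, h2⟩ <;> simp [*]

theorem Model.abs_price_le (M : Model N S) (a : S) : |M.price a| ≤ M.eMax + |M.eMin| := by
  have h := M.price_le a
  have h3 := (M.es_mem a).1
  have h4 := (M.ed_mem a).1
  have h5 := M.eMax_nonneg
  have h6 := neg_abs_le M.eMin
  have h7 := abs_nonneg M.eMin
  have : -|M.eMin| ≤ M.price a := by
    unfold Model.price
    rcases M.regulation_cases a with ⟨-, h1, h2⟩ | ⟨-, h1, h2⟩ | ⟨-, h1, h2⟩ <;>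
      simp only [h1, h2] <;> linarith
  rw [abs_le]
  constructor <;> linarith

theorem Model.xMax_le_iSup (M : Model N S) (i : Fin N) : M.xMax i ≤ ⨆ i, M.xMax i :=
  le_ciSup (Set.finite_range _).bddAbove i

theorem Model.Icc_subset (M : Model N S) (i : Fin N) :
    Set.Icc 0 (M.xMax i) ⊆ Set.Icc 0 (⨆ i, M.xMax i) :=
  Set.Icc_subset_Icc_right (M.xMax_le_iSup i)

theorem range_of_le_vMax {M : Model N S} {B : Battery N} {V : ℝ} (hV : V ≤ vMax M B) (i : Fin N) :
    4 * M.xMax i + 2 * (V * (M.ω i * M.μ + M.eMax)) ≤ B.sMax i - B.sMin i := by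
  have h1 : V ≤ (B.sMax i - B.sMin i - 4 * M.xMax i) / (2 * (M.ω i * M.μ + M.eMax)) :=
    hV.trans (ciInf_le (Set.finite_range _).bddBelow i)
  have h2 : 0 < 2 * (M.ω i * M.μ + M.eMax) := by
    have := mul_pos (M.ω_pos i) M.μ_pos
    linarith [M.eMax_nonneg]
  rw [le_div_iff₀ h2] at h1
  linarith

namespace Operation

variable {M : Model N S} {B : Battery N} {Ω : Type*} [mΩ : MeasurableSpace Ω] {ℙ : Measure Ω}
  (X : Operation M B ℙ)

/-- At most one direction is active in a slot, so a sign and a single amount describe both; this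
lets the two subproblems be treated as one. -/
theorem b_eq (i : Fin N) (t : ℕ) (ω : Ω) : X.b i t ω = M.sign (X.A t ω) * X.x i t ω := by
  unfold b x Model.sign
  rcases M.regulation_cases (X.A t ω) with ⟨-, h1, h2⟩ | ⟨-, h1, h2⟩ | ⟨-, h1, h2⟩ <;> simp [h1, h2]

theorem deg_eq (i : Fin N) (t : ℕ) (ω : Ω) : X.deg i t ω = M.C i (X.x i t ω) := by
  unfold deg x
  rcases M.regulation_cases (X.A t ω) with ⟨-, h1, h2⟩ | ⟨-, h1, h2⟩ | ⟨-, h1, h2⟩ <;>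
    simp [h1, h2, M.C_zero]

theorem e_eq (t : ℕ) (ω : Ω) :
    X.e t ω = M.price (X.A t ω) * (|M.G (X.A t ω)| - ∑ i, X.x i t ω) := by
  unfold e x Model.price
  rcases M.regulation_cases (X.A t ω) with ⟨h, h1, h2⟩ | ⟨-, h1, h2⟩ | ⟨-, h1, h2⟩ <;>
    simp [h1, h2]
  rw [abs_of_pos h]; simp

/-- The regulation amounts respect the constraints of (b1) and (b2). -/
def Admissible : Prop := ∀ t ω, (fun i => X.x i t ω) ∈ X.allowed t ω

theorem ind_of_present {i : Fin N} {t : ℕ} {ω : Ω} (h : X.Present i t ω) : X.ind i t ω = 1 := by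
  unfold ind; rw [if_pos h]

theorem ind_of_absent {i : Fin N} {t : ℕ} {ω : Ω} (h : ¬ X.Present i t ω) : X.ind i t ω = 0 := by
  unfold ind; rw [if_neg h]

theorem ind_nonneg (i : Fin N) (t : ℕ) (ω : Ω) : 0 ≤ X.ind i t ω := by
  unfold ind; split_ifs <;> norm_num

theorem ind_mul_le (i : Fin N) (t : ℕ) (ω : Ω) : X.ind i t ω * M.xMax i ≤ M.xMax i := by
  unfold ind; split_ifs <;> simp [(M.xMax_pos i).le]

theorem mem_Icc_of_allowed {y : Fin N → ℝ} {t : ℕ} {ω : Ω} (hy : y ∈ X.allowed t ω) (i : Fin N) :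
    y i ∈ Set.Icc 0 (M.xMax i) :=
  ⟨(hy.1 i).1, (hy.1 i).2.trans (X.ind_mul_le i t ω)⟩

theorem zero_mem_allowed (t : ℕ) (ω : Ω) : (0 : Fin N → ℝ) ∈ X.allowed t ω :=
  ⟨fun i => ⟨le_rfl, mul_nonneg (X.ind_nonneg i t ω) (M.xMax_pos i).le⟩, by simp⟩

variable {X}

theorem Feasible.admissible (h : X.Feasible) : X.Admissible := by
  intro t ω
  have hd := h.down_sum t ω
  have hu := h.up_sum t ω
  have hle : ∀ i a, X.ind i t ω * min (M.xMax i) a ≤ X.ind i t ω * M.xMax i := fun i a =>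
    mul_le_mul_of_nonneg_left (min_le_left _ _) (X.ind_nonneg i t ω)
  rcases M.regulation_cases (X.A t ω) with ⟨h0, h1, h2⟩ | ⟨h0, h1, h2⟩ | ⟨h0, h1, h2⟩ <;>
    rw [h1] at hd <;> rw [h2] at hu <;> refine ⟨fun i => ?_, ?_⟩ <;>
    simp only [x, h1, h2, one_mul, zero_mul, add_zero, zero_add] <;> simp at hd hu
  · exact ⟨(h.down_bound i t ω).1, (h.down_bound i t ω).2.trans (hle i _)⟩
  · exact hd.trans (le_abs_self _)
  · exact ⟨(h.up_bound i t ω).1, (h.up_bound i t ω).2.trans (hle i _)⟩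
  · exact hu
  · exact ⟨le_rfl, mul_nonneg (X.ind_nonneg i t ω) (M.xMax_pos i).le⟩
  · simp

section Admissible

variable (h : X.Admissible)
include h

theorem Admissible.x_mem (i : Fin N) (t : ℕ) (ω : Ω) : X.x i t ω ∈ Set.Icc 0 (M.xMax i) :=
  X.mem_Icc_of_allowed (h t ω) i

theorem Admissible.abs_x_le (i : Fin N) (t : ℕ) (ω : Ω) : |X.x i t ω| ≤ M.xMax i := by
  rw [abs_of_nonneg (h.x_mem i t ω).1]
  exact (h.x_mem i t ω).2

theorem Admissible.deg_mem (i : Fin N) (t : ℕ) (ω : Ω) : X.deg i t ω ∈ Set.Icc 0 (M.cMax i) := by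
  rw [deg_eq]
  exact M.C_mem i _ (h.x_mem i t ω)

theorem Admissible.abs_deg_le (i : Fin N) (t : ℕ) (ω : Ω) : |X.deg i t ω| ≤ M.cMax i := by
  rw [abs_of_nonneg (h.deg_mem i t ω).1]
  exact (h.deg_mem i t ω).2

theorem Admissible.abs_b_le (i : Fin N) (t : ℕ) (ω : Ω) : |X.b i t ω| ≤ M.xMax i := by
  rw [b_eq, abs_mul]
  have h1 := M.abs_sign_le (X.A t ω)
  have h2 := h.abs_x_le i t ω
  have h3 := abs_nonneg (X.x i t ω)
  nlinarith

theorem Admissible.b_of_absent {i : Fin N} {ω : Ω} (t : ℕ) (hp : ¬ X.Present i t ω) :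
    X.b i t ω = 0 := by
  have h1 := (h t ω).1 i
  simp only [X.ind_of_absent hp, zero_mul] at h1
  rw [b_eq, le_antisymm h1.2 h1.1, mul_zero]

theorem Admissible.measurable_deg (i : Fin N) (t : ℕ) : Measurable[X.ℱ t] (X.deg i t) := by
  have : X.deg i t = fun ω => M.C i (X.x i t ω) := funext fun ω => X.deg_eq i t ω
  rw [this]
  exact measurable_comp_of_continuousOn (M.xMax_pos i).le (M.C_cont i) (X.measurable_x i t)
    (h.x_mem i t)

theorem Admissible.measurable_J (i : Fin N) (t : ℕ) : Measurable[X.ℱ t] (X.J i t) := by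
  induction t with
  | zero => exact measurable_const
  | succ t ih =>
    exact (((ih.add (h.measurable_deg i t)).sub_const _).max measurable_const).mono
      (X.ℱ.mono t.le_succ) le_rfl

end Admissible

variable (X) in
theorem J_nonneg (i : Fin N) (t : ℕ) (ω : Ω) : 0 ≤ X.J i t ω := by
  cases t with
  | zero => exact le_rfl
  | succ t => exact le_max_right _ _

variable (X) in
/-- The objective of (b1) and (b2) in a common form. -/
def objective (V : ℝ) (z : Fin N → ℕ → Ω → ℝ) (t : ℕ) (ω : Ω) (y : Fin N → ℝ) : ℝ :=
  V * M.price (X.A t ω) * |M.G (X.A t ω)| +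
    ∑ i, ((M.sign (X.A t ω) * X.K V i t ω - V * M.price (X.A t ω) - X.H z i t ω) * y i +
      X.J i t ω * M.C i (y i))

variable {V : ℝ} {z : Fin N → ℕ → Ω → ℝ}

theorem objDown_eq {t : ℕ} {ω : Ω} (h : 0 < M.G (X.A t ω)) (y : Fin N → ℝ) :
    X.objDown V z t ω y = X.objective V z t ω y := by
  rcases M.regulation_cases (X.A t ω) with ⟨h0, h1, h2⟩ | ⟨h0, h1, h2⟩ | ⟨h0, h1, h2⟩
  · simp only [objDown, objective, Model.sign, Model.price, h1, h2, Finset.sum_add_distrib, sub_mul,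
      Finset.sum_sub_distrib, mul_sub, Finset.mul_sum, abs_of_pos h]
    simp
    ring
  · linarith
  · linarith

theorem objUp_eq {t : ℕ} {ω : Ω} (h : M.G (X.A t ω) < 0) (y : Fin N → ℝ) :
    X.objUp V z t ω y = X.objective V z t ω y := by
  rcases M.regulation_cases (X.A t ω) with ⟨h0, h1, h2⟩ | ⟨h0, h1, h2⟩ | ⟨h0, h1, h2⟩
  · linarith
  · simp only [objUp, objective, Model.sign, Model.price, h1, h2, Finset.sum_add_distrib, sub_mul,
      Finset.sum_sub_distrib, mul_sub, Finset.mul_sum]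
    simp
    ring
  · linarith

section WMRA

variable (h : X.IsWMRA V z)
include h

theorem IsWMRA.admissible : X.Admissible := by
  intro t ω
  rcases M.regulation_cases (X.A t ω) with ⟨h0, h1, h2⟩ | ⟨h0, h1, h2⟩ | ⟨h0, h1, h2⟩
  · simpa [x, h1, h2] using h.xd_mem t ω h0
  · simpa [x, h1, h2] using h.xu_mem t ω h0
  · simp only [x, h1, h2, zero_mul, add_zero]
    exact X.zero_mem_allowed t ω

theorem IsWMRA.isMinOn (t : ℕ) (ω : Ω) :
    IsMinOn (X.objective V z t ω) (X.allowed t ω) fun i => X.x i t ω := by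
  rcases M.regulation_cases (X.A t ω) with ⟨h0, h1, h2⟩ | ⟨h0, h1, h2⟩ | ⟨h0, h1, h2⟩
  · have := h.xd_min t ω h0
    rw [funext (objDown_eq (V := V) (z := z) h0)] at this
    simpa [x, h1, h2] using this
  · have := h.xu_min t ω h0
    rw [funext (objUp_eq (V := V) (z := z) h0)] at this
    simpa [x, h1, h2] using this
  -- With no regulation signal the only allowed vector is 0.
  · intro y hy
    have hsum := hy.2
    rw [h0, abs_zero] at hsum
    have hy0 : y = fun i => X.x i t ω := by
      ext i
      have h3 := (Finset.sum_eq_zero_iff_of_nonneg fun i _ => (hy.1 i).1).1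
        (le_antisymm hsum (Finset.sum_nonneg fun i _ => (hy.1 i).1)) i (Finset.mem_univ i)
      simp [x, h1, h2, h3]
    rw [hy0]
    change X.objective V z t ω _ ≤ X.objective V z t ω _
    exact le_rfl

/-- No EV gains from cancelling its own regulation amount. -/
theorem IsWMRA.local_le (i : Fin N) (t : ℕ) (ω : Ω) :
    (M.sign (X.A t ω) * X.K V i t ω - V * M.price (X.A t ω) - X.H z i t ω) * X.x i t ω +
      X.J i t ω * M.C i (X.x i t ω) ≤ 0 := by
  classical
  have hx := h.admissible t ω
  have hy : Function.update (fun i => X.x i t ω) i 0 ∈ X.allowed t ω := by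
    refine ⟨fun j => ?_, le_trans (Finset.sum_le_sum fun j _ => ?_) hx.2⟩
    · by_cases hj : j = i
      · subst hj
        simpa using mul_nonneg (X.ind_nonneg j t ω) (M.xMax_pos j).le
      · simpa [hj] using hx.1 j
    · by_cases hj : j = i
      · subst hj
        simpa using (hx.1 j).1
      · simp [hj]
  have hmin := isMinOn_iff.1 (h.isMinOn t ω) _ hy
  simp only [objective] at hmin
  rw [← Finset.add_sum_erase _ _ (Finset.mem_univ i),
    ← Finset.add_sum_erase Finset.univ (fun j => _ * Function.update _ i 0 j + _)
    (Finset.mem_univ i)] at hmin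
  have : ∀ j ∈ Finset.univ.erase i,
      (M.sign (X.A t ω) * X.K V j t ω - V * M.price (X.A t ω) - X.H z j t ω) *
        Function.update (fun i => X.x i t ω) i 0 j +
        X.J j t ω * M.C j (Function.update (fun i => X.x i t ω) i 0 j) =
      (M.sign (X.A t ω) * X.K V j t ω - V * M.price (X.A t ω) - X.H z j t ω) * X.x j t ω +
        X.J j t ω * M.C j (X.x j t ω) := fun j hj => by
    rw [Function.update_of_ne (Finset.ne_of_mem_erase hj)]
  rw [Finset.sum_congr rfl this] at hmin
  simp only [Function.update_self, mul_zero, M.C_zero, zero_add] at hmin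
  linarith

theorem IsWMRA.mul_x_nonpos (i : Fin N) (t : ℕ) (ω : Ω) :
    (M.sign (X.A t ω) * X.K V i t ω - V * M.price (X.A t ω) - X.H z i t ω) * X.x i t ω ≤ 0 := by
  have h1 := h.local_le i t ω
  have h2 := mul_nonneg (X.J_nonneg i t ω) (M.C_mem i _ (h.admissible.x_mem i t ω)).1
  linarith

/-- Above the level ωVμ the bound U(z) ≤ μz forces the minimizer z = 0, so H cannot grow; from below
that level one slot adds at most xMax. -/
theorem IsWMRA.H_le (hV : 0 < V) (i : Fin N) (t : ℕ) (ω : Ω) :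
    X.H z i t ω ≤ M.ω i * V * M.μ + M.xMax i := by
  have hpos : 0 < M.ω i * V * M.μ := mul_pos (mul_pos (M.ω_pos i) hV) M.μ_pos
  induction t with
  | zero =>
    rw [H]
    linarith [M.xMax_pos i]
  | succ t ih =>
    rw [H]
    have hx := (h.admissible.x_mem i t ω).1
    have hz := h.z_mem i t ω
    by_cases hH : X.H z i t ω ≤ M.ω i * V * M.μ
    · linarith [hz.2]
    · have h1 := isMinOn_iff.1 (h.z_min i t ω) 0 ⟨le_rfl, (M.xMax_pos i).le⟩
      have h2 := M.U_le _ (M.Icc_subset i hz)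
      rw [M.U_zero] at h1 h2
      have h3 : M.ω i * V * M.U (z i t ω) ≤ M.ω i * V * (M.μ * z i t ω) :=
        mul_le_mul_of_nonneg_left (by linarith) (mul_pos (M.ω_pos i) hV).le
      have h4 : z i t ω ≤ 0 := by
        by_contra hz0
        nlinarith
      linarith

/-- A positive amount requires sign·K ≤ V(ωμ + eMax) + xMax. Thus K moves up or down only from
values at which a step of xMax still fits; `shift` and `vMax` are chosen to make both ends work. -/
theorem IsWMRA.K_mem (hV : 0 < V) (hV' : V ≤ vMax M B) (i : Fin N) (t : ℕ) (ω : Ω) :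
    X.K V i t ω ∈ Set.Icc (B.sMin i - shift M B V i) (B.sMax i - shift M B V i) := by
  have hrange := range_of_le_vMax hV' i
  induction t with
  | zero =>
    have := X.returning i 0 ω (X.initial i ω) (by omega)
    rw [K]
    exact ⟨by linarith [this.1], by linarith [this.2]⟩
  | succ t ih =>
    rw [K]
    split_ifs with hr
    · have := X.returning i (t + 1) ω hr.1 hr.2
      exact ⟨by linarith [this.1], by linarith [this.2]⟩
    · have hx := h.admissible.x_mem i t ω
      have hH := h.H_le hV i t ω
      have hl := h.mul_x_nonpos i t ω
      have hp := mul_le_mul_of_nonneg_left (M.price_le (X.A t ω)) hV.le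
      rw [b_eq]
      rcases hx.1.eq_or_lt with h0 | h0
      · rw [← h0, mul_zero, add_zero]; exact ih
      · have hneg : M.sign (X.A t ω) * X.K V i t ω - V * M.price (X.A t ω) - X.H z i t ω ≤ 0 := by
          by_contra hc
          nlinarith
        have hsign : M.sign (X.A t ω) = 1 ∨ M.sign (X.A t ω) = -1 ∨ M.sign (X.A t ω) = 0 := by
          unfold Model.sign
          rcases M.regulation_cases (X.A t ω) with ⟨-, h1, h2⟩ | ⟨-, h1, h2⟩ | ⟨-, h1, h2⟩ <;>
            simp [h1, h2]
        unfold shift at ih ⊢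
        rcases hsign with hs | hs | hs <;> rw [hs] at hneg ⊢
        · exact ⟨by linarith [ih.1], by linarith [hx.2]⟩
        · exact ⟨by linarith [hx.2], by linarith [ih.2]⟩
        · simpa using ih

theorem IsWMRA.exists_abs_K_le (hV : 0 < V) (hV' : V ≤ vMax M B) (i : Fin N) :
    ∃ c, ∀ t ω, |X.K V i t ω| ≤ c := by
  refine ⟨|B.sMin i - shift M B V i| + |B.sMax i - shift M B V i|, fun t ω => ?_⟩
  have := h.K_mem hV hV' i t ω
  rw [abs_le]
  constructor
  · linarith [this.1, neg_abs_le (B.sMin i - shift M B V i), abs_nonneg (B.sMax i - shift M B V i)]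
  · linarith [this.2, le_abs_self (B.sMax i - shift M B V i), abs_nonneg (B.sMin i - shift M B V i)]

/-- H can decrease only when x > 0, and then local optimality bounds it below by sign·K minus
V·price, which is bounded. The resulting constant depends on V and the battery, but later enters
only terms that vanish as T → ∞. -/
theorem IsWMRA.exists_abs_H_le (hV : 0 < V) (hV' : V ≤ vMax M B) (i : Fin N) :
    ∃ c, ∀ t ω, |X.H z i t ω| ≤ c := by
  obtain ⟨k, hk⟩ := h.exists_abs_K_le hV hV' i
  have hlow : ∀ t ω, -(|k| + V * (M.eMax + |M.eMin|) + M.xMax i) ≤ X.H z i t ω := by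
    intro t ω
    have he : 0 ≤ V * (M.eMax + |M.eMin|) :=
      mul_nonneg hV.le (add_nonneg M.eMax_nonneg (abs_nonneg _))
    induction t with
    | zero =>
      rw [H]
      linarith [M.xMax_pos i, abs_nonneg k]
    | succ t ih =>
      rw [H]
      have hx := h.admissible.x_mem i t ω
      have hl := h.mul_x_nonpos i t ω
      have hz := (h.z_mem i t ω).1
      rcases hx.1.eq_or_lt with h0 | h0
      · linarith
      · have hneg : M.sign (X.A t ω) * X.K V i t ω - V * M.price (X.A t ω) - X.H z i t ω ≤ 0 := by
          by_contra hc
          nlinarith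
        have h1 : |M.sign (X.A t ω) * X.K V i t ω| ≤ |k| := by
          rw [abs_mul]
          have := M.abs_sign_le (X.A t ω)
          have h2 := (hk t ω).trans (le_abs_self k)
          nlinarith [abs_nonneg (X.K V i t ω)]
        have h2 := mul_le_mul_of_nonneg_left
          ((le_abs_self _).trans (M.abs_price_le (X.A t ω))) hV.le
        linarith [neg_abs_le (M.sign (X.A t ω) * X.K V i t ω), hx.2]
  refine ⟨(|k| + V * (M.eMax + |M.eMin|) + M.xMax i) + |M.ω i * V * M.μ + M.xMax i|, fun t ω => ?_⟩
  have h1 := h.H_le hV i t ω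
  have h2 := hlow t ω
  have h3 := le_abs_self (M.ω i * V * M.μ + M.xMax i)
  have h4 : 0 ≤ |k| + V * (M.eMax + |M.eMin|) + M.xMax i :=
    add_nonneg (add_nonneg (abs_nonneg _) (mul_nonneg hV.le
      (add_nonneg M.eMax_nonneg (abs_nonneg _)))) (M.xMax_pos i).le
  rw [abs_le]
  constructor <;> linarith [abs_nonneg (M.ω i * V * M.μ + M.xMax i)]

/-- The virtual queue `J` grows at most like the square root of time. -/
theorem IsWMRA.exists_J_le (hV : 0 < V) (hV' : V ≤ vMax M B) (i : Fin N) :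
    ∃ c, 0 ≤ c ∧ ∀ t ω, X.J i t ω ≤ c * √t := by
  obtain ⟨k, hk⟩ := h.exists_abs_K_le hV hV' i
  obtain ⟨l, hl⟩ := h.exists_abs_H_le hV hV' i
  let D := (|k| + V * (M.eMax + |M.eMin|) + |l|) * M.xMax i
  have he : 0 ≤ V * (M.eMax + |M.eMin|) :=
    mul_nonneg hV.le (add_nonneg M.eMax_nonneg (abs_nonneg _))
  have hD : 0 ≤ D := mul_nonneg (by positivity) (M.xMax_pos i).le
  -- Local optimality again: J·C(x) is at most the gain from the linear terms, all of which are
  -- bounded.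
  have hJC : ∀ t ω, X.J i t ω * X.deg i t ω ≤ D := by
    intro t ω
    have h1 := h.local_le i t ω
    rw [deg_eq]
    have hx := h.admissible.x_mem i t ω
    have h2 : |M.sign (X.A t ω) * X.K V i t ω| ≤ |k| := by
      rw [abs_mul]
      have := M.abs_sign_le (X.A t ω)
      have h2 := (hk t ω).trans (le_abs_self k)
      nlinarith [abs_nonneg (X.K V i t ω)]
    have h3 := mul_le_mul_of_nonneg_left
      ((le_abs_self _).trans (M.abs_price_le (X.A t ω))) hV.le
    have h4 := ((le_abs_self _).trans (hl t ω)).trans (le_abs_self l)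
    have h5 : -(M.sign (X.A t ω) * X.K V i t ω - V * M.price (X.A t ω) - X.H z i t ω) ≤
        |k| + V * (M.eMax + |M.eMin|) + |l| := by
      linarith [neg_abs_le (M.sign (X.A t ω) * X.K V i t ω)]
    have h6 := mul_le_mul_of_nonneg_right h5 hx.1
    have h7 : (|k| + V * (M.eMax + |M.eMin|) + |l|) * X.x i t ω ≤ D :=
      mul_le_mul_of_nonneg_left hx.2 (by positivity)
    linarith
  -- Dropping `cUp` only enlarges the next J, so J² gains at most 2 J·deg + deg² per slot.
  have hsq : ∀ (t : ℕ) ω, X.J i t ω ^ 2 ≤ (2 * D + M.cMax i ^ 2) * t := by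
    intro t ω
    induction t with
    | zero => simp [J]
    | succ t ih =>
      have h1 := X.J_nonneg i t ω
      have h2 := h.admissible.deg_mem i t ω
      have h3 := (M.cUp_mem i).1
      have h4 : X.J i (t + 1) ω ≤ X.J i t ω + X.deg i t ω := by
        rw [J]
        exact max_le (by linarith) (by linarith [h2.1])
      have h5 := X.J_nonneg i (t + 1) ω
      have h6 := hJC t ω
      have h7 := pow_le_pow_left₀ h5 h4 2
      have h8 := pow_le_pow_left₀ h2.1 h2.2 2
      push_cast
      nlinarith
  refine ⟨√(2 * D + M.cMax i ^ 2), Real.sqrt_nonneg _, fun t ω => ?_⟩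
  rw [← Real.sqrt_mul (by positivity)]
  exact Real.le_sqrt_of_sq_le (hsq t ω)

end WMRA

end Operation

end

/-! ### Feasibility of WMRA -/

section

namespace Operation

section Average

variable {Ω : Type*} [mΩ : MeasurableSpace Ω] {ℙ : Measure Ω}

theorem avg_add {f g : ℕ → Ω → ℝ} (hf : ∀ t, Integrable (f t) ℙ) (hg : ∀ t, Integrable (g t) ℙ)
    (T : ℕ) : avg ℙ (fun t ω => f t ω + g t ω) T = avg ℙ f T + avg ℙ g T := by
  simp only [avg, integral_add (hf _) (hg _), Finset.sum_add_distrib, mul_add]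

theorem avg_sub {f g : ℕ → Ω → ℝ} (hf : ∀ t, Integrable (f t) ℙ) (hg : ∀ t, Integrable (g t) ℙ)
    (T : ℕ) : avg ℙ (fun t ω => f t ω - g t ω) T = avg ℙ f T - avg ℙ g T := by
  simp only [avg, integral_sub (hf _) (hg _), Finset.sum_sub_distrib, mul_sub]

theorem avg_const_mul (a : ℝ) (f : ℕ → Ω → ℝ) (T : ℕ) :
    avg ℙ (fun t ω => a * f t ω) T = a * avg ℙ f T := by
  simp only [avg, integral_const_mul, ← Finset.mul_sum]
  ring

theorem avg_sum {ι : Type*} (s : Finset ι) {f : ι → ℕ → Ω → ℝ}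
    (hf : ∀ i t, Integrable (f i t) ℙ) (T : ℕ) :
    avg ℙ (fun t ω => ∑ i ∈ s, f i t ω) T = ∑ i ∈ s, avg ℙ (f i) T := by
  simp only [avg, integral_finsetSum s fun i _ => hf i _]
  rw [Finset.sum_comm, Finset.mul_sum]

theorem avg_mono {f g : ℕ → Ω → ℝ} (hf : ∀ t, Integrable (f t) ℙ) (hg : ∀ t, Integrable (g t) ℙ)
    (hfg : ∀ t ω, f t ω ≤ g t ω) (T : ℕ) : avg ℙ f T ≤ avg ℙ g T :=
  mul_le_mul_of_nonneg_left
    (Finset.sum_le_sum fun t _ => integral_mono (hf t) (hg t) (hfg t)) (by positivity)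

theorem avg_nonneg {f : ℕ → Ω → ℝ} (hf : ∀ t ω, 0 ≤ f t ω) (T : ℕ) : 0 ≤ avg ℙ f T :=
  mul_nonneg (by positivity) (Finset.sum_nonneg fun t _ => integral_nonneg (hf t))

theorem avg_le_of_sum_le {f : ℕ → Ω → ℝ} {T : ℕ} {c : ℝ} (hT : 0 < T)
    (h : ∑ t ∈ Finset.range T, ∫ ω, f t ω ∂ℙ ≤ T * c) : avg ℙ f T ≤ c := by
  have hT' : (0 : ℝ) < T := by exact_mod_cast hT
  rw [avg, one_div, inv_mul_le_iff₀ hT']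
  exact h

variable [IsProbabilityMeasure ℙ]

theorem avg_const (c : ℝ) {T : ℕ} (hT : 0 < T) : avg ℙ (fun _ _ => c) T = c := by
  have hT' : (T : ℝ) ≠ 0 := by exact_mod_cast hT.ne'
  simp [avg, hT']

theorem abs_avg_le {f : ℕ → Ω → ℝ} {c : ℝ} (hc : 0 ≤ c) (hf : ∀ t ω, |f t ω| ≤ c) (T : ℕ) :
    |avg ℙ f T| ≤ c := by
  rcases T.eq_zero_or_pos with rfl | hT
  · simpa [avg] using hc
  · have hT' : (0 : ℝ) < T := by exact_mod_cast hT
    rw [avg, abs_mul, abs_of_pos (by positivity), one_div, inv_mul_le_iff₀ hT']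
    refine (Finset.abs_sum_le_sum_abs _ _).trans
      ((Finset.sum_le_sum fun t _ => abs_integral_le_of_abs_le (hf t)).trans ?_)
    simp

theorem avg_mem_Icc {f : ℕ → Ω → ℝ} {c : ℝ} (hf : ∀ t ω, f t ω ∈ Set.Icc 0 c) (hc : 0 ≤ c) (T : ℕ) :
    avg ℙ f T ∈ Set.Icc 0 c :=
  ⟨avg_nonneg (fun t ω => (hf t ω).1) T, (le_abs_self _).trans (abs_avg_le hc (fun t ω => by
    rw [abs_of_nonneg (hf t ω).1]; exact (hf t ω).2) T)⟩

end Average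

theorem limsup_le_of_le_tendsto {u v : ℕ → ℝ} {c : ℝ} (hu : ∀ n, 0 ≤ u n)
    (huv : ∀ᶠ n in atTop, u n ≤ v n) (hv : Tendsto v atTop (nhds c)) : limsup u atTop ≤ c := by
  rw [← hv.limsup_eq]
  exact limsup_le_limsup huv (isBoundedUnder_of ⟨0, hu⟩).isCoboundedUnder_le hv.isBoundedUnder_le

theorem tendsto_sqrt_div : Tendsto (fun T : ℕ => √(T : ℝ) / T) atTop (nhds 0) := by
  have h : (fun T : ℕ => √(T : ℝ) / T) = fun T : ℕ => (√(T : ℝ))⁻¹ := by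
    ext T
    rw [Real.sqrt_div_self', one_div]
  rw [h]
  exact tendsto_inv_atTop_zero.comp
    (Real.tendsto_sqrt_atTop.comp tendsto_natCast_atTop_atTop)

variable {N : ℕ} {S : Type*} [Fintype S] [DecidableEq S]
  {M : Model N S} {B : Battery N} {Ω : Type*} [mΩ : MeasurableSpace Ω] {ℙ : Measure Ω}
  {X : Operation M B ℙ} {V : ℝ} {z : Fin N → ℕ → Ω → ℝ}

theorem sum_deg_le (i : Fin N) (T : ℕ) (ω : Ω) :
    ∑ t ∈ Finset.range T, X.deg i t ω ≤ T * M.cUp i + X.J i T ω := by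
  induction T with
  | zero => simp [J]
  | succ T ih =>
    rw [Finset.sum_range_succ]
    have : X.J i T ω + X.deg i T ω - M.cUp i ≤ X.J i (T + 1) ω := le_max_left _ _
    push_cast
    linarith

variable [IsProbabilityMeasure ℙ]

theorem Admissible.integrable_deg (h : X.Admissible) (i : Fin N) (t : ℕ) :
    Integrable (X.deg i t) ℙ :=
  integrable_of_abs_le ((h.measurable_deg i t).mono (X.ℱ.le t) le_rfl) (h.abs_deg_le i t)

theorem Admissible.integrable_x (h : X.Admissible) (i : Fin N) (t : ℕ) :
    Integrable (X.x i t) ℙ :=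
  integrable_of_abs_le ((X.measurable_x i t).mono (X.ℱ.le t) le_rfl) (h.abs_x_le i t)

theorem Admissible.integrable_b (h : X.Admissible) (i : Fin N) (t : ℕ) :
    Integrable (X.b i t) ℙ :=
  integrable_of_abs_le ((X.measurable_b i t).mono (X.ℱ.le t) le_rfl) (h.abs_b_le i t)

/-- The queue J records the excess of accumulated cost over T·`cUp`; growth of order √T is
negligible after division by T. -/
theorem IsWMRA.limsup_deg_le (h : X.IsWMRA V z) (hV : 0 < V) (hV' : V ≤ vMax M B) (i : Fin N) :
    limsup (avg ℙ (X.deg i)) atTop ≤ M.cUp i := by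
  obtain ⟨c, hc, hJ⟩ := h.exists_J_le hV hV' i
  refine limsup_le_of_le_tendsto (v := fun T : ℕ => M.cUp i + c * (√(T : ℝ) / T))
    (avg_nonneg fun t ω => (h.admissible.deg_mem i t ω).1) ?_ ?_
  · filter_upwards [eventually_gt_atTop 0] with T hT
    refine avg_le_of_sum_le hT ?_
    have hT' : (T : ℝ) ≠ 0 := by exact_mod_cast hT.ne'
    rw [← integral_finsetSum _ fun t _ => h.admissible.integrable_deg i t]
    have hle : ∀ ω, ∑ t ∈ Finset.range T, X.deg i t ω ≤ T * M.cUp i + c * √T := fun ω =>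
      (sum_deg_le i T ω).trans (by gcongr; exact hJ T ω)
    have h1 := integral_mono (μ := ℙ)
      (integrable_finsetSum (Finset.range T) fun t _ => h.admissible.integrable_deg i t)
      (integrable_const _) hle
    rw [integral_const, probReal_univ, one_smul] at h1
    refine h1.trans_eq ?_
    field_simp
  · simpa using (tendsto_sqrt_div.const_mul c).const_add (M.cUp i)

omit [IsProbabilityMeasure ℙ] in
theorem IsWMRA.s_mem (h : X.IsWMRA V z) (hV : 0 < V) (hV' : V ≤ vMax M B) {i : Fin N} {t : ℕ}
    {ω : Ω} (hp : X.Present i t ω) : X.s i t ω ∈ Set.Icc (B.sMin i) (B.sMax i) := by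
  have h1 := h.K_mem hV hV' i t ω
  rw [X.K_of_present V hp] at h1
  exact ⟨by linarith [h1.1], by linarith [h1.2]⟩

-- A positive amount is chosen only below the charging threshold, where the preferred range has room
-- for a full xMax. The bound for regulation up is symmetric.
omit [IsProbabilityMeasure ℙ] in
theorem IsWMRA.down_le (h : X.IsWMRA V z) (hV : 0 < V) (hV' : V ≤ vMax M B) (i : Fin N) (t : ℕ)
    (ω : Ω) (hG : 0 < M.G (X.A t ω)) (hp : X.Present i t ω) :
    X.xd i t ω ≤ B.sMax i - X.s i t ω := by
  rcases M.regulation_cases (X.A t ω) with ⟨h0, h1, h2⟩ | ⟨h0, h1, h2⟩ | ⟨h0, h1, h2⟩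
  · have hs := h.s_mem hV hV' hp
    have hx := h.admissible.x_mem i t ω
    have hH := h.H_le hV i t ω
    have hl := h.mul_x_nonpos i t ω
    have hprice := mul_le_mul_of_nonneg_left (M.price_le (X.A t ω)) hV.le
    have hrange := range_of_le_vMax hV' i
    have hxd : X.x i t ω = X.xd i t ω := by simp [x, h1, h2]
    rw [hxd] at hx hl
    rcases hx.1.eq_or_lt with hx0 | hx0
    · linarith [hs.2]
    · rw [X.K_of_present V hp, Model.sign, h1, h2] at hl
      have hneg : (1 - 0) * (X.s i t ω - shift M B V i) - V * M.price (X.A t ω) -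
          X.H z i t ω ≤ 0 := by
        by_contra hc
        nlinarith
      unfold shift at hneg
      linarith [hx.2]
  · linarith
  · linarith

omit [IsProbabilityMeasure ℙ] in
theorem IsWMRA.up_le (h : X.IsWMRA V z) (hV : 0 < V) (hV' : V ≤ vMax M B) (i : Fin N) (t : ℕ)
    (ω : Ω) (hG : M.G (X.A t ω) < 0) (hp : X.Present i t ω) :
    X.xu i t ω ≤ X.s i t ω - B.sMin i := by
  rcases M.regulation_cases (X.A t ω) with ⟨h0, h1, h2⟩ | ⟨h0, h1, h2⟩ | ⟨h0, h1, h2⟩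
  · linarith
  · have hs := h.s_mem hV hV' hp
    have hx := h.admissible.x_mem i t ω
    have hH := h.H_le hV i t ω
    have hl := h.mul_x_nonpos i t ω
    have hprice := mul_le_mul_of_nonneg_left (M.price_le (X.A t ω)) hV.le
    have hxu : X.x i t ω = X.xu i t ω := by simp [x, h1, h2]
    rw [hxu] at hx hl
    rcases hx.1.eq_or_lt with hx0 | hx0
    · linarith [hs.1]
    · rw [X.K_of_present V hp, Model.sign, h1, h2] at hl
      have hneg : (0 - 1) * (X.s i t ω - shift M B V i) - V * M.price (X.A t ω) -
          X.H z i t ω ≤ 0 := by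
        by_contra hc
        nlinarith
      unfold shift at hneg
      linarith [hx.2]
  · linarith

/-- The WMRA allocations are feasible for P1. -/
theorem IsWMRA.feasible (h : X.IsWMRA V z) (hV : 0 < V) (hV' : V ≤ vMax M B) : X.Feasible where
  down_bound i t ω := by
    by_cases hp : X.Present i t ω
    · rw [X.ind_of_present hp, one_mul]
      by_cases hG : 0 < M.G (X.A t ω)
      · have hmem := X.mem_Icc_of_allowed (h.xd_mem t ω hG) i
        exact ⟨hmem.1, le_min hmem.2 (h.down_le hV hV' i t ω hG hp)⟩
      · rw [h.xd_zero i t ω hG]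
        exact ⟨le_rfl, le_min (M.xMax_pos i).le (sub_nonneg.2 (h.s_mem hV hV' hp).2)⟩
    · rw [X.ind_of_absent hp, zero_mul]
      by_cases hG : 0 < M.G (X.A t ω)
      · have := (h.xd_mem t ω hG).1 i
        rwa [X.ind_of_absent hp, zero_mul] at this
      · simp [h.xd_zero i t ω hG]
  up_bound i t ω := by
    by_cases hp : X.Present i t ω
    · rw [X.ind_of_present hp, one_mul]
      by_cases hG : M.G (X.A t ω) < 0
      · have hmem := X.mem_Icc_of_allowed (h.xu_mem t ω hG) i
        exact ⟨hmem.1, le_min hmem.2 (h.up_le hV hV' i t ω hG hp)⟩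
      · rw [h.xu_zero i t ω hG]
        exact ⟨le_rfl, le_min (M.xMax_pos i).le (sub_nonneg.2 (h.s_mem hV hV' hp).1)⟩
    · rw [X.ind_of_absent hp, zero_mul]
      by_cases hG : M.G (X.A t ω) < 0
      · have := (h.xu_mem t ω hG).1 i
        rwa [X.ind_of_absent hp, zero_mul] at this
      · simp [h.xu_zero i t ω hG]
  down_sum t ω := by
    rcases M.regulation_cases (X.A t ω) with ⟨h0, h1, h2⟩ | ⟨h0, h1, h2⟩ | ⟨h0, h1, h2⟩
    · rw [h1, one_mul, ← abs_of_pos h0]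
      exact (h.xd_mem t ω h0).2
    · simp [h1, h.xd_zero _ t ω h0.not_gt]
    · simp [h1, h.xd_zero _ t ω h0.le.not_gt]
  up_sum t ω := by
    rcases M.regulation_cases (X.A t ω) with ⟨h0, h1, h2⟩ | ⟨h0, h1, h2⟩ | ⟨h0, h1, h2⟩
    · simp [h2, h.xu_zero _ t ω h0.not_gt]
    · rw [h2, one_mul]
      exact (h.xu_mem t ω h0).2
    · simp [h2, h.xu_zero _ t ω h0.ge.not_gt]
  degradation i := h.limsup_deg_le hV hV' i

end Operation

end

/-! ### Energy balance of feasible policies -/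

section

theorem abs_sum_range_sub_le {g : ℕ → ℝ} {c : ℝ} (hg : ∀ k, |g k| ≤ c) (n m : ℕ) :
    |∑ k ∈ Finset.range n, g k - ∑ k ∈ Finset.range m, g k| ≤ c * |(n : ℝ) - m| := by
  have key : ∀ n m : ℕ, n ≤ m →
      |∑ k ∈ Finset.range m, g k - ∑ k ∈ Finset.range n, g k| ≤ c * ((m : ℝ) - n) := by
    intro n m hnm
    rw [← Finset.sum_Ico_eq_sub _ hnm]
    refine (Finset.abs_sum_le_sum_abs _ _).trans ((Finset.sum_le_sum fun k _ => hg k).trans ?_)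
    simp [Nat.cast_sub hnm, mul_comm]
  rcases le_total n m with h | h
  · rw [abs_sub_comm, abs_sub_comm (n : ℝ),
      abs_of_nonneg (sub_nonneg.2 (Nat.cast_le.2 h) : (0 : ℝ) ≤ m - n)]
    exact key n m h
  · rw [abs_of_nonneg (sub_nonneg.2 (Nat.cast_le.2 h) : (0 : ℝ) ≤ n - m)]
    exact key m n h

variable {N : ℕ} {S : Type*} [Fintype S] [DecidableEq S]

theorem Model.part_mod {M : Model N S} {p : ℕ} [NeZero p] (hp : ∀ t, M.part (t + p) = M.part t)
    (t : ℕ) : M.part ((t : ZMod p)).val = M.part t := by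
  have h : ∀ k t : ℕ, M.part (t + p * k) = M.part t := by
    intro k
    induction k with
    | zero => simp
    | succ k ih => intro t; rw [Nat.mul_succ, ← Nat.add_assoc, hp, ih]
  rw [ZMod.val_natCast]
  conv_rhs => rw [← Nat.mod_add_div t p, h]

namespace Operation

variable {M : Model N S} {B : Battery N} {Ω : Type*} [mΩ : MeasurableSpace Ω] {ℙ : Measure Ω}
  {X : Operation M B ℙ}

theorem Feasible.K_mem (h : X.Feasible) (V : ℝ) (i : Fin N) (t : ℕ) (ω : Ω) :
    X.K V i t ω ∈ Set.Icc (B.sMin i - shift M B V i) (B.sMax i - shift M B V i) := by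
  induction t with
  | zero =>
    have := X.returning i 0 ω (X.initial i ω) (by omega)
    rw [K]
    exact ⟨by linarith [this.1], by linarith [this.2]⟩
  | succ t ih =>
    rw [K]
    split_ifs with hr
    · have := X.returning i (t + 1) ω hr.1 hr.2
      exact ⟨by linarith [this.1], by linarith [this.2]⟩
    · by_cases hp : X.Present i t ω
      · have hK := X.K_of_present V hp
        have hd := h.down_bound i t ω
        have hu := h.up_bound i t ω
        rw [X.ind_of_present hp, one_mul] at hd hu
        have hd' := hd.2.trans (min_le_right _ _)
        have hu' := hu.2.trans (min_le_right _ _)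
        rw [hK] at ih ⊢
        unfold b
        rcases M.regulation_cases (X.A t ω) with ⟨-, h1, h2⟩ | ⟨-, h1, h2⟩ | ⟨-, h1, h2⟩ <;>
          rw [h1, h2] <;> constructor <;> linarith [ih.1, ih.2]
      · rw [h.admissible.b_of_absent t hp, add_zero]
        exact ih

open Classical in
/-- The indicator that an EV returns in slot `t + 1`, as a function of two states. -/
def returnIndicator (M : Model N S) (i : Fin N) (t : ℕ) (a b : S) : ℝ :=
  if M.part (t + 1) b i ∧ ¬ M.part t a i then 1 else 0

theorem returnIndicator_mem (i : Fin N) (t : ℕ) (a b : S) :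
    returnIndicator M i t a b ∈ Set.Icc (0 : ℝ) 1 := by
  unfold returnIndicator; split_ifs <;> simp

/-- The probability that an EV returns in the next slot, as a function of the phase. -/
def returnRate (M : Model N S) (p : ℕ) (i : Fin N) (q : ZMod p × S) : ℝ :=
  ∑ b, M.P q.2 b * returnIndicator M i q.1.val q.2 b

theorem returnRate_mem (p : ℕ) (i : Fin N) (q : ZMod p × S) :
    returnRate M p i q ∈ Set.Icc (0 : ℝ) 1 := by
  have hP : ∀ b, 0 ≤ M.P q.2 b := fun b => Matrix.nonneg_of_mem_rowStochastic M.P_stochastic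
  refine ⟨Finset.sum_nonneg fun b _ => mul_nonneg (hP b) (returnIndicator_mem i _ _ b).1, ?_⟩
  rw [← Matrix.sum_row_of_mem_rowStochastic M.P_stochastic q.2]
  exact Finset.sum_le_sum fun b _ =>
    mul_le_of_le_one_right (hP b) (returnIndicator_mem i _ _ b).2

variable (X) in
/-- Number of returns in the slots `1, …, t`. -/
def returns (i : Fin N) (t : ℕ) (ω : Ω) : ℕ := X.returnCount i (t + 1) ω - 1

theorem returns_zero (i : Fin N) (ω : Ω) : X.returns i 0 ω = 0 := by
  classical
  simp [returns, returnCount, Nat.count_succ, X.isReturn_zero]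

theorem returns_succ (i : Fin N) (t : ℕ) (ω : Ω) :
    (X.returns i (t + 1) ω : ℝ) =
      X.returns i t ω + returnIndicator M i t (X.A t ω) (X.A (t + 1) ω) := by
  classical
  have h1 := X.one_le_returnCount i t ω
  have h2 : X.returnCount i (t + 1 + 1) ω = X.returnCount i (t + 1) ω +
      if X.IsReturn i ω (t + 1) then 1 else 0 := Nat.count_succ _ _
  have h3 : X.IsReturn i ω (t + 1) ↔
      M.part (t + 1) (X.A (t + 1) ω) i ∧ ¬ M.part t (X.A t ω) i := X.isReturn_succ
  simp only [returns, h2, returnIndicator, ← h3]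
  split_ifs
  · rw [Nat.sub_add_comm h1]; push_cast; ring
  · simp

theorem measurable_returns (i : Fin N) (t : ℕ) :
    Measurable[X.ℱ t] fun ω => (X.returns i t ω : ℝ) := by
  have h1 : Measurable[X.ℱ t] (X.returnCount i (t + 1)) := X.measurable_returnCount i le_rfl
  exact (measurable_from_top (f := fun n : ℕ => ((n - 1 : ℕ) : ℝ))).comp h1

variable [IsProbabilityMeasure ℙ]

section LawOfLargeNumbers

variable {p : ℕ} [NeZero p] {w : ZMod p × S → ℝ} {κ : ℝ}

theorem weighted_mem_Icc (hw : IsPoisson p M.P w κ) {f : ZMod p × S → ℝ} {c : ℝ}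
    (hf : ∀ q, f q ∈ Set.Icc 0 c) : ∑ q, w q * f q ∈ Set.Icc 0 c := by
  refine ⟨Finset.sum_nonneg fun q _ => mul_nonneg (hw.weight_nonneg q) (hf q).1, ?_⟩
  calc ∑ q, w q * f q ≤ ∑ q, w q * c :=
        Finset.sum_le_sum fun q _ => mul_le_mul_of_nonneg_left (hf q).2 (hw.weight_nonneg q)
    _ = c := by rw [← Finset.sum_mul, hw.weight_sum, one_mul]

/-- The number of returns deviates from its trend by the order of the square root of time. -/
theorem exists_integral_returns_le (hp : ∀ t, M.part (t + p) = M.part t)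
    (hw : IsPoisson p M.P w κ) (i : Fin N) :
    ∃ ρ : ℝ, 0 ≤ ρ ∧ ∀ T : ℕ, 0 < T →
      Integrable (fun ω => |(X.returns i T ω : ℝ) - ρ * T|) ℙ ∧
      ∫ ω, |(X.returns i T ω : ℝ) - ρ * T| ∂ℙ ≤ (2 * κ + 1) * √T := by
  -- The long-run return rate: the stationary mean of the one-step return probability.
  let ρ := ∑ q, w q * returnRate M p i q
  have hρ : ρ ∈ Set.Icc (0 : ℝ) 1 := weighted_mem_Icc hw (returnRate_mem p i)
  let Z : ℕ → Ω → ℝ := fun t ω => X.returns i t ω - ρ * t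
  have hZm : ∀ t, Measurable[X.ℱ t] (Z t) := fun t => (measurable_returns i t).sub_const _
  have hZm' : ∀ t, Measurable (Z t) := fun t => (hZm t).mono (X.ℱ.le t) le_rfl
  let r : ℕ → Ω → ℝ := fun t ω => returnIndicator M i t (X.A t ω) (X.A (t + 1) ω)
  have hstep : ∀ t ω, Z (t + 1) ω = Z t ω + (r t ω - ρ) := fun t ω => by
    simp only [Z, r, returns_succ]; push_cast; ring
  have hr1 : ∀ t ω, |r t ω - ρ| ≤ 1 := fun t ω => by
    have := returnIndicator_mem (M := M) i t (X.A t ω) (X.A (t + 1) ω)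
    rw [abs_le]
    constructor <;> linarith [this.1, this.2, hρ.1, hρ.2]
  have hZb : ∀ (t : ℕ) ω, |Z t ω| ≤ t := by
    intro t ω
    induction t with
    | zero => simp [Z, returns_zero]
    | succ t ih =>
      rw [hstep]
      push_cast
      exact (abs_add_le _ _).trans (add_le_add ih (hr1 t ω))
  have hZ2 : ∀ t, Integrable (fun ω => Z t ω ^ 2) ℙ := fun t =>
    integrable_of_abs_le (c := (t : ℝ) ^ 2) ((hZm' t).pow_const 2) fun ω => by
      rw [abs_pow]; exact pow_le_pow_left₀ (abs_nonneg _) (hZb t ω) 2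
  have hZr : ∀ t, Integrable (fun ω => Z t ω * (r t ω - ρ)) ℙ := fun t => by
    have he : (fun ω => Z t ω * (r t ω - ρ)) = fun ω => Z t ω * (Z (t + 1) ω - Z t ω) := by
      ext ω; rw [hstep]; ring
    refine integrable_of_abs_le (c := (t : ℝ) * 1) ?_ fun ω => ?_
    · rw [he]; exact (hZm' t).mul ((hZm' (t + 1)).sub (hZm' t))
    · rw [abs_mul]
      exact mul_le_mul (hZb t ω) (hr1 t ω) (abs_nonneg _) (Nat.cast_nonneg t)
  -- Conditioning on slot t turns the return indicator into its rate, a function of the phase, to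
  -- which the Poisson estimate applies.
  have hpair : ∀ t, ∫ ω, Z t ω * (r t ω - ρ) ∂ℙ =
      ∫ ω, Z t ω * (returnRate M p i (X.phase p t ω) - ρ) ∂ℙ := by
    intro t
    have h1 := X.integral_mul_pair (hZm t) (hZb t) fun a b => returnIndicator M i t a b - ρ
    refine h1.trans (integral_congr_ae (ae_of_all _ fun ω => ?_))
    -- After reduction modulo p, `val + 1` may equal p; periodicity identifies it with residue 0.
    have h2 : ∀ a b, returnIndicator M i ((t : ZMod p)).val a b = returnIndicator M i t a b := by
      intro a b
      unfold returnIndicator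
      have h3 : M.part (((t : ZMod p)).val + 1) = M.part (t + 1) := by
        rw [← M.part_mod hp (((t : ZMod p)).val + 1), ← M.part_mod hp (t + 1)]
        simp
      rw [M.part_mod hp, h3]
    simp only [returnRate, phase, h2, mul_sub, Finset.sum_sub_distrib, ← Finset.sum_mul,
      Matrix.sum_row_of_mem_rowStochastic M.P_stochastic, one_mul]
  have hkey := fun T => X.abs_sum_integral_mul_phase_le hw (f := returnRate M p i) (R := 1)
    (fun q => by
      rw [abs_of_nonneg (returnRate_mem p i q).1]; exact (returnRate_mem p i q).2)
    (Y := Z) (c := fun t => (t : ℝ)) (β := 1) hZm hZb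
    (fun t ω => by rw [hstep, add_sub_cancel_left]; exact hr1 t ω) T
  -- Expanding the square, each step contributes twice a correlation and at most 1. The correlations
  -- sum to at most κ(T + T), whence the constant 4κ + 1 below.
  have hsum : ∀ T : ℕ, ∫ ω, Z T ω ^ 2 ∂ℙ ≤
      2 * ∑ t ∈ Finset.range T, ∫ ω, Z t ω * (returnRate M p i (X.phase p t ω) - ρ) ∂ℙ + T := by
    intro T
    induction T with
    | zero => simp [Z, returns_zero]
    | succ T ih =>
      have hI : Integrable (fun ω => Z T ω ^ 2 + 2 * (Z T ω * (r T ω - ρ))) ℙ :=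
        (hZ2 T).add ((hZr T).const_mul 2)
      have h1 : ∫ ω, Z (T + 1) ω ^ 2 ∂ℙ ≤ ∫ ω, (Z T ω ^ 2 + 2 * (Z T ω * (r T ω - ρ)) + 1) ∂ℙ := by
        refine integral_mono (hZ2 _) (hI.add (integrable_const _)) fun ω => ?_
        have h2 := sq_le_one_iff_abs_le_one (r T ω - ρ) |>.2 (hr1 T ω)
        have h3 := hstep T ω
        simp only [h3]
        nlinarith
      rw [integral_add hI (integrable_const _),
        integral_add (hZ2 T) ((hZr T).const_mul 2), integral_const_mul, hpair] at h1
      simp only [integral_const, probReal_univ, one_smul] at h1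
      rw [Finset.sum_range_succ]
      push_cast
      linarith
  refine ⟨ρ, hρ.1, fun T hT => ?_⟩
  have hI : Integrable (fun ω => |Z T ω|) ℙ :=
    (integrable_of_abs_le (hZm' T) (hZb T)).abs
  refine ⟨hI, ?_⟩
  have hs : 0 < √(T : ℝ) := Real.sqrt_pos.2 (by exact_mod_cast hT)
  have hs2 : √(T : ℝ) * √T = T := Real.mul_self_sqrt (Nat.cast_nonneg T)
  have h1 : ∫ ω, Z T ω ^ 2 ∂ℙ ≤ (4 * κ + 1) * T := by
    have h2 := hsum T
    have h3 := (abs_le.1 (hkey T)).2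
    push_cast at h3
    linarith
  -- The inequality 2√T·|Z| ≤ Z² + T passes from the second moment to the first and gives (4κ + 2)/2
  -- = 2κ + 1.
  have h2 : ∫ ω, 2 * √T * |Z T ω| ∂ℙ ≤ ∫ ω, (Z T ω ^ 2 + T) ∂ℙ := by
    refine integral_mono (hI.const_mul _) ((hZ2 T).add (integrable_const _)) fun ω => ?_
    have := sq_nonneg (|Z T ω| - √T)
    have h3 := sq_abs (Z T ω)
    simp only
    nlinarith
  rw [integral_const_mul, integral_add (hZ2 T) (integrable_const _), integral_const,
    probReal_univ, one_smul] at h2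
  have h3 : √T * ∫ ω, |Z T ω| ∂ℙ ≤ √T * ((2 * κ + 1) * √T) := by
    have h4 : √(T : ℝ) * ((2 * κ + 1) * √T) = (2 * κ + 1) * T := by
      linear_combination (2 * κ + 1) * hs2
    rw [h4]
    linarith
  exact le_of_mul_le_mul_left h3 hs

/-- The energy delivered by a feasible policy averages out. -/
theorem Feasible.tendsto_avg_b (h : X.Feasible) (h1 : X.A1) (h2 : X.A2)
    (hp : ∀ t, M.part (t + p) = M.part t) (hw : IsPoisson p M.P w κ) (i : Fin N) :
    Tendsto (avg ℙ (X.b i)) atTop (nhds 0) := by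
  obtain ⟨ρ, hρ, hret⟩ := exists_integral_returns_le (X := X) hp hw i
  -- The parameter V = 0 is an arbitrary choice: only differences of K matter here, and V shifts K
  -- by a constant.
  let c := |B.sMin i - shift M B 0 i| + |B.sMax i - shift M B 0 i|
  have hK : ∀ t ω, |X.K 0 i t ω| ≤ c := by
    intro t ω
    have := h.K_mem 0 i t ω
    rw [abs_le]
    constructor
    · linarith [this.1, neg_abs_le (B.sMin i - shift M B 0 i),
        abs_nonneg (B.sMax i - shift M B 0 i)]
    · linarith [this.2, le_abs_self (B.sMax i - shift M B 0 i),
        abs_nonneg (B.sMin i - shift M B 0 i)]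
  have hgapI : ∀ k, Integrable (X.gap i k) ℙ := fun k =>
    integrable_of_abs_le (X.measurable_gap i k) (h1 i k)
  have hsum : ∀ T ω, ∑ t ∈ Finset.range T, X.b i t ω =
      X.K 0 i T ω - X.K 0 i 0 ω - ∑ k ∈ Finset.range (X.returns i T ω), X.gap i k ω := by
    intro T ω
    rw [returns, ← X.sum_jump i T ω]
    induction T with
    | zero => simp
    | succ T ih =>
      rw [Finset.sum_range_succ, Finset.sum_range_succ, ih,
        X.K_succ 0 (fun t => h.admissible.b_of_absent t) T]
      ring
  have hbound : ∀ T : ℕ, 0 < T → |∑ t ∈ Finset.range T, ∫ ω, X.b i t ω ∂ℙ| ≤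
      2 * c + M.ΔMax i * ((2 * κ + 1) * √T + 1) := by
    intro T hT
    obtain ⟨hI, hE⟩ := hret T hT
    have hbI := integrable_finsetSum (Finset.range T) fun t _ => h.admissible.integrable_b i t
    have hgI := integrable_finsetSum (Finset.range ⌊ρ * T⌋₊) fun k _ => hgapI k
    have e1 : ∑ t ∈ Finset.range T, ∫ ω, X.b i t ω ∂ℙ = ∫ ω, (∑ t ∈ Finset.range T, X.b i t ω +
        ∑ k ∈ Finset.range ⌊ρ * T⌋₊, X.gap i k ω) ∂ℙ := by
      rw [integral_add hbI hgI, integral_finsetSum _ fun t _ => h.admissible.integrable_b i t,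
        integral_finsetSum _ fun k _ => hgapI k, Finset.sum_congr rfl fun k _ => h2 i k]
      simp
    rw [e1]
    refine abs_integral_le_integral_abs.trans ?_
    have hle : ∀ ω, |∑ t ∈ Finset.range T, X.b i t ω +
        ∑ k ∈ Finset.range ⌊ρ * T⌋₊, X.gap i k ω| ≤
          2 * c + M.ΔMax i * (|(X.returns i T ω : ℝ) - ρ * T| + 1) := by
      intro ω
      have h3 := abs_sum_range_sub_le (fun k => h1 i k ω) (X.returns i T ω) ⌊ρ * T⌋₊
      have h4 : |(X.returns i T ω : ℝ) - ⌊ρ * T⌋₊| ≤ |(X.returns i T ω : ℝ) - ρ * T| + 1 := by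
        have h5 := Nat.floor_le (mul_nonneg hρ (Nat.cast_nonneg T))
        have h6 := Nat.lt_floor_add_one (ρ * (T : ℝ))
        have h7 : |ρ * T - (⌊ρ * (T : ℝ)⌋₊ : ℝ)| ≤ 1 := by
          rw [abs_of_nonneg (by linarith)]; linarith
        exact (abs_sub_le _ (ρ * T) _).trans (by linarith)
      have h5 := mul_le_mul_of_nonneg_left h4 (M.ΔMax_nonneg i)
      have h6 := hK T ω
      have h7 := hK 0 ω
      have h8 := hsum T ω
      rw [abs_le] at h3 h6 h7 ⊢
      constructor <;> linarith [h3.1, h3.2, h6.1, h6.2, h7.1, h7.2]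
    have hI' : Integrable (fun ω => M.ΔMax i * (|(X.returns i T ω : ℝ) - ρ * T| + 1)) ℙ :=
      (hI.add (integrable_const 1)).const_mul _
    refine (integral_mono (hbI.add hgI).abs ((integrable_const (2 * c)).add hI') hle).trans ?_
    simp only [Pi.add_apply]
    rw [integral_add (integrable_const _) hI', integral_const_mul (M.ΔMax i),
      integral_add hI (integrable_const _)]
    simp only [integral_const, probReal_univ, one_smul]
    have := mul_le_mul_of_nonneg_left hE (M.ΔMax_nonneg i)
    linarith
  have hlim : Tendsto (fun T : ℕ => (2 * c + M.ΔMax i) * (T : ℝ)⁻¹ +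
      M.ΔMax i * (2 * κ + 1) * (√(T : ℝ) / T)) atTop (nhds 0) := by
    have h3 := (tendsto_inv_atTop_nhds_zero_nat (𝕜 := ℝ)).const_mul (2 * c + M.ΔMax i)
    have h4 := tendsto_sqrt_div.const_mul (M.ΔMax i * (2 * κ + 1))
    simpa using h3.add h4
  refine squeeze_zero_norm' ?_ hlim
  filter_upwards [eventually_gt_atTop 0] with T hT
  have hT' : (0 : ℝ) < T := by exact_mod_cast hT
  rw [avg, Real.norm_eq_abs, abs_mul, abs_of_pos (by positivity), one_div, inv_mul_le_iff₀ hT']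
  refine (hbound T hT).trans_eq ?_
  field_simp
  ring

end LawOfLargeNumbers

end Operation

end

/-! ### Reduction of feasible policies to stationary ones -/

section

variable {N : ℕ} {S : Type*} [Fintype S] [DecidableEq S]

open Classical in
/-- The regulation amounts allowed in a phase. -/
def Model.allowed (M : Model N S) {p : ℕ} (q : ZMod p × S) : Set (Fin N → ℝ) :=
  {y | (∀ i, 0 ≤ y i ∧ y i ≤ (if M.part q.1.val q.2 i then 1 else 0) * M.xMax i) ∧
    ∑ i, y i ≤ |M.G q.2|}

/-- A stationary randomized policy, represented by its mean regulation amounts `y` and mean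
degradation costs `c` in each phase, which satisfies the constraints of P1 on average and has
welfare at least `l`. -/
structure IsStationary (M : Model N S) {p : ℕ} [NeZero p] (w : ZMod p × S → ℝ)
    (y c : ZMod p × S → Fin N → ℝ) (l : ℝ) : Prop where
  y_mem : ∀ q i, y q i ∈ Set.Icc 0 (M.xMax i)
  c_mem : ∀ q i, c q i ∈ Set.Icc 0 (M.cMax i)
  /-- A lower bound, affine in amounts and costs, that holds for all allowed amounts,
  holds for the means. -/
  affine : ∀ (q : ZMod p × S) (k a : ℝ) (α J : Fin N → ℝ),
    (∀ v ∈ M.allowed q, k ≤ a + ∑ i, (α i * v i + J i * M.C i (v i))) →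
      k ≤ a + ∑ i, (α i * y q i + J i * c q i)
  degradation : ∀ i, ∑ q, w q * c q i ≤ M.cUp i
  energy : ∀ i, ∑ q, w q * (M.sign q.2 * y q i) = 0
  welfare : l ≤ ∑ i, M.ω i * M.U (∑ q, w q * y q i) -
    ∑ q, w q * (M.price q.2 * (|M.G q.2| - ∑ i, y q i))

theorem Model.U_mem (M : Model N S) {x : ℝ} (hx : x ∈ Set.Icc 0 (⨆ i, M.xMax i)) :
    M.U x ∈ Set.Icc 0 (M.μ * ⨆ i, M.xMax i) := by
  have h0 : (0 : ℝ) ≤ ⨆ i, M.xMax i := hx.1.trans hx.2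
  constructor
  · rw [← M.U_zero]
    exact M.U_mono ⟨le_rfl, h0⟩ hx hx.1
  · have := M.U_le x hx
    rw [M.U_zero, zero_add] at this
    exact this.trans (mul_le_mul_of_nonneg_left hx.2 M.μ_pos.le)

theorem Model.exists_abs_G_le (M : Model N S) : ∃ g, 0 ≤ g ∧ ∀ a, |M.G a| ≤ g :=
  ⟨∑ a, |M.G a|, Finset.sum_nonneg fun _ _ => abs_nonneg _, fun a =>
    Finset.single_le_sum (f := fun a => |M.G a|) (fun _ _ => abs_nonneg _) (Finset.mem_univ a)⟩

theorem Model.abs_cost_le (M : Model N S) {g : ℝ} (hg : ∀ a, |M.G a| ≤ g) (a : S) {y : Fin N → ℝ}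
    (hy : ∀ i, y i ∈ Set.Icc 0 (M.xMax i)) :
    |M.price a * (|M.G a| - ∑ i, y i)| ≤ (M.eMax + |M.eMin|) * (g + ∑ i, M.xMax i) := by
  rw [abs_mul]
  refine mul_le_mul (M.abs_price_le a) ?_ (abs_nonneg _) ((abs_nonneg _).trans (M.abs_price_le a))
  have h1 : 0 ≤ ∑ i, y i := Finset.sum_nonneg fun i _ => (hy i).1
  have h2 : ∑ i, y i ≤ ∑ i, M.xMax i := Finset.sum_le_sum fun i _ => (hy i).2
  have h3 := hg a
  have h4 := abs_nonneg (M.G a)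
  rw [abs_le]
  constructor <;> linarith

namespace Operation

variable {M : Model N S} {B : Battery N} {Ω : Type*} [mΩ : MeasurableSpace Ω] {ℙ : Measure Ω}
  {X : Operation M B ℙ}

theorem allowed_eq {p : ℕ} [NeZero p] (hp : ∀ t, M.part (t + p) = M.part t) (t : ℕ) (ω : Ω) :
    X.allowed t ω = M.allowed (X.phase p t ω) := by
  unfold allowed Model.allowed ind Present phase
  rw [show M.part ((t : ZMod p)).val = M.part t from Model.part_mod hp t]

theorem measurable_e (t : ℕ) : Measurable[X.ℱ t] (X.e t) := by
  have : X.e t = fun ω => M.price (X.A t ω) * (|M.G (X.A t ω)| - ∑ i, X.x i t ω) :=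
    funext fun ω => X.e_eq t ω
  rw [this]
  exact (X.measurable_A le_rfl M.price).mul ((X.measurable_A le_rfl fun a => |M.G a|).sub
    (Finset.measurable_sum _ fun i _ => X.measurable_x i t))

theorem Admissible.exists_abs_e_le (h : X.Admissible) : ∃ c, 0 ≤ c ∧ ∀ t ω, |X.e t ω| ≤ c := by
  obtain ⟨g, hg0, hg⟩ := M.exists_abs_G_le
  refine ⟨(M.eMax + |M.eMin|) * (g + ∑ i, M.xMax i), ?_, fun t ω => ?_⟩
  · exact mul_nonneg (add_nonneg M.eMax_nonneg (abs_nonneg _))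
      (add_nonneg hg0 (Finset.sum_nonneg fun i _ => (M.xMax_pos i).le))
  · rw [e_eq]
    exact M.abs_cost_le hg _ fun i => h.x_mem i t ω

variable [IsProbabilityMeasure ℙ]

theorem Admissible.integrable_e (h : X.Admissible) (t : ℕ) : Integrable (X.e t) ℙ := by
  obtain ⟨c, -, hc⟩ := h.exists_abs_e_le
  exact integrable_of_abs_le ((measurable_e t).mono (X.ℱ.le t) le_rfl) (hc t)

theorem Admissible.avg_x_mem (h : X.Admissible) (i : Fin N) (T : ℕ) :
    avg ℙ (X.x i) T ∈ Set.Icc 0 (⨆ i, M.xMax i) :=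
  M.Icc_subset i (avg_mem_Icc (h.x_mem i) (M.xMax_pos i).le T)

theorem Admissible.exists_abs_welfare_le (h : X.Admissible) : ∃ c, ∀ T, |X.welfare T| ≤ c := by
  obtain ⟨c, hc0, hc⟩ := h.exists_abs_e_le
  refine ⟨∑ i, M.ω i * (M.μ * ⨆ i, M.xMax i) + c, fun T => ?_⟩
  refine (abs_sub _ _).trans (add_le_add ?_ (abs_avg_le hc0 hc T))
  refine (Finset.abs_sum_le_sum_abs _ _).trans (Finset.sum_le_sum fun i _ => ?_)
  have hU := M.U_mem (h.avg_x_mem i T)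
  rw [abs_mul, abs_of_pos (M.ω_pos i), abs_of_nonneg hU.1]
  exact mul_le_mul_of_nonneg_left hU.2 (M.ω_pos i).le

section Phase

variable {p : ℕ} [NeZero p] {w : ZMod p × S → ℝ} {κ : ℝ}

/-- The Poisson estimate with Y = 1, which has no increments, leaves an error of order 1/T. -/
theorem tendsto_avg_phase (hw : IsPoisson p M.P w κ) (f : ZMod p × S → ℝ) :
    Tendsto (avg ℙ fun t ω => f (X.phase p t ω)) atTop (nhds (∑ q, w q * f q)) := by
  obtain ⟨R, hR⟩ : ∃ R, ∀ q, |f q| ≤ R := ⟨∑ q, |f q|, fun q =>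
    Finset.single_le_sum (f := fun q => |f q|) (fun _ _ => abs_nonneg _) (Finset.mem_univ q)⟩
  have hfI : ∀ t, Integrable (fun ω => f (X.phase p t ω)) ℙ := fun t =>
    integrable_of_abs_le ((X.measurable_phase le_rfl f).mono (X.ℱ.le t) le_rfl) fun ω => hR _
  have hkey := fun T => X.abs_sum_integral_mul_phase_le hw hR (Y := fun _ _ => 1)
    (c := fun _ => 1) (β := 0) (fun _ => measurable_const) (by simp) (by simp) T
  rw [tendsto_iff_norm_sub_tendsto_zero]
  have hlim : Tendsto (fun T : ℕ => κ * R * 2 * (T : ℝ)⁻¹) atTop (nhds 0) := by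
    simpa using (tendsto_inv_atTop_nhds_zero_nat (𝕜 := ℝ)).const_mul (κ * R * 2)
  refine squeeze_zero' (Eventually.of_forall fun _ => norm_nonneg _) ?_ hlim
  filter_upwards [eventually_gt_atTop 0] with T hT
  have hT' : (0 : ℝ) < T := by exact_mod_cast hT
  have h1 := hkey T
  have h2 : ∀ t, ∫ ω, 1 * (f (X.phase p t ω) - ∑ q, w q * f q) ∂ℙ =
      ∫ ω, f (X.phase p t ω) ∂ℙ - ∑ q, w q * f q := by
    intro t
    simp only [one_mul]
    rw [integral_sub (hfI t) (integrable_const _)]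
    simp
  simp only [h2, Finset.sum_sub_distrib, Finset.sum_const, Finset.card_range, nsmul_eq_mul] at h1
  have h3 : avg ℙ (fun t ω => f (X.phase p t ω)) T - ∑ q, w q * f q = (T : ℝ)⁻¹ *
      (∑ t ∈ Finset.range T, ∫ ω, f (X.phase p t ω) ∂ℙ - T * ∑ q, w q * f q) := by
    rw [avg]; field_simp
  rw [h3, norm_mul, Real.norm_eq_abs, Real.norm_eq_abs, abs_of_pos (inv_pos.2 hT'), mul_comm]
  refine mul_le_mul_of_nonneg_right (h1.trans_eq ?_) (inv_pos.2 hT').le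
  ring

variable (X) in
/-- The average of a process over the slots in phase `q`. -/
def phaseAvg (p : ℕ) (f : ℕ → Ω → ℝ) (q : ZMod p × S) (T : ℕ) : ℝ :=
  avg ℙ (fun t ω => (Pi.single q 1 : ZMod p × S → ℝ) (X.phase p t ω) * f t ω) T

omit [IsProbabilityMeasure ℙ] in
theorem integrable_phase_mul (g : ZMod p × S → ℝ) {f : ℕ → Ω → ℝ}
    (hf : ∀ t, Integrable (f t) ℙ) (t : ℕ) :
    Integrable (fun ω => g (X.phase p t ω) * f t ω) ℙ := by
  refine (hf t).bdd_mul (c := ∑ q, |g q|)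
    ((X.measurable_phase le_rfl g).mono (X.ℱ.le t) le_rfl).aestronglyMeasurable
    (ae_of_all _ fun ω => ?_)
  rw [Real.norm_eq_abs]
  exact Finset.single_le_sum (f := fun q => |g q|) (fun _ _ => abs_nonneg _)
    (Finset.mem_univ (X.phase p t ω))

omit [IsProbabilityMeasure ℙ] in
theorem avg_phase_mul (g : ZMod p × S → ℝ) {f : ℕ → Ω → ℝ} (hf : ∀ t, Integrable (f t) ℙ) (T : ℕ) :
    avg ℙ (fun t ω => g (X.phase p t ω) * f t ω) T = ∑ q, g q * X.phaseAvg p f q T := by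
  have h1 : (fun t ω => g (X.phase p t ω) * f t ω) = fun t ω => ∑ q,
      g q * ((Pi.single q 1 : ZMod p × S → ℝ) (X.phase p t ω) * f t ω) := by
    ext t ω
    simp [Pi.single_apply]
  rw [h1, avg_sum _ fun q t => (integrable_phase_mul _ hf t).const_mul _]
  exact Finset.sum_congr rfl fun q _ => avg_const_mul _ _ _

omit [IsProbabilityMeasure ℙ] in
theorem phaseAvg_mono {f g : ℕ → Ω → ℝ} (hf : ∀ t, Integrable (f t) ℙ)
    (hg : ∀ t, Integrable (g t) ℙ) (q : ZMod p × S)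
    (hfg : ∀ t ω, X.phase p t ω = q → f t ω ≤ g t ω) (T : ℕ) :
    X.phaseAvg p f q T ≤ X.phaseAvg p g q T := by
  refine avg_mono (fun t => integrable_phase_mul _ hf t) (fun t => integrable_phase_mul _ hg t)
    (fun t ω => ?_) T
  rw [Pi.single_apply]
  split_ifs with h
  · simpa using hfg t ω h
  · simp

omit [IsProbabilityMeasure ℙ] in
theorem phaseAvg_add {f g : ℕ → Ω → ℝ} (hf : ∀ t, Integrable (f t) ℙ)
    (hg : ∀ t, Integrable (g t) ℙ) (q : ZMod p × S) (T : ℕ) :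
    X.phaseAvg p (fun t ω => f t ω + g t ω) q T = X.phaseAvg p f q T + X.phaseAvg p g q T := by
  simp only [phaseAvg, mul_add]
  exact avg_add (integrable_phase_mul _ hf) (integrable_phase_mul _ hg) T

omit [IsProbabilityMeasure ℙ] in
theorem phaseAvg_sub {f g : ℕ → Ω → ℝ} (hf : ∀ t, Integrable (f t) ℙ)
    (hg : ∀ t, Integrable (g t) ℙ) (q : ZMod p × S) (T : ℕ) :
    X.phaseAvg p (fun t ω => f t ω - g t ω) q T = X.phaseAvg p f q T - X.phaseAvg p g q T := by
  simp only [phaseAvg, mul_sub]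
  exact avg_sub (integrable_phase_mul _ hf) (integrable_phase_mul _ hg) T

omit [IsProbabilityMeasure ℙ] in
theorem phaseAvg_sum {ι : Type*} (s : Finset ι) {f : ι → ℕ → Ω → ℝ}
    (hf : ∀ i t, Integrable (f i t) ℙ) (q : ZMod p × S) (T : ℕ) :
    X.phaseAvg p (fun t ω => ∑ i ∈ s, f i t ω) q T = ∑ i ∈ s, X.phaseAvg p (f i) q T := by
  simp only [phaseAvg, Finset.mul_sum]
  exact avg_sum s (fun i => integrable_phase_mul _ (hf i)) T

omit [IsProbabilityMeasure ℙ] [NeZero p] in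
theorem phaseAvg_const_mul (a : ℝ) (f : ℕ → Ω → ℝ) (q : ZMod p × S) (T : ℕ) :
    X.phaseAvg p (fun t ω => a * f t ω) q T = a * X.phaseAvg p f q T := by
  simp only [phaseAvg, mul_left_comm _ a]
  exact avg_const_mul _ _ _

theorem tendsto_phaseAvg_const (hw : IsPoisson p M.P w κ) (a : ℝ) (q : ZMod p × S) :
    Tendsto (X.phaseAvg p (fun _ _ => a) q) atTop (nhds (a * w q)) := by
  have h1 := tendsto_avg_phase (X := X) hw fun q' => (Pi.single q 1 : ZMod p × S → ℝ) q' * a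
  have h2 : ∑ q', w q' * ((Pi.single q 1 : ZMod p × S → ℝ) q' * a) = a * w q := by
    simp [Pi.single_apply, mul_comm]
  rw [h2] at h1
  exact h1

/-- Phase averages of a process with values in `[0, c]`. -/
theorem phaseAvg_mem {f : ℕ → Ω → ℝ} {c : ℝ} (hf : ∀ t, Integrable (f t) ℙ)
    (hc : ∀ t ω, f t ω ∈ Set.Icc 0 c) (q : ZMod p × S) (T : ℕ) :
    X.phaseAvg p f q T ∈ Set.Icc 0 (X.phaseAvg p (fun _ _ => c) q T) := by
  refine ⟨avg_nonneg (fun t ω => mul_nonneg ?_ (hc t ω).1) T,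
    phaseAvg_mono hf (fun _ => integrable_const _) q (fun t ω _ => (hc t ω).2) T⟩
  rw [Pi.single_apply]; split_ifs <;> norm_num

omit [NeZero p] in
theorem phaseAvg_const_le {c : ℝ} (hc : 0 ≤ c) (q : ZMod p × S) (T : ℕ) :
    X.phaseAvg p (fun _ _ => c) q T ≤ c := by
  refine (le_abs_self _).trans (abs_avg_le hc (fun t ω => ?_) T)
  rw [Pi.single_apply]; split_ifs <;> simp [abs_of_nonneg hc, hc]

/-- Every welfare level below the upper limit of a feasible policy is attained by a stationary
policy. -/
theorem Feasible.exists_isStationary (h : X.Feasible) (h1 : X.A1) (h2 : X.A2)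
    (hp : ∀ t, M.part (t + p) = M.part t) (hw : IsPoisson p M.P w κ) {l : ℝ}
    (hl : l < limsup X.welfare atTop) : ∃ y c, IsStationary M w y c l := by
  have hadm := h.admissible
  have hxI := hadm.integrable_x
  have hdI := hadm.integrable_deg
  obtain ⟨k, hk⟩ := hadm.exists_abs_welfare_le
  -- Horizons with welfare above l form a sequence; by compactness, a subsequence makes all phase
  -- averages of amounts and costs converge.
  have hfreq : ∃ᶠ T in atTop, l < X.welfare T := frequently_lt_of_lt_limsup
    (isBoundedUnder_of ⟨-k, fun T => (abs_le.1 (hk T)).1⟩).isCoboundedUnder_le hl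
  obtain ⟨φ, hφ, hφl⟩ := extraction_of_frequently_atTop hfreq
  let D : ℕ → (ZMod p × S → Fin N → ℝ) × (ZMod p × S → Fin N → ℝ) := fun n =>
    (fun q i => X.phaseAvg p (X.x i) q (φ n), fun q i => X.phaseAvg p (X.deg i) q (φ n))
  have hcMax : ∀ i, 0 ≤ M.cMax i := fun i => (M.cUp_mem i).1.trans (M.cUp_mem i).2
  have hD : ∀ n, D n ∈ Set.Icc (0 : (ZMod p × S → Fin N → ℝ) × (ZMod p × S → Fin N → ℝ))
      (fun _ i => M.xMax i, fun _ i => M.cMax i) := by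
    intro n
    refine ⟨⟨fun q i => ?_, fun q i => ?_⟩, ⟨fun q i => ?_, fun q i => ?_⟩⟩
    · exact (phaseAvg_mem (hxI i) (hadm.x_mem i) q _).1
    · exact (phaseAvg_mem (hdI i) (hadm.deg_mem i) q _).1
    · exact (phaseAvg_mem (hxI i) (hadm.x_mem i) q _).2.trans
        (phaseAvg_const_le (M.xMax_pos i).le q _)
    · exact (phaseAvg_mem (hdI i) (hadm.deg_mem i) q _).2.trans (phaseAvg_const_le (hcMax i) q _)
  obtain ⟨⟨v, d⟩, -, ψ, hψ, hlim⟩ := isCompact_Icc.tendsto_subseq hD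
  have hθ : Tendsto (fun n => φ (ψ n)) atTop atTop :=
    hφ.tendsto_atTop.comp hψ.tendsto_atTop
  rw [nhds_prod_eq, tendsto_prod_iff'] at hlim
  have hv : ∀ q i, Tendsto (fun n => X.phaseAvg p (X.x i) q (φ (ψ n))) atTop (nhds (v q i)) :=
    fun q i => (tendsto_pi_nhds.1 ((tendsto_pi_nhds.1 hlim.1) q)) i
  have hd : ∀ q i, Tendsto (fun n => X.phaseAvg p (X.deg i) q (φ (ψ n))) atTop (nhds (d q i)) :=
    fun q i => (tendsto_pi_nhds.1 ((tendsto_pi_nhds.1 hlim.2) q)) i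
  have hconst : ∀ a q, Tendsto (fun n => X.phaseAvg p (fun _ _ => a) q (φ (ψ n))) atTop
      (nhds (a * w q)) := fun a q => (tendsto_phaseAvg_const hw a q).comp hθ
  have hvb : ∀ q i, v q i ∈ Set.Icc 0 (M.xMax i * w q) := fun q i =>
    ⟨ge_of_tendsto' (hv q i) fun n => (phaseAvg_mem (hxI i) (hadm.x_mem i) q _).1,
      le_of_tendsto_of_tendsto' (hv q i) (hconst _ q) fun n =>
        (phaseAvg_mem (hxI i) (hadm.x_mem i) q _).2⟩
  have hdb : ∀ q i, d q i ∈ Set.Icc 0 (M.cMax i * w q) := fun q i =>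
    ⟨ge_of_tendsto' (hd q i) fun n => (phaseAvg_mem (hdI i) (hadm.deg_mem i) q _).1,
      le_of_tendsto_of_tendsto' (hd q i) (hconst _ q) fun n =>
        (phaseAvg_mem (hdI i) (hadm.deg_mem i) q _).2⟩
  -- A phase of weight 0 also has limiting phase average 0, so division by zero, which yields 0, is
  -- harmless.
  have hwv : ∀ q i, w q * (v q i / w q) = v q i := by
    intro q i
    by_cases hq : w q = 0
    · have := hvb q i
      rw [hq, mul_zero] at this
      rw [hq, zero_mul, le_antisymm this.2 this.1]
    · field_simp
  have hwd : ∀ q i, w q * (d q i / w q) = d q i := by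
    intro q i
    by_cases hq : w q = 0
    · have := hdb q i
      rw [hq, mul_zero] at this
      rw [hq, zero_mul, le_antisymm this.2 this.1]
    · field_simp
  have hdiv : ∀ q a b, 0 ≤ b → a ∈ Set.Icc 0 (b * w q) → a / w q ∈ Set.Icc 0 b := by
    intro q a b hb ha
    have hq := hw.weight_nonneg q
    exact ⟨div_nonneg ha.1 hq, div_le_of_le_mul₀ hq hb ha.2⟩
  have hone : ∀ f : ℕ → Ω → ℝ, (∀ t, Integrable (f t) ℙ) → ∀ T,
      avg ℙ f T = ∑ q, X.phaseAvg p f q T := by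
    intro f hf T
    have := avg_phase_mul (X := X) (p := p) (fun _ => 1) hf T
    simpa using this
  have hx : ∀ i, Tendsto (fun n => avg ℙ (X.x i) (φ (ψ n))) atTop (nhds (∑ q, v q i)) := by
    intro i
    simp only [hone _ (hxI i)]
    exact tendsto_finsetSum _ fun q _ => hv q i
  refine ⟨fun q i => v q i / w q, fun q i => d q i / w q,
    fun q i => hdiv q _ _ (M.xMax_pos i).le (hvb q i),
    fun q i => hdiv q _ _ (hcMax i) (hdb q i), ?_, ?_, ?_, ?_⟩
  -- An affine lower bound valid for all allowed amounts survives averaging over the slots in phase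
  -- q and passage to the limit. In a phase of weight 0 the zero allocation is allowed and serves
  -- instead.
  · intro q k a α J hle
    rcases (hw.weight_nonneg q).eq_or_lt with hq | hq
    · simp only [← hq, div_zero, mul_zero, add_zero, Finset.sum_const_zero]
      have := hle 0 ⟨fun i => ⟨le_rfl, mul_nonneg (by split_ifs <;> norm_num)
        (M.xMax_pos i).le⟩, by simp⟩
      simpa [M.C_zero] using this
    · have hI : ∀ i t, Integrable (fun ω => α i * X.x i t ω + J i * X.deg i t ω) ℙ := fun i t =>
        ((hxI i t).const_mul _).add ((hdI i t).const_mul _)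
      have hT : ∀ T, X.phaseAvg p (fun _ _ => k) q T ≤ X.phaseAvg p (fun _ _ => a) q T +
          ∑ i, (α i * X.phaseAvg p (X.x i) q T + J i * X.phaseAvg p (X.deg i) q T) := by
        intro T
        have h3 := phaseAvg_mono (X := X) (p := p) (f := fun _ _ => k)
          (g := fun t ω => a + ∑ i, (α i * X.x i t ω + J i * X.deg i t ω))
          (fun _ => integrable_const _)
          (fun t => (integrable_const a).add (integrable_finsetSum _ fun i _ => hI i t)) q
          (fun t ω hph => by
            have h4 := hle (fun i => X.x i t ω) (by
              rw [← hph, ← allowed_eq hp]; exact hadm t ω)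
            simpa only [deg_eq] using h4) T
        refine h3.trans_eq ?_
        rw [phaseAvg_add (f := fun _ _ => a) (fun _ => integrable_const _) (fun t =>
          integrable_finsetSum _ fun i _ => hI i t), phaseAvg_sum _ hI]
        congr 1
        refine Finset.sum_congr rfl fun i _ => ?_
        rw [phaseAvg_add (fun t => (hxI i t).const_mul _) fun t => (hdI i t).const_mul _,
          phaseAvg_const_mul, phaseAvg_const_mul]
      have h3 := le_of_tendsto_of_tendsto' (hconst k q) ((hconst a q).add
        (tendsto_finsetSum Finset.univ fun i _ => ((hv q i).const_mul (α i)).add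
          ((hd q i).const_mul (J i)))) fun n => hT _
      have h4 : a * w q + ∑ i, (α i * v q i + J i * d q i) =
          (a + ∑ i, (α i * (v q i / w q) + J i * (d q i / w q))) * w q := by
        rw [add_mul, Finset.sum_mul]
        congr 1
        refine Finset.sum_congr rfl fun i _ => ?_
        field_simp
      rw [h4] at h3
      exact le_of_mul_le_mul_right h3 hq
  · intro i
    simp only [hwd]
    have hdeg : Tendsto (fun n => avg ℙ (X.deg i) (φ (ψ n))) atTop (nhds (∑ q, d q i)) := by
      simp only [hone _ (hdI i)]
      exact tendsto_finsetSum _ fun q _ => hd q i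
    -- The constraint bounds a limsup, so along the subsequence the averages are eventually below
    -- every c > `cUp`.
    refine le_of_forall_gt_imp_ge_of_dense fun c hc => ?_
    have h3 := eventually_lt_of_limsup_lt ((h.degradation i).trans_lt hc)
      (isBoundedUnder_of ⟨M.cMax i, fun T => (avg_mem_Icc (hadm.deg_mem i) (hcMax i) T).2⟩)
    exact le_of_tendsto hdeg ((hθ.eventually h3).mono fun n hn => hn.le)
  · intro i
    have h3 : Tendsto (fun n => avg ℙ (X.b i) (φ (ψ n))) atTop (nhds 0) :=
      (h.tendsto_avg_b h1 h2 hp hw i).comp hθ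
    have h4 : Tendsto (fun n => avg ℙ (X.b i) (φ (ψ n))) atTop
        (nhds (∑ q : ZMod p × S, M.sign q.2 * v q i)) := by
      have h5 : ∀ T, avg ℙ (X.b i) T = ∑ q : ZMod p × S, M.sign q.2 * X.phaseAvg p (X.x i) q T := by
        intro T
        rw [← avg_phase_mul (X := X) (fun q : ZMod p × S => M.sign q.2) (hxI i)]
        congr 1
        ext t ω
        exact X.b_eq i t ω
      simp only [h5]
      exact tendsto_finsetSum _ fun q _ => (hv q i).const_mul _
    simp only [mul_left_comm (w _), hwv]
    exact tendsto_nhds_unique h4 h3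
  · have hterm : ∀ q : ZMod p × S, w q * (M.price q.2 * (|M.G q.2| - ∑ i, v q i / w q)) =
        M.price q.2 * (|M.G q.2| * w q - ∑ i, v q i) := by
      intro q
      rw [mul_left_comm, mul_sub, Finset.mul_sum]
      simp only [hwv, mul_comm (w q)]
    simp only [hwv, hterm]
    have he : Tendsto (fun n => avg ℙ X.e (φ (ψ n))) atTop
        (nhds (∑ q : ZMod p × S, M.price q.2 * (|M.G q.2| * w q - ∑ i, v q i))) := by
      have h5 : ∀ T, avg ℙ X.e T = ∑ q : ZMod p × S, M.price q.2 *
          (X.phaseAvg p (fun _ _ => |M.G q.2|) q T - ∑ i, X.phaseAvg p (X.x i) q T) := by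
        intro T
        rw [hone _ hadm.integrable_e]
        refine Finset.sum_congr rfl fun q _ => ?_
        rw [← phaseAvg_sum _ hxI, ← phaseAvg_sub (fun _ => integrable_const _) fun t =>
          integrable_finsetSum _ fun i _ => hxI i t, ← phaseAvg_const_mul]
        unfold phaseAvg
        congr 1
        ext t ω
        rw [Pi.single_apply, e_eq]
        split_ifs with hph
        · rw [← hph]; simp [phase]
        · simp
      simp only [h5]
      exact tendsto_finsetSum _ fun q _ => (((hconst _ q).sub
        (tendsto_finsetSum _ fun i _ => hv q i)).const_mul _)
    have hU : ∀ i, Tendsto (fun n => M.U (avg ℙ (X.x i) (φ (ψ n)))) atTop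
        (nhds (M.U (∑ q, v q i))) := by
      intro i
      have hmem : ∑ q, v q i ∈ Set.Icc 0 (⨆ i, M.xMax i) :=
        isClosed_Icc.mem_of_tendsto (hx i) (Eventually.of_forall fun n => hadm.avg_x_mem i _)
      exact (M.U_cont _ hmem).tendsto.comp (tendsto_nhdsWithin_iff.2
        ⟨hx i, Eventually.of_forall fun n => hadm.avg_x_mem i _⟩)
    have hW : Tendsto (fun n => X.welfare (φ (ψ n))) atTop
        (nhds (∑ i, M.ω i * M.U (∑ q, v q i) -
          ∑ q : ZMod p × S, M.price q.2 * (|M.G q.2| * w q - ∑ i, v q i))) :=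
      (tendsto_finsetSum _ fun i _ => (hU i).const_mul _).sub he
    exact ge_of_tendsto' hW fun n => (hφl (ψ n)).le

end Phase

end Operation

end

/-! ### Quadratic drift of the queues under WMRA -/

section

variable {N : ℕ} {S : Type*} [Fintype S] [DecidableEq S]

namespace Operation

section Average

variable {Ω : Type*} [mΩ : MeasurableSpace Ω] {ℙ : Measure Ω}

/-- A process with a nonnegative quadratic potential cannot correlate negatively with its drift. -/
theorem le_avg_of_drift {Y D : ℕ → Ω → ℝ} {β : ℝ}
    (h : ∀ t, ∫ ω, Y (t + 1) ω ^ 2 ∂ℙ ≤ ∫ ω, Y t ω ^ 2 ∂ℙ + 2 * ∫ ω, Y t ω * D t ω ∂ℙ + 2 * β)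
    {T : ℕ} (hT : 0 < T) :
    -(β + (∫ ω, Y 0 ω ^ 2 ∂ℙ) / 2 * (T : ℝ)⁻¹) ≤ avg ℙ (fun t ω => Y t ω * D t ω) T := by
  have hT' : (0 : ℝ) < T := by exact_mod_cast hT
  have hsum : ∀ T : ℕ, ∫ ω, Y T ω ^ 2 ∂ℙ ≤ ∫ ω, Y 0 ω ^ 2 ∂ℙ +
      2 * ∑ t ∈ Finset.range T, ∫ ω, Y t ω * D t ω ∂ℙ + 2 * β * T := by
    intro T
    induction T with
    | zero => simp
    | succ T ih =>
      rw [Finset.sum_range_succ]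
      push_cast
      linarith [h T]
  have h1 := hsum T
  have h2 : 0 ≤ ∫ ω, Y T ω ^ 2 ∂ℙ := integral_nonneg fun ω => sq_nonneg _
  rw [avg, one_div]
  have h3 : -(β + (∫ ω, Y 0 ω ^ 2 ∂ℙ) / 2 * (T : ℝ)⁻¹) =
      (T : ℝ)⁻¹ * -(β * T + (∫ ω, Y 0 ω ^ 2 ∂ℙ) / 2) := by
    field_simp
  rw [h3]
  exact mul_le_mul_of_nonneg_left (by linarith) (inv_pos.2 hT').le

/-- Jensen's inequality is used twice, for the expectation in each slot and for the time average. -/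
theorem avg_comp_le [IsProbabilityMeasure ℙ] {U : ℝ → ℝ} {R : ℝ}
    (hU : ConcaveOn ℝ (Set.Icc 0 R) U) (hUc : ContinuousOn U (Set.Icc 0 R)) {f : ℕ → Ω → ℝ}
    (hf : ∀ t ω, f t ω ∈ Set.Icc 0 R) (hfI : ∀ t, Integrable (f t) ℙ)
    (hUI : ∀ t, Integrable (fun ω => U (f t ω)) ℙ) {T : ℕ} (hT : 0 < T) :
    avg ℙ (fun t ω => U (f t ω)) T ≤ U (avg ℙ f T) := by
  have hT' : (T : ℝ) ≠ 0 := by exact_mod_cast hT.ne'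
  have h1 : ∀ t, ∫ ω, U (f t ω) ∂ℙ ≤ U (∫ ω, f t ω ∂ℙ) := fun t =>
    hU.le_map_integral hUc isClosed_Icc (ae_of_all _ (hf t)) (hfI t) (hUI t)
  have hmem : ∀ t, ∫ ω, f t ω ∂ℙ ∈ Set.Icc 0 R := fun t =>
    (convex_Icc 0 R).integral_mem isClosed_Icc (ae_of_all _ (hf t)) (hfI t)
  have h2 := hU.le_map_sum (t := Finset.range T) (w := fun _ => 1 / (T : ℝ))
    (p := fun t => ∫ ω, f t ω ∂ℙ) (fun _ _ => by positivity) (by simp [hT']) fun t _ => hmem t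
  simp only [smul_eq_mul, ← Finset.mul_sum] at h2
  refine le_trans ?_ h2
  exact mul_le_mul_of_nonneg_left (Finset.sum_le_sum fun t _ => h1 t) (by positivity)

end Average

variable {M : Model N S} {B : Battery N} {Ω : Type*} [mΩ : MeasurableSpace Ω] {ℙ : Measure Ω}
  {X : Operation M B ℙ} {V : ℝ} {z : Fin N → ℕ → Ω → ℝ}

theorem IsWMRA.measurable_H (h : X.IsWMRA V z) (i : Fin N) (t : ℕ) :
    Measurable[X.ℱ t] (X.H z i t) := by
  induction t with
  | zero => exact measurable_const
  | succ t ih =>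
    exact ((ih.add (h.z_adapted i t)).sub (X.measurable_x i t)).mono
      (X.ℱ.mono t.le_succ) le_rfl

theorem IsWMRA.abs_sub_x_le (h : X.IsWMRA V z) (i : Fin N) (t : ℕ) (ω : Ω) :
    |z i t ω - X.x i t ω| ≤ M.xMax i := by
  have h1 := h.z_mem i t ω
  have h2 := h.admissible.x_mem i t ω
  rw [abs_le]
  constructor <;> linarith [h1.1, h1.2, h2.1, h2.2]

theorem Admissible.abs_deg_sub_le (h : X.Admissible) (i : Fin N) (t : ℕ) (ω : Ω) :
    |X.deg i t ω - M.cUp i| ≤ M.cMax i := by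
  have h1 := h.deg_mem i t ω
  have h2 := M.cUp_mem i
  rw [abs_le]
  constructor <;> linarith [h1.1, h1.2, h2.1, h2.2]

theorem Admissible.abs_J_succ_sub_le (h : X.Admissible) (i : Fin N) (t : ℕ) (ω : Ω) :
    |X.J i (t + 1) ω - X.J i t ω| ≤ M.cMax i := by
  have h1 := abs_le.1 (h.abs_deg_sub_le i t ω)
  have h2 := X.J_nonneg i t ω
  rw [J, abs_le]
  rcases le_total (X.J i t ω + X.deg i t ω - M.cUp i) 0 with h3 | h3
  · rw [max_eq_right h3]
    constructor <;> linarith [h1.1, h1.2]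
  · rw [max_eq_left h3]
    constructor <;> linarith [h1.1, h1.2]

theorem Admissible.abs_K_succ_sub_le (h : X.Admissible) (h1 : X.A1) (V : ℝ) (i : Fin N) (t : ℕ)
    (ω : Ω) : |X.K V i (t + 1) ω - X.K V i t ω| ≤ M.xMax i + M.ΔMax i := by
  rw [X.K_succ V (fun t => h.b_of_absent t) t, add_assoc, add_sub_cancel_left]
  exact (abs_add_le _ _).trans (add_le_add (h.abs_b_le i t ω) (X.abs_jump_le h1 i t ω))

/-- An EV returning at t + 1 is absent in slot t. Hence the squared increment of K has no cross
term. -/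
theorem Admissible.b_mul_jump (h : X.Admissible) (i : Fin N) (t : ℕ) (ω : Ω) :
    X.b i t ω * X.jump i t ω = 0 := by
  rw [jump]
  split_ifs with hr
  · rw [h.b_of_absent t (X.isReturn_succ.1 hr).2, zero_mul]
  · rw [mul_zero]

variable [IsProbabilityMeasure ℙ]

/-- The virtual queue `K` is uncorrelated with the energy changes during absences. -/
theorem IsWMRA.integral_K_mul_jump (h : X.IsWMRA V z) (hV : 0 < V) (hV' : V ≤ vMax M B)
    (h1 : X.A1) (h3 : X.A3 V z) (i : Fin N) (t : ℕ) :
    ∫ ω, X.K V i t ω * X.jump i t ω ∂ℙ = 0 := by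
  obtain ⟨k, hk⟩ := h.exists_abs_K_le hV hV' i
  have hm : MeasurableSpace.comap (X.Θ V z t) inferInstance ≤ mΩ := by
    refine Measurable.comap_le (measurable_pi_iff.2 fun j => ?_)
    exact ((h.admissible.measurable_J j t).mono (X.ℱ.le t) le_rfl).prodMk
      (((h.measurable_H j t).mono (X.ℱ.le t) le_rfl).prodMk
        ((X.measurable_K V j t).mono (X.ℱ.le t) le_rfl))
  -- K is a component of the vector conditioned on in A3, so it can be pulled out of the conditional
  -- expectation.
  have hKm : Measurable[MeasurableSpace.comap (X.Θ V z t) inferInstance] (X.K V i t) :=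
    (((measurable_pi_apply i).snd.snd : Measurable fun v : Fin N → ℝ × ℝ × ℝ => (v i).2.2)).comp
      (comap_measurable (X.Θ V z t))
  have hf : ∀ k', Measurable
      (Set.indicator {ω | X.returnTime i (k' + 1) ω = t + 1} (X.gap i k')) := fun k' =>
    (X.measurable_gap i k').indicator
      (measurableSet_eq_fun (X.measurable_returnTime i (k' + 1)) measurable_const)
  have hfb : ∀ k' ω, |Set.indicator {ω | X.returnTime i (k' + 1) ω = t + 1} (X.gap i k') ω| ≤
      M.ΔMax i := fun k' ω => by
    rw [Set.indicator_apply]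
    split_ifs
    · exact h1 i k' ω
    · simpa using M.ΔMax_nonneg i
  have hI : ∀ k', Integrable (X.K V i t *
      Set.indicator {ω | X.returnTime i (k' + 1) ω = t + 1} (X.gap i k')) ℙ := fun k' =>
    integrable_of_abs_le (c := k * M.ΔMax i) ((hKm.mono hm le_rfl).mul (hf k')) fun ω => by
      rw [Pi.mul_apply, abs_mul]
      exact mul_le_mul (hk t ω) (hfb k' ω) (abs_nonneg _) ((abs_nonneg _).trans (hk t ω))
  have hzero : ∀ k', ∫ ω, X.K V i t ω *
      Set.indicator {ω | X.returnTime i (k' + 1) ω = t + 1} (X.gap i k') ω ∂ℙ = 0 := by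
    intro k'
    have h4 := condExp_mul_of_stronglyMeasurable_left (μ := ℙ) hKm.stronglyMeasurable (hI k')
      (integrable_of_abs_le (hf k') (hfb k'))
    have h5 := integral_condExp hm (μ := ℙ) (f := X.K V i t *
      Set.indicator {ω | X.returnTime i (k' + 1) ω = t + 1} (X.gap i k'))
    refine h5.symm.trans (integral_eq_zero_of_ae ?_)
    filter_upwards [h4, h3 i k' t] with ω hω hω'
    rw [hω, Pi.mul_apply, hω']
    simp
  simp only [jump_eq_sum, Finset.mul_sum]
  refine (integral_finsetSum _ fun k' _ => hI k').trans ?_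
  exact Finset.sum_eq_zero fun k' _ => hzero k'

theorem IsWMRA.integrable_z (h : X.IsWMRA V z) (i : Fin N) (t : ℕ) : Integrable (z i t) ℙ :=
  integrable_of_abs_le (c := M.xMax i) ((h.z_adapted i t).mono (X.ℱ.le t) le_rfl) fun ω => by
    rw [abs_of_nonneg (h.z_mem i t ω).1]; exact (h.z_mem i t ω).2

omit [IsProbabilityMeasure ℙ] in
theorem IsWMRA.integrable_J (h : X.IsWMRA V z) (hV : 0 < V) (hV' : V ≤ vMax M B) (i : Fin N)
    (t : ℕ) {f : Ω → ℝ} (hf : Integrable f ℙ) : Integrable (fun ω => X.J i t ω * f ω) ℙ := by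
  obtain ⟨c, -, hc⟩ := h.exists_J_le hV hV' i
  exact hf.bdd_mul (c := c * √t)
    ((h.admissible.measurable_J i t).mono (X.ℱ.le t) le_rfl).aestronglyMeasurable
    (ae_of_all _ fun ω => by
      rw [Real.norm_eq_abs, abs_of_nonneg (X.J_nonneg i t ω)]; exact hc t ω)

omit [IsProbabilityMeasure ℙ] in
theorem IsWMRA.integrable_H (h : X.IsWMRA V z) (hV : 0 < V) (hV' : V ≤ vMax M B) (i : Fin N)
    (t : ℕ) {f : Ω → ℝ} (hf : Integrable f ℙ) : Integrable (fun ω => X.H z i t ω * f ω) ℙ := by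
  obtain ⟨c, hc⟩ := h.exists_abs_H_le hV hV' i
  exact hf.bdd_mul (c := c) ((h.measurable_H i t).mono (X.ℱ.le t) le_rfl).aestronglyMeasurable
    (ae_of_all _ fun ω => by rw [Real.norm_eq_abs]; exact hc t ω)

omit [IsProbabilityMeasure ℙ] in
theorem IsWMRA.integrable_K (h : X.IsWMRA V z) (hV : 0 < V) (hV' : V ≤ vMax M B) (i : Fin N)
    (t : ℕ) {f : Ω → ℝ} (hf : Integrable f ℙ) : Integrable (fun ω => X.K V i t ω * f ω) ℙ := by
  obtain ⟨c, hc⟩ := h.exists_abs_K_le hV hV' i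
  exact hf.bdd_mul (c := c) ((X.measurable_K V i t).mono (X.ℱ.le t) le_rfl).aestronglyMeasurable
    (ae_of_all _ fun ω => by rw [Real.norm_eq_abs]; exact hc t ω)

theorem IsWMRA.integrable_J_self (h : X.IsWMRA V z) (hV : 0 < V) (hV' : V ≤ vMax M B) (i : Fin N)
    (t : ℕ) : Integrable (X.J i t) ℙ := by
  simpa using h.integrable_J hV hV' i t (integrable_const 1)

theorem IsWMRA.integrable_H_self (h : X.IsWMRA V z) (hV : 0 < V) (hV' : V ≤ vMax M B) (i : Fin N)
    (t : ℕ) : Integrable (X.H z i t) ℙ := by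
  simpa using h.integrable_H hV hV' i t (integrable_const 1)

theorem IsWMRA.integrable_K_self (h : X.IsWMRA V z) (hV : 0 < V) (hV' : V ≤ vMax M B) (i : Fin N)
    (t : ℕ) : Integrable (X.K V i t) ℙ := by
  simpa using h.integrable_K hV hV' i t (integrable_const 1)

/-- Drift of a process with bounded increments whose square is controlled pathwise. -/
theorem integral_sq_le_of_step {f g d : Ω → ℝ} {β : ℝ} (hg : Integrable (fun ω => g ω ^ 2) ℙ)
    (hf : Integrable (fun ω => f ω ^ 2) ℙ) (hfd : Integrable (fun ω => f ω * d ω) ℙ)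
    (hstep : ∀ ω, g ω ^ 2 ≤ f ω ^ 2 + 2 * (f ω * d ω) + 2 * β) :
    ∫ ω, g ω ^ 2 ∂ℙ ≤ ∫ ω, f ω ^ 2 ∂ℙ + 2 * ∫ ω, f ω * d ω ∂ℙ + 2 * β := by
  have hI : Integrable (fun ω => f ω ^ 2 + 2 * (f ω * d ω)) ℙ := hf.add (hfd.const_mul 2)
  have h1 := integral_mono hg (hI.add (integrable_const (2 * β))) hstep
  simp only [Pi.add_apply] at h1
  rw [integral_add hI (integrable_const _), integral_add hf (hfd.const_mul 2),
    integral_const_mul 2 (fun ω => f ω * d ω)] at h1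
  simpa using h1

theorem IsWMRA.le_avg_J (h : X.IsWMRA V z) (hV : 0 < V) (hV' : V ≤ vMax M B) (i : Fin N) {T : ℕ}
    (hT : 0 < T) : -(M.cMax i ^ 2 / 2) ≤
      avg ℙ (fun t ω => X.J i t ω * (X.deg i t ω - M.cUp i)) T := by
  have hsq : ∀ t, Integrable (fun ω => X.J i t ω ^ 2) ℙ := fun t => by
    simpa only [sq] using h.integrable_J hV hV' i t (h.integrable_J_self hV hV' i t)
  have h1 := le_avg_of_drift (ℙ := ℙ) (Y := X.J i) (D := fun t ω => X.deg i t ω - M.cUp i)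
    (β := M.cMax i ^ 2 / 2) (fun t => integral_sq_le_of_step (hsq _) (hsq t)
      (h.integrable_J hV hV' i t ((h.admissible.integrable_deg i t).sub (integrable_const _)))
      fun ω => ?_) hT
  · simpa [J] using h1
  -- Truncation at 0 does not increase the absolute value, so the drift bound is that of the
  -- untruncated step.
  · have h2 : |X.J i (t + 1) ω| ≤ |X.J i t ω + (X.deg i t ω - M.cUp i)| := by
      rw [J, abs_of_nonneg (le_max_right _ _), ← add_sub_assoc]
      exact max_le (le_abs_self _) (abs_nonneg _)
    have h3 := sq_le_sq' (neg_le_of_abs_le (h.admissible.abs_deg_sub_le i t ω))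
      (le_of_abs_le (h.admissible.abs_deg_sub_le i t ω))
    have h4 := sq_le_sq.2 h2
    nlinarith

theorem IsWMRA.le_avg_H (h : X.IsWMRA V z) (hV : 0 < V) (hV' : V ≤ vMax M B) (i : Fin N) {T : ℕ}
    (hT : 0 < T) : -(M.xMax i ^ 2 / 2) ≤
      avg ℙ (fun t ω => X.H z i t ω * (z i t ω - X.x i t ω)) T := by
  have hsq : ∀ t, Integrable (fun ω => X.H z i t ω ^ 2) ℙ := fun t => by
    simpa only [sq] using h.integrable_H hV hV' i t (h.integrable_H_self hV hV' i t)
  have h1 := le_avg_of_drift (ℙ := ℙ) (Y := X.H z i) (D := fun t ω => z i t ω - X.x i t ω)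
    (β := M.xMax i ^ 2 / 2) (fun t => integral_sq_le_of_step (hsq _) (hsq t)
      (h.integrable_H hV hV' i t ((h.integrable_z i t).sub (h.admissible.integrable_x i t)))
      fun ω => ?_) hT
  · simpa [H] using h1
  · have h3 := sq_le_sq' (neg_le_of_abs_le (h.abs_sub_x_le i t ω))
      (le_of_abs_le (h.abs_sub_x_le i t ω))
    rw [H]
    nlinarith

/-- Unlike J and H, K does not start at 0. Its initial energy depends on the battery and the initial
state, but is divided by T. -/
theorem IsWMRA.le_avg_K (h : X.IsWMRA V z) (hV : 0 < V) (hV' : V ≤ vMax M B) (h1 : X.A1)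
    (h3 : X.A3 V z) (i : Fin N) {T : ℕ} (hT : 0 < T) :
    -((M.xMax i ^ 2 + M.ΔMax i ^ 2) / 2 + (∫ ω, X.K V i 0 ω ^ 2 ∂ℙ) / 2 * (T : ℝ)⁻¹) ≤
      avg ℙ (fun t ω => X.K V i t ω * X.b i t ω) T := by
  have hsq : ∀ t, Integrable (fun ω => X.K V i t ω ^ 2) ℙ := fun t => by
    simpa only [sq] using h.integrable_K hV hV' i t (h.integrable_K_self hV hV' i t)
  have hbI := fun t => h.integrable_K hV hV' i t (h.admissible.integrable_b i t)
  have hjI := fun t => h.integrable_K hV hV' i t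
    (integrable_of_abs_le (X.measurable_jump i t) (X.abs_jump_le h1 i t))
  refine le_avg_of_drift (fun t => ?_) hT
  have h4 := integral_sq_le_of_step (β := (M.xMax i ^ 2 + M.ΔMax i ^ 2) / 2)
    (d := fun ω => X.b i t ω + X.jump i t ω) (hsq (t + 1)) (hsq t)
    (((hbI t).add (hjI t)).congr (ae_of_all _ fun ω => (mul_add _ _ _).symm)) fun ω => by
      have h5 := sq_le_sq' (neg_le_of_abs_le (h.admissible.abs_b_le i t ω))
        (le_of_abs_le (h.admissible.abs_b_le i t ω))
      have h6 := sq_le_sq' (neg_le_of_abs_le (X.abs_jump_le h1 i t ω))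
        (le_of_abs_le (X.abs_jump_le h1 i t ω))
      have h7 := h.admissible.b_mul_jump i t ω
      rw [X.K_succ V (fun t => h.admissible.b_of_absent t) t]
      nlinarith
  simp only [mul_add (X.K V i t _)] at h4
  rwa [integral_add (hbI t) (hjI t), h.integral_K_mul_jump hV hV' h1 h3, add_zero] at h4

end Operation

end

/-! ### Comparison of WMRA with stationary policies -/

section

variable {N : ℕ} {S : Type*} [Fintype S] [DecidableEq S]

/-- The constant in the performance bound of WMRA. -/
def performanceGap (M : Model N S) (κ : ℝ) : ℝ :=
  ∑ i, (M.cMax i ^ 2 / 2 + M.xMax i ^ 2 / 2 + (M.xMax i ^ 2 + M.ΔMax i ^ 2) / 2 +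
    κ * M.cMax i * M.cMax i + κ * M.xMax i * M.xMax i +
    κ * M.xMax i * (M.xMax i + M.ΔMax i))

namespace Operation

variable {M : Model N S} {B : Battery N} {Ω : Type*} [mΩ : MeasurableSpace Ω] {ℙ : Measure Ω}
  {X : Operation M B ℙ} {V : ℝ} {z : Fin N → ℕ → Ω → ℝ}
  {p : ℕ} [NeZero p] {w : ZMod p × S → ℝ} {κ l : ℝ} {y c : ZMod p × S → Fin N → ℝ}

theorem objective_identity (V P g s : ℝ) (J H K u d : Fin N → ℝ) :
    V * (P * (g - ∑ i, u i)) + ∑ i, (J i * d i - H i * u i + K i * (s * u i)) =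
      V * P * g + ∑ i, ((s * K i - V * P - H i) * u i + J i * d i) := by
  have : ∑ i, ((s * K i - V * P - H i) * u i + J i * d i) =
      ∑ i, (J i * d i - H i * u i + K i * (s * u i)) - V * P * ∑ i, u i := by
    rw [Finset.mul_sum, ← Finset.sum_sub_distrib]
    exact Finset.sum_congr rfl fun i _ => by ring
  rw [this]
  ring

/-- In each slot WMRA does at least as well, in drift plus penalty, as a stationary policy. -/
theorem IsWMRA.drift_le (h : X.IsWMRA V z) (hp : ∀ t, M.part (t + p) = M.part t)
    (hs : IsStationary M w y c l) {v : Fin N → ℝ} (hv : ∀ i, v i ∈ Set.Icc 0 (M.xMax i))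
    (t : ℕ) (ω : Ω) :
    V * X.e t ω + ∑ i, (X.J i t ω * (X.deg i t ω - M.cUp i) +
        X.H z i t ω * (z i t ω - X.x i t ω) + X.K V i t ω * X.b i t ω -
        M.ω i * V * M.U (z i t ω)) ≤
      V * (M.price (X.A t ω) * (|M.G (X.A t ω)| - ∑ i, y (X.phase p t ω) i)) +
      ∑ i, (X.J i t ω * (c (X.phase p t ω) i - M.cUp i) +
        X.H z i t ω * (v i - y (X.phase p t ω) i) +
        X.K V i t ω * (M.sign (X.A t ω) * y (X.phase p t ω) i) - M.ω i * V * M.U (v i)) := by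
  -- The lower bound k is the minimum attained by WMRA: as an affine bound on amounts and costs, it
  -- transfers to the stationary means.
  have h1 := hs.affine (X.phase p t ω) (X.objective V z t ω fun i => X.x i t ω)
    (V * M.price (X.A t ω) * |M.G (X.A t ω)|)
    (fun i => M.sign (X.A t ω) * X.K V i t ω - V * M.price (X.A t ω) - X.H z i t ω)
    (fun i => X.J i t ω) (fun u hu => isMinOn_iff.1 (h.isMinOn t ω) u (by
      rw [allowed_eq hp]; exact hu))
  rw [objective, ← objective_identity, ← objective_identity] at h1
  have h2 := Finset.sum_le_sum fun i (_ : i ∈ Finset.univ) =>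
    isMinOn_iff.1 (h.z_min i t ω) (v i) (hv i)
  simp only [e_eq, deg_eq, b_eq]
  simp only [mul_sub, Finset.sum_add_distrib, Finset.sum_sub_distrib] at h1 h2 ⊢
  linarith

variable [IsProbabilityMeasure ℙ]

section Penalty

variable {e : ℕ → Ω → ℝ} {f₁ f₂ f₃ f₄ : Fin N → ℕ → Ω → ℝ} (he : ∀ t, Integrable (e t) ℙ)
  (h₁ : ∀ i t, Integrable (f₁ i t) ℙ) (h₂ : ∀ i t, Integrable (f₂ i t) ℙ)
  (h₃ : ∀ i t, Integrable (f₃ i t) ℙ) (h₄ : ∀ i t, Integrable (f₄ i t) ℙ)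

omit [IsProbabilityMeasure ℙ]
include he h₁ h₂ h₃ h₄

theorem integrable_penalty_add_drift (V : ℝ) (t : ℕ) :
    Integrable (fun ω => V * e t ω + ∑ i, (f₁ i t ω + f₂ i t ω + f₃ i t ω - f₄ i t ω)) ℙ :=
  ((he t).const_mul V).add (integrable_finsetSum _ fun i _ =>
    (((h₁ i t).add (h₂ i t)).add (h₃ i t)).sub (h₄ i t))

theorem avg_penalty_add_drift (V : ℝ) (T : ℕ) :
    avg ℙ (fun t ω => V * e t ω + ∑ i, (f₁ i t ω + f₂ i t ω + f₃ i t ω - f₄ i t ω)) T =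
      V * avg ℙ e T + ∑ i, (avg ℙ (f₁ i) T + avg ℙ (f₂ i) T + avg ℙ (f₃ i) T -
        avg ℙ (f₄ i) T) := by
  have h₁₂ : ∀ i t, Integrable (fun ω => f₁ i t ω + f₂ i t ω) ℙ := fun i t =>
    (h₁ i t).add (h₂ i t)
  have h₁₂₃ : ∀ i t, Integrable (fun ω => f₁ i t ω + f₂ i t ω + f₃ i t ω) ℙ := fun i t =>
    (h₁₂ i t).add (h₃ i t)
  have h' : ∀ i t, Integrable (fun ω => f₁ i t ω + f₂ i t ω + f₃ i t ω - f₄ i t ω) ℙ := fun i t =>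
    (h₁₂₃ i t).sub (h₄ i t)
  rw [avg_add (fun t => (he t).const_mul V) fun t => integrable_finsetSum _ fun i _ => h' i t,
    avg_const_mul, avg_sum _ h']
  congr 1
  refine Finset.sum_congr rfl fun i _ => ?_
  rw [avg_sub (h₁₂₃ i) (h₄ i), avg_add (h₁₂ i) (h₃ i), avg_add (h₁ i) (h₂ i)]

end Penalty

theorem abs_avg_mul_phase_le (hw : IsPoisson p M.P w κ) {f : ZMod p × S → ℝ} {R : ℝ}
    (hf : ∀ q, |f q| ≤ R) {Y : ℕ → Ω → ℝ} {a : ℕ → ℝ} {β : ℝ}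
    (hY : ∀ t, Measurable[X.ℱ t] (Y t)) (ha : ∀ t ω, |Y t ω| ≤ a t)
    (hβ : ∀ t ω, |Y (t + 1) ω - Y t ω| ≤ β) {T : ℕ} (hT : 0 < T) :
    |avg ℙ (fun t ω => Y t ω * (f (X.phase p t ω) - ∑ q, w q * f q)) T| ≤
      κ * R * ((a 0 + a T) * (T : ℝ)⁻¹ + β) := by
  have hT' : (0 : ℝ) < T := by exact_mod_cast hT
  have h1 := X.abs_sum_integral_mul_phase_le hw hf hY ha hβ T
  rw [avg, abs_mul, abs_of_pos (by positivity), one_div, inv_mul_le_iff₀ hT']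
  refine h1.trans_eq ?_
  field_simp

section Stationary

variable (h : X.IsWMRA V z) (hV : 0 < V) (hV' : V ≤ vMax M B) (hw : IsPoisson p M.P w κ)
  (hs : IsStationary M w y c l) (i : Fin N)
include h hV hV' hw hs

/-- Since J ≥ 0 and the stationary mean cost is at most `cUp`, only the centred cost remains. The
increments of J are at most cMax, and J = O(√T) makes the boundary term √T/T. -/
theorem IsWMRA.exists_avg_J_le : ∃ r, ∀ T : ℕ, 0 < T →
    avg ℙ (fun t ω => X.J i t ω * (c (X.phase p t ω) i - M.cUp i)) T ≤
      κ * M.cMax i * M.cMax i + r * (√(T : ℝ) / T) := by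
  obtain ⟨a, -, ha⟩ := h.exists_J_le hV hV' i
  have hf : ∀ q, |c q i| ≤ M.cMax i := fun q => by
    rw [abs_of_nonneg (hs.c_mem q i).1]; exact (hs.c_mem q i).2
  have hfI : ∀ t, Integrable (fun ω => c (X.phase p t ω) i) ℙ := fun t =>
    integrable_of_abs_le ((X.measurable_phase le_rfl fun q => c q i).mono (X.ℱ.le t) le_rfl)
      fun ω => hf _
  refine ⟨κ * M.cMax i * a, fun T hT => ?_⟩
  have h1 := abs_avg_mul_phase_le (X := X) hw (f := fun q => c q i) hf
    (h.admissible.measurable_J i) (a := fun t => a * √t)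
    (fun t ω => by rw [abs_of_nonneg (X.J_nonneg i t ω)]; exact ha t ω)
    (h.admissible.abs_J_succ_sub_le i) hT
  have h2 := avg_mono (T := T)
    (fun t => h.integrable_J hV hV' i t ((hfI t).sub (integrable_const (M.cUp i))))
    (fun t => h.integrable_J hV hV' i t ((hfI t).sub (integrable_const (∑ q, w q * c q i))))
    (fun t ω => mul_le_mul_of_nonneg_left (sub_le_sub_left (hs.degradation i) _)
      (X.J_nonneg i t ω))
  refine h2.trans ((le_abs_self _).trans (h1.trans_eq ?_))
  simp only [Nat.cast_zero, Real.sqrt_zero]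
  ring

/-- The comparison value for z is the stationary mean of y, so the factor multiplying H is centred
and only the increments of H count. -/
theorem IsWMRA.exists_avg_H_le : ∃ r, ∀ T : ℕ, 0 < T →
    avg ℙ (fun t ω => X.H z i t ω * (∑ q, w q * y q i - y (X.phase p t ω) i)) T ≤
      κ * M.xMax i * M.xMax i + r * (T : ℝ)⁻¹ := by
  obtain ⟨a, ha⟩ := h.exists_abs_H_le hV hV' i
  have hf : ∀ q, |y q i| ≤ M.xMax i := fun q => by
    rw [abs_of_nonneg (hs.y_mem q i).1]; exact (hs.y_mem q i).2
  refine ⟨κ * M.xMax i * (a + a), fun T hT => ?_⟩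
  have h1 := abs_avg_mul_phase_le (X := X) hw (f := fun q => y q i) hf
    (h.measurable_H i) (a := fun _ => a) ha
    (fun t ω => by rw [H, add_sub_assoc, add_sub_cancel_left]; exact h.abs_sub_x_le i t ω) hT
  have h2 : avg ℙ (fun t ω => X.H z i t ω * (∑ q, w q * y q i - y (X.phase p t ω) i)) T =
      -avg ℙ (fun t ω => X.H z i t ω * (y (X.phase p t ω) i - ∑ q, w q * y q i)) T := by
    rw [← neg_one_mul, ← avg_const_mul]
    congr 1
    ext t ω
    ring
  rw [h2]
  refine (neg_le_abs _).trans (h1.trans_eq ?_)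
  ring

/-- Energy balance is precisely the statement that this factor is centred. The leading term involves
only the increments of K, hence no battery parameter. -/
theorem IsWMRA.exists_avg_K_le (hA1 : X.A1) : ∃ r, ∀ T : ℕ, 0 < T →
    avg ℙ (fun t ω => X.K V i t ω * (M.sign (X.A t ω) * y (X.phase p t ω) i)) T ≤
      κ * M.xMax i * (M.xMax i + M.ΔMax i) + r * (T : ℝ)⁻¹ := by
  obtain ⟨a, ha⟩ := h.exists_abs_K_le hV hV' i
  have hf : ∀ q : ZMod p × S, |M.sign q.2 * y q i| ≤ M.xMax i := fun q => by
    rw [abs_mul, abs_of_nonneg (hs.y_mem q i).1]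
    exact (mul_le_of_le_one_left (hs.y_mem q i).1 (M.abs_sign_le q.2)).trans (hs.y_mem q i).2
  refine ⟨κ * M.xMax i * (a + a), fun T hT => ?_⟩
  have h1 := abs_avg_mul_phase_le (X := X) hw (f := fun q => M.sign q.2 * y q i) hf
    (X.measurable_K V i) (a := fun _ => a) ha
    (h.admissible.abs_K_succ_sub_le hA1 V i) hT
  rw [hs.energy i] at h1
  simp only [sub_zero] at h1
  refine (le_abs_self _).trans (h1.trans_eq ?_)
  ring

omit hw hs

/-- H telescopes the difference of z and x, so their averages differ by E[H_T]/T, which tends to 0;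
uniform continuity of U does the rest. -/
theorem IsWMRA.tendsto_U_sub :
    Tendsto (fun T => M.U (avg ℙ (X.x i) T) - M.U (avg ℙ (z i) T)) atTop (nhds 0) := by
  obtain ⟨a, ha⟩ := h.exists_abs_H_le hV hV' i
  have hsub : ∀ T : ℕ, avg ℙ (z i) T - avg ℙ (X.x i) T = (T : ℝ)⁻¹ * ∫ ω, X.H z i T ω ∂ℙ := by
    intro T
    rw [avg, avg, one_div, ← mul_sub, ← Finset.sum_sub_distrib]
    congr 1
    induction T with
    | zero => simp [H]
    | succ T ih =>
      have h1 : ∫ ω, X.H z i (T + 1) ω ∂ℙ =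
          ∫ ω, X.H z i T ω ∂ℙ + ∫ ω, z i T ω ∂ℙ - ∫ ω, X.x i T ω ∂ℙ := by
        have hI : Integrable (fun ω => X.H z i T ω + z i T ω) ℙ :=
          (h.integrable_H_self hV hV' i T).add (h.integrable_z i T)
        simp only [H]
        rw [integral_sub hI (h.admissible.integrable_x i T),
          integral_add (h.integrable_H_self hV hV' i T) (h.integrable_z i T)]
      rw [Finset.sum_range_succ, ih, h1]
      ring
  have hz : ∀ T, avg ℙ (z i) T ∈ Set.Icc 0 (⨆ i, M.xMax i) := fun T =>
    M.Icc_subset i (avg_mem_Icc (h.z_mem i) (M.xMax_pos i).le T)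
  have hlim : Tendsto (fun T : ℕ => |a| * (T : ℝ)⁻¹) atTop (nhds 0) := by
    simpa using (tendsto_inv_atTop_nhds_zero_nat (𝕜 := ℝ)).const_mul |a|
  have huc := Metric.uniformContinuousOn_iff.1
    (isCompact_Icc.uniformContinuousOn_of_continuous M.U_cont)
  rw [Metric.tendsto_nhds]
  intro ε hε
  obtain ⟨δ, hδ, hδε⟩ := huc ε hε
  filter_upwards [(hlim.eventually_lt_const hδ)] with T hT
  have h1 := hδε _ (h.admissible.avg_x_mem i T) _ (hz T) (by
    rw [dist_comm, Real.dist_eq, hsub, abs_mul, abs_of_nonneg (by positivity : (0 : ℝ) ≤ (T : ℝ)⁻¹),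
      mul_comm]
    refine lt_of_le_of_lt (mul_le_mul_of_nonneg_right ?_ (by positivity)) hT
    exact (abs_integral_le_of_abs_le (ha T)).trans (le_abs_self a))
  rwa [Real.dist_eq, sub_zero]

end Stationary

/-- The welfare of WMRA falls short of that of a stationary policy by at most the order `1 / V`. -/
theorem IsWMRA.le_liminf_welfare (h : X.IsWMRA V z) (hV : 0 < V) (hV' : V ≤ vMax M B)
    (h1 : X.A1) (h3 : X.A3 V z) (hp : ∀ t, M.part (t + p) = M.part t)
    (hw : IsPoisson p M.P w κ) (hs : IsStationary M w y c l) :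
    l - performanceGap M κ / V ≤ liminf X.welfare atTop := by
  -- The comparison choice for the auxiliary variable is constant in time: the mean amount of the
  -- stationary policy.
  let v : Fin N → ℝ := fun i => ∑ q, w q * y q i
  have hv : ∀ i, v i ∈ Set.Icc 0 (M.xMax i) := fun i =>
    weighted_mem_Icc hw fun q => hs.y_mem q i
  choose rJ hJ using h.exists_avg_J_le hV hV' hw hs
  choose rH hH using h.exists_avg_H_le hV hV' hw hs
  choose rK hK using fun i => h.exists_avg_K_le hV hV' hw hs i h1
  let k : Fin N → ℝ := fun i => (∫ ω, X.K V i 0 ω ^ 2 ∂ℙ) / 2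
  -- All contributions depending on V, the battery or the initial state are gathered here; they
  -- vanish as T → ∞, leaving only `performanceGap`.
  let rem : Fin N → ℕ → ℝ := fun i T =>
    rJ i * (√(T : ℝ) / T) + (rH i + rK i + k i) * (T : ℝ)⁻¹
  have hrem : ∀ i, Tendsto (rem i) atTop (nhds 0) := fun i => by
    simpa using (tendsto_sqrt_div.const_mul (rJ i)).add
      ((tendsto_inv_atTop_nhds_zero_nat (𝕜 := ℝ)).const_mul (rH i + rK i + k i))
  let cost : ZMod p × S → ℝ := fun q => M.price q.2 * (|M.G q.2| - ∑ i, y q i)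
  obtain ⟨g, -, hg⟩ := M.exists_abs_G_le
  have hcostI : ∀ t, Integrable (fun ω => cost (X.phase p t ω)) ℙ := fun t =>
    integrable_of_abs_le ((X.measurable_phase le_rfl cost).mono (X.ℱ.le t) le_rfl)
      fun ω => M.abs_cost_le hg _ fun i => hs.y_mem _ i
  have hUm : ∀ i t, Measurable fun ω => M.U (z i t ω) := fun i t =>
    measurable_comp_of_continuousOn (M.xMax_pos i).le (M.U_cont.mono (M.Icc_subset i))
      ((h.z_adapted i t).mono (X.ℱ.le t) le_rfl) (h.z_mem i t)
  have hUI : ∀ i t, Integrable (fun ω => M.U (z i t ω)) ℙ := fun i t =>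
    integrable_of_abs_le (hUm i t) fun ω => by
      have := M.U_mem (M.Icc_subset i (h.z_mem i t ω))
      rw [abs_of_nonneg this.1]
      exact this.2
  have hyI : ∀ i t, Integrable (fun ω => y (X.phase p t ω) i) ℙ := fun i t =>
    integrable_of_abs_le (c := M.xMax i)
      ((X.measurable_phase le_rfl fun q => y q i).mono (X.ℱ.le t) le_rfl) fun ω => by
      rw [abs_of_nonneg (hs.y_mem _ i).1]; exact (hs.y_mem _ i).2
  have hcI : ∀ i t, Integrable (fun ω => c (X.phase p t ω) i) ℙ := fun i t =>
    integrable_of_abs_le (c := M.cMax i)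
      ((X.measurable_phase le_rfl fun q => c q i).mono (X.ℱ.le t) le_rfl) fun ω => by
      rw [abs_of_nonneg (hs.c_mem _ i).1]; exact (hs.c_mem _ i).2
  have hsyI : ∀ i t, Integrable (fun ω => M.sign (X.A t ω) * y (X.phase p t ω) i) ℙ := fun i t =>
    integrable_of_abs_le (c := M.xMax i)
      ((X.measurable_phase le_rfl fun q : ZMod p × S => M.sign q.2 * y q i).mono
        (X.ℱ.le t) le_rfl) fun ω => by
      rw [abs_mul, abs_of_nonneg (hs.y_mem _ i).1]
      exact (mul_le_of_le_one_left (hs.y_mem _ i).1 (M.abs_sign_le _)).trans (hs.y_mem _ i).2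
  have i1 : ∀ i t, Integrable (fun ω => X.J i t ω * (X.deg i t ω - M.cUp i)) ℙ := fun i t =>
    h.integrable_J hV hV' i t ((h.admissible.integrable_deg i t).sub (integrable_const (M.cUp i)))
  have i2 : ∀ i t, Integrable (fun ω => X.H z i t ω * (z i t ω - X.x i t ω)) ℙ := fun i t =>
    h.integrable_H hV hV' i t ((h.integrable_z i t).sub (h.admissible.integrable_x i t))
  have i3 : ∀ i t, Integrable (fun ω => X.K V i t ω * X.b i t ω) ℙ := fun i t =>
    h.integrable_K hV hV' i t (h.admissible.integrable_b i t)
  have i4 : ∀ i t, Integrable (fun ω => M.ω i * V * M.U (z i t ω)) ℙ := fun i t =>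
    (hUI i t).const_mul (M.ω i * V)
  have j1 : ∀ i t, Integrable (fun ω => X.J i t ω * (c (X.phase p t ω) i - M.cUp i)) ℙ := fun i t =>
    h.integrable_J hV hV' i t ((hcI i t).sub (integrable_const (M.cUp i)))
  have j2 : ∀ i t, Integrable (fun ω => X.H z i t ω * (v i - y (X.phase p t ω) i)) ℙ := fun i t =>
    h.integrable_H hV hV' i t ((integrable_const (v i)).sub (hyI i t))
  have j3 : ∀ i t,
      Integrable (fun ω => X.K V i t ω * (M.sign (X.A t ω) * y (X.phase p t ω) i)) ℙ := fun i t =>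
    h.integrable_K hV hV' i t (hsyI i t)
  have j4 : ∀ (i : Fin N) (_ : ℕ), Integrable (fun _ : Ω => M.ω i * V * M.U (v i)) ℙ := fun i _ =>
    integrable_const _
  have hmain : ∀ T : ℕ, 0 < T →
      V * avg ℙ X.e T - V * ∑ i, M.ω i * avg ℙ (fun t ω => M.U (z i t ω)) T ≤
      V * avg ℙ (fun t ω => cost (X.phase p t ω)) T - V * ∑ i, M.ω i * M.U (v i) +
        performanceGap M κ + ∑ i, rem i T := by
    intro T hT
    have hle := avg_mono (T := T)
      (integrable_penalty_add_drift h.admissible.integrable_e i1 i2 i3 i4 V)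
      (integrable_penalty_add_drift hcostI j1 j2 j3 j4 V) (h.drift_le hp hs hv)
    rw [avg_penalty_add_drift h.admissible.integrable_e i1 i2 i3 i4,
      avg_penalty_add_drift hcostI j1 j2 j3 j4] at hle
    have hterm : ∑ i, (avg ℙ (fun t ω => X.J i t ω * (c (X.phase p t ω) i - M.cUp i)) T +
        avg ℙ (fun t ω => X.H z i t ω * (v i - y (X.phase p t ω) i)) T +
        avg ℙ (fun t ω => X.K V i t ω * (M.sign (X.A t ω) * y (X.phase p t ω) i)) T -
        avg ℙ (fun _ _ => M.ω i * V * M.U (v i)) T) -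
        ∑ i, (avg ℙ (fun t ω => X.J i t ω * (X.deg i t ω - M.cUp i)) T +
        avg ℙ (fun t ω => X.H z i t ω * (z i t ω - X.x i t ω)) T +
        avg ℙ (fun t ω => X.K V i t ω * X.b i t ω) T -
        avg ℙ (fun t ω => M.ω i * V * M.U (z i t ω)) T) ≤
        V * ∑ i, M.ω i * avg ℙ (fun t ω => M.U (z i t ω)) T - V * ∑ i, M.ω i * M.U (v i) +
          performanceGap M κ + ∑ i, rem i T := by
      rw [performanceGap, Finset.mul_sum, Finset.mul_sum, ← Finset.sum_sub_distrib,
        ← Finset.sum_sub_distrib, ← Finset.sum_add_distrib, ← Finset.sum_add_distrib]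
      refine Finset.sum_le_sum fun i _ => ?_
      rw [avg_const _ hT, avg_const_mul]
      have hH' : avg ℙ (fun t ω => X.H z i t ω * (v i - y (X.phase p t ω) i)) T ≤
          κ * M.xMax i * M.xMax i + rH i * (T : ℝ)⁻¹ := hH i T hT
      have hr : rem i T = rJ i * (√(T : ℝ) / T) + (rH i + rK i +
          (∫ ω, X.K V i 0 ω ^ 2 ∂ℙ) / 2) * (T : ℝ)⁻¹ := rfl
      rw [hr]
      linarith [hJ i T hT, hK i T hT, h.le_avg_J hV hV' i hT, h.le_avg_H hV hV' i hT,
        h.le_avg_K hV hV' h1 h3 i hT]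
    linarith
  -- Jensen replaces the average utility of z by the utility of its average, and the first sum
  -- exchanges z for the actual amounts at vanishing cost.
  have hlow : ∀ T : ℕ, 0 < T → ∑ i, M.ω i * (M.U (avg ℙ (X.x i) T) - M.U (avg ℙ (z i) T)) +
      ∑ i, M.ω i * M.U (v i) - avg ℙ (fun t ω => cost (X.phase p t ω)) T -
      (performanceGap M κ + ∑ i, rem i T) / V ≤ X.welfare T := by
    intro T hT
    have h4 : ∑ i, M.ω i * avg ℙ (fun t ω => M.U (z i t ω)) T ≤
        ∑ i, M.ω i * M.U (avg ℙ (z i) T) := Finset.sum_le_sum fun i _ =>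
      mul_le_mul_of_nonneg_left (avg_comp_le M.U_concave M.U_cont
        (fun t ω => M.Icc_subset i (h.z_mem i t ω)) (h.integrable_z i) (hUI i) hT) (M.ω_pos i).le
    have h5 : avg ℙ X.e T - ∑ i, M.ω i * avg ℙ (fun t ω => M.U (z i t ω)) T -
        avg ℙ (fun t ω => cost (X.phase p t ω)) T + ∑ i, M.ω i * M.U (v i) ≤
        (performanceGap M κ + ∑ i, rem i T) / V := by
      rw [le_div_iff₀ hV]
      linarith [hmain T hT]
    simp only [welfare, mul_sub, Finset.sum_sub_distrib]
    linarith
  have hlim := ((tendsto_finsetSum Finset.univ fun i _ =>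
    (h.tendsto_U_sub hV hV' i).const_mul (M.ω i)).add_const (∑ i, M.ω i * M.U (v i))).sub
    (tendsto_avg_phase (X := X) hw cost) |>.sub
    (((tendsto_finsetSum Finset.univ fun i _ => hrem i).const_add (performanceGap M κ)).div_const V)
  obtain ⟨k', hk'⟩ := h.admissible.exists_abs_welfare_le
  have h6 := liminf_le_liminf ((eventually_gt_atTop 0).mono hlow) hlim.isBoundedUnder_ge
    (isBoundedUnder_of ⟨k', fun T => (abs_le.1 (hk' T)).2⟩).isCoboundedUnder_ge
  rw [hlim.liminf_eq] at h6
  refine le_trans ?_ h6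
  simp only [mul_zero, Finset.sum_const_zero, zero_add, add_zero]
  linarith [hs.welfare]

end Operation

end

end V2G

end

theorem theorem2 {N : ℕ} {S : Type*} [Fintype S] [DecidableEq S] (M : V2G.Model N S)
    (hirr : M.P.IsIrreducible) (haper : V2G.Aperiodic M.P) :
    -- 1) the WMRA allocations are feasible for P1
    (∀ (B : V2G.Battery N) (V : ℝ), 0 < V → V ≤ V2G.vMax M B →
      ∀ (Ω : Type*) [MeasurableSpace Ω] (ℙ : Measure Ω) [IsProbabilityMeasure ℙ]
        (X : V2G.Operation M B ℙ) (z : Fin N → ℕ → Ω → ℝ),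
        X.A1 → X.A2 → X.IsWMRA V z → X.A3 V z → X.Feasible) ∧
    -- 2) their welfare is within `O(1/V)` of that of every feasible policy
    (∀ p : ℕ, 0 < p → (∀ t, M.part (t + p) = M.part t) →
      ∃ C : ℝ, ∀ (B : V2G.Battery N) (V : ℝ), 0 < V → V ≤ V2G.vMax M B →
      ∀ (Ω : Type*) [MeasurableSpace Ω] (ℙ : Measure Ω) [IsProbabilityMeasure ℙ]
        (X : V2G.Operation M B ℙ) (z : Fin N → ℕ → Ω → ℝ),
        X.A1 → X.A2 → X.IsWMRA V z → X.A3 V z →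
      ∀ (Ω' : Type*) [MeasurableSpace Ω'] (ℙ' : Measure Ω') [IsProbabilityMeasure ℙ']
        (Y : V2G.Operation M B ℙ'), Y.A1 → Y.A2 → Y.Feasible →
        limsup Y.welfare atTop - C / V ≤ liminf X.welfare atTop) := by
  refine ⟨fun B V hV hV' Ω _ ℙ _ X z _ _ h _ => h.feasible hV hV', fun p hp hper => ?_⟩
  have : NeZero p := ⟨hp.ne'⟩
  rcases isEmpty_or_nonempty S with hS | hS
  -- Without states there is no operation, since a probability space has a point.
  · refine ⟨0, fun B V hV hV' Ω _ ℙ _ X z _ _ _ _ => ?_⟩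
    obtain ⟨ω⟩ := nonempty_of_isProbabilityMeasure ℙ
    exact hS.elim (X.A 0 ω)
  -- κ is obtained from P and p alone, before V, the battery and the processes are introduced; this
  -- makes the constant uniform.
  · obtain ⟨w, κ, hw⟩ := V2G.exists_isPoisson (p := p) M.P_stochastic hirr haper
    refine ⟨V2G.performanceGap M κ, ?_⟩
    intro B V hV hV' Ω _ ℙ _ X z h1 _ h h3 Ω' _ ℙ' _ Y hY1 hY2 hY
    rw [sub_le_iff_le_add]
    -- Each level l strictly below the limsup is attained by a stationary policy, which suffices by
    -- density.
    refine le_of_forall_lt_imp_le_of_dense fun l hl => ?_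
    obtain ⟨y, c, hs⟩ := hY.exists_isStationary hY1 hY2 hper hw hl
    linarith [h.le_liminf_welfare hV hV' h1 h3 hper hw hs]
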